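/- All Banach spaces are real, $\mathbb N=\{1,2,\dots\}$, $[\mathbb N]^{\omega}$ is the set of infinite subsets of $\mathbb N$, and $\mathcal L(X)$ is the algebra of bounded operators on $X$ with the operator norm. For a basis $(e_j)$ of $X$ put $X_k=\overline{\mathrm{span}}(e_j:j\ge k)$. Vectors $(f_j)$ are $c$-equivalent to the unit vector basis of $\ell_1$ (or $\ell_1^n$) if there are $A,B>0$ with $A\ge cB$ and $A\sum|a_j|\le\|\sum a_jf_j\|\le B\sum|a_j|$ for all finitely supported scalars $(a_j)$; they are equivalent to it if this holds for some $c>0$. For $\mathcal T\subset\mathcal L(X)$ let $\mathcal J^{\mathcal T}$ be the closure of $\{\sum_{j=1}^nA_jT_jB_j:\ n\in\mathbb N,\ T_j\in\mathcal T,\ A_j,B_j\in\mathcal L(X)\}$, and $\mathcal J^T=\mathcal J^{\{T\}}$. A closed ideal is a closed subspace of $\mathcal L(X)$ that is closed under multiplication from both sides by elements of $\mathcal L(X)$. A spatial projection (with respect to an unconditional basis $(e_j)$) is a bounded operator $P$ with $Pe_j=e_j$ for $j\in A$ and $Pe_j=0$ for $j\notin A$, for some infinite $A\subset\mathbb N$.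 A family $(T_N:N\in[\mathbb N]^\omega)$ in $\mathcal L(X)$ satisfies (T) if there is $\delta>0$ such that, for all $M,N\in[\mathbb N]^\omega$, $T_M\in\mathcal J^{T_N}$ if $M\subset N$, and $\mathrm{dist}(T_M,\mathcal J^{T_N})\ge\delta$ if $M\setminus N$ is infinite. **Schreier families and Tsirelson spaces.** For finite sets $A,B\subset\mathbb N$, write $A<B$ if $a<b$ for all $a\in A$, $b\in B$, and $n\le A$ (resp. $n<A$) if $n\le a$ (resp. $n<a$) for all $a\in A$. Let $\mathcal S_0=\{\emptyset\}\cup\{\{n\}:n\in\mathbb N\}$; let $\mathcal S_{\gamma+1}$ be the set of all $\bigcup_{i=1}^nE_i$ with $E_i\in\mathcal S_\gamma$, $n\le E_i$ for all $i$, and $E_i<E_j$ for $i<j$; and for a countable limit ordinal $\xi$ let $\mathcal S_\xi=\{E:\exists n\ (n\le E,\ E\in\mathcal S_{\alpha(\xi,n)})\}$, where $(\alpha(\xi,n))_n$ is any fixed strictly increasing sequence of successor ordinals with supremum $\xi$ such that $\alpha(\xi,1)=1$ and $A\cup B\in\mathcal S_{\alpha(\xi,n+1)}$ whenever $A,B\in\mathcal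 S_{\alpha(\xi,n)}$ and $1<A<B$. For $0<\theta<1$, $T[\mathcal S_\xi,\theta]$ is the completion of $c_{00}$ under the norm given implicitly by $$\|x\|=\max\Big\{\|x\|_\infty,\ \theta\sup\Big\{\sum_{i=1}^k\|E_ix\|:\ E_1<\dots<E_k\text{ finite, nonempty},\ \{\min E_1,\dots,\min E_k\}\in\mathcal S_\xi\Big\}\Big\}$$ (that is, $\|x\|=\sup_n\|x\|_n$, where $\|\cdot\|_0=\|\cdot\|_\infty$ and $\|\cdot\|_{n+1}$ is the right-hand side with $\|\cdot\|_n$ in place of $\|\cdot\|$). **Theorem.** (1) (Johnson) Let $X$ be a Banach space with a normalized $1$-unconditional basis $(e_j)$ that is not equivalent to the unit vector basis of $\ell_1$. Suppose that for some $c>0$ and some sequence $(L(m))_{m\ge1}\subset\mathbb N$ the following holds: for every $m\in\mathbb N$ and every $m$-dimensional subspace $E$ of $X_{L(m)}$ there are vectors $f_1,\dots,f_{L(m)}\in X_{L(m)}$ that are $c$-equivalent to the unit vector basis of $\ell_1^{L(m)}$ and an automorphism $S$ of $X_{L(m)}$ with $\|S\|\,\|S^{-1}\|\le2$ and $S(E)\subset\mathrm{span}(f_j:j\le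 L(m))$. Then there is a family $(T_N:N\in[\mathbb N]^\omega)$ of spatial projections on $X$ that satisfies (T). (2) There is a sequence $(L(m))_{m\ge1}\subset\mathbb N$ such that, for every Banach space $Y$ with a $1$-unconditional basis, every $m\in\mathbb N$ and every $m$-dimensional subspace $E$ of $Y$, there are an automorphism $S$ of $Y$ with $\|S\|\,\|S^{-1}\|\le2$ and pairwise disjointly supported vectors $x_1,\dots,x_{L(m)}\in Y$ with $S(E)\subset\mathrm{span}(x_j)$, and such that, for all $1\le\xi<\omega_1$ and $0<\theta<1$, the following holds for $X=T[\mathcal S_\xi,\theta]$. The unit vectors $(e_j)$ form a normalized $1$-unconditional basis of $X$ that is not equivalent to the unit vector basis of $\ell_1$, and: (a) for every $m\in\mathbb N$ and every $m$-dimensional subspace $E$ of $X_{L(m)}$ there are pairwise disjointly supported normalized vectors $x_1,\dots,x_{L(m)}\in X_{L(m)}$ that are $\frac\theta3$-equivalent to the unit vector basis of $\ell_1^{L(m)}$ and an automorphism $S$ of $X_{L(m)}$ with $\|S\|\,\|S^{-1}\|\le2$ and $S(E)\subset\mathrm{span}(x_j:j\le L(m))$; (b) there is a family $(T_N:N\in[\mathbb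 N]^\omega)$ of spatial projections on $X$ that satisfies (T); (c) $\mathcal L(X)$ has exactly $2^{\mathfrak c}$ closed ideals. -/

import Mathlib

universe u

open scoped ENNReal

noncomputable section

/-! ### Schreier families -/

/-- `Schreier α ξ E` says that the finite set `E` of positive integers belongs to the Schreier
family `𝓢_ξ`, where `α ξ n` (used only for limit `ξ`) is the approximating sequence of `ξ`. -/
inductive Schreier (α : Ordinal.{0} → ℕ+ → Ordinal.{0}) : Ordinal.{0} → Finset ℕ+ → Prop
  | zero_empty : Schreier α 0 ∅
  | zero_singleton (n : ℕ+) : Schreier α 0 {n}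
  | succ {γ : Ordinal.{0}} {n : ℕ} {F : Finset ℕ+} (E : Fin n → Finset ℕ+)
      (hn : ∀ i, ∀ k ∈ E i, n ≤ (k : ℕ))
      (hlt : ∀ i j, i < j → ∀ a ∈ E i, ∀ b ∈ E j, a < b)
      (hE : ∀ i, Schreier α γ (E i))
      (hF : F = Finset.univ.biUnion E) : Schreier α (γ + 1) F
  | limit {ξ : Ordinal.{0}} {E : Finset ℕ+} (hξ : Order.IsSuccLimit ξ) (n : ℕ+)
      (hn : ∀ k ∈ E, n ≤ k) (hE : Schreier α (α ξ n) E) : Schreier α ξ E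

/-- The Schreier family `𝓢_ξ`. -/
def schreierFamily (α : Ordinal.{0} → ℕ+ → Ordinal.{0}) (ξ : Ordinal.{0}) : Set (Finset ℕ+) :=
  {E | Schreier α ξ E}

/-- The conditions on the approximating sequences `(α ξ n)ₙ` of the countable limit ordinals `ξ`:
they are sequences of successor ordinals below `ξ` which strictly increase to `ξ`, which start
with `1`, and for which `A ∪ B ∈ 𝓢_{α ξ (n+1)}` whenever `A, B ∈ 𝓢_{α ξ n}` and `1 < A < B`. -/
structure IsApproximating (α : Ordinal.{0} → ℕ+ → Ordinal.{0}) : Prop where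
  succ : ∀ ξ < Ordinal.omega 1, Order.IsSuccLimit ξ → ∀ n, ∃ β, α ξ n = β + 1
  lt : ∀ ξ < Ordinal.omega 1, Order.IsSuccLimit ξ → ∀ n, α ξ n < ξ
  strictMono : ∀ ξ < Ordinal.omega 1, Order.IsSuccLimit ξ → StrictMono (α ξ)
  cofinal : ∀ ξ < Ordinal.omega 1, Order.IsSuccLimit ξ → ∀ γ < ξ, ∃ n, γ < α ξ n
  one : ∀ ξ < Ordinal.omega 1, Order.IsSuccLimit ξ → α ξ 1 = 1
  union : ∀ ξ < Ordinal.omega 1, Order.IsSuccLimit ξ → ∀ (n : ℕ+) (A B : Finset ℕ+),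
    A ∈ schreierFamily α (α ξ n) → B ∈ schreierFamily α (α ξ n) →
    (∀ a ∈ A, 1 < a) → (∀ a ∈ A, ∀ b ∈ B, a < b) → A ∪ B ∈ schreierFamily α (α ξ (n + 1))

/-! ### The Tsirelson space `T[𝓕, θ]` -/

/-- `(E₁, …, E_k)` is `𝓕`-admissible: `E₁ < ⋯ < E_k` are nonempty and `{min Eᵢ} ∈ 𝓕`. -/
def IsAdmissible (F : Set (Finset ℕ+)) {k : ℕ} (E : Fin k → Finset ℕ+) : Prop :=
  (∀ i j, i < j → ∀ a ∈ E i, ∀ b ∈ E j, a < b) ∧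
  ∃ m : Fin k → ℕ+, (∀ i, IsLeast (E i : Set ℕ+) (m i)) ∧ Finset.univ.image m ∈ F

/-- `E x`, the restriction of `x ∈ c₀₀` to the coordinates in `E`. -/
def restrictTo (E : Finset ℕ+) (x : ℕ+ →₀ ℝ) : ℕ+ →₀ ℝ := x.filter (· ∈ E)

/-- The supremum norm on `c₀₀`. -/
def supENorm (x : ℕ+ →₀ ℝ) : ℝ≥0∞ := ⨆ j, ‖x j‖ₑ

/-- The iterates `‖·‖₀ = ‖·‖_∞` and
`‖x‖_{n+1} = max (‖x‖_∞, θ sup {∑ ‖Eᵢ x‖ₙ : (Eᵢ) admissible})`. -/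
def tsirelsonIter (F : Set (Finset ℕ+)) (θ : ℝ) : ℕ → (ℕ+ →₀ ℝ) → ℝ≥0∞
  | 0, x => supENorm x
  | n + 1, x => max (supENorm x) (ENNReal.ofReal θ *
      ⨆ (k : ℕ) (E : Fin k → Finset ℕ+) (_ : IsAdmissible F E),
        ∑ i, tsirelsonIter F θ n (restrictTo (E i) x))

/-- The Tsirelson norm, the limit of the increasing sequence of iterates. It solves the implicit
equation, see `tsirelsonENorm_eq`. -/
def tsirelsonENorm (F : Set (Finset ℕ+)) (θ : ℝ) (x : ℕ+ →₀ ℝ) : ℝ≥0∞ :=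
  ⨆ n, tsirelsonIter F θ n x

theorem tsirelsonIter_mono (F : Set (Finset ℕ+)) (θ : ℝ) (x : ℕ+ →₀ ℝ) :
    Monotone (fun n => tsirelsonIter F θ n x) := by
  refine monotone_nat_of_le_succ fun n => ?_
  induction n generalizing x with
  | zero => exact le_max_left _ _
  | succ n ih =>
    simp only [tsirelsonIter] at ih ⊢
    gcongr
    exact ih _

/-- The implicit equation
`‖x‖ = max (‖x‖_∞, θ sup {∑ ‖Eᵢ x‖ : (Eᵢ) is 𝓕-admissible})`. -/
theorem tsirelsonENorm_eq (F : Set (Finset ℕ+)) (θ : ℝ) (x : ℕ+ →₀ ℝ) :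
    tsirelsonENorm F θ x = max (supENorm x) (ENNReal.ofReal θ *
      ⨆ (k : ℕ) (E : Fin k → Finset ℕ+) (_ : IsAdmissible F E),
        ∑ i, tsirelsonENorm F θ (restrictTo (E i) x)) := by
  apply le_antisymm
  · refine iSup_le fun n => ?_
    cases n with
    | zero => exact le_max_left _ _
    | succ n =>
      simp only [tsirelsonIter]
      gcongr
      exact le_iSup (fun n => tsirelsonIter F θ n _) n
  · refine max_le (le_iSup (fun n => tsirelsonIter F θ n x) 0) ?_
    simp only [ENNReal.mul_iSup]
    refine iSup_le fun k => iSup_le fun E => iSup_le fun hE => ?_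
    simp only [tsirelsonENorm]
    rw [ENNReal.finsetSum_iSup_of_monotone (fun i => tsirelsonIter_mono F θ _), ENNReal.mul_iSup]
    refine iSup_le fun n => le_trans ?_ (le_iSup (fun n => tsirelsonIter F θ n x) (n + 1))
    simp only [tsirelsonIter]
    refine le_trans ?_ (le_max_right _ _)
    gcongr
    exact le_iSup_of_le k (le_iSup_of_le E (le_iSup_of_le hE le_rfl))

theorem restrictTo_apply (E : Finset ℕ+) (x : ℕ+ →₀ ℝ) (j : ℕ+) :
    restrictTo E x j = if j ∈ E then x j else 0 := by
  classical
  simp [restrictTo, Finsupp.filter_apply]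

theorem tsirelsonIter_le_tsum (F : Set (Finset ℕ+)) {θ : ℝ} (hθ : θ ≤ 1) (n : ℕ)
    (x : ℕ+ →₀ ℝ) : tsirelsonIter F θ n x ≤ ∑' j, ‖x j‖ₑ := by
  have hsup : ∀ x : ℕ+ →₀ ℝ, supENorm x ≤ ∑' j, ‖x j‖ₑ :=
    fun x => iSup_le fun j => ENNReal.le_tsum j
  induction n generalizing x with
  | zero => exact hsup x
  | succ n ih =>
    refine max_le (hsup x) ?_
    refine le_trans (mul_le_of_le_one_left' (ENNReal.ofReal_le_one.2 hθ)) ?_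
    refine iSup_le fun k => iSup_le fun E => iSup_le fun hE => ?_
    refine (Finset.sum_le_sum fun i _ => ih _).trans ?_
    rw [← Summable.tsum_finsetSum (fun _ _ => ENNReal.summable)]
    refine ENNReal.tsum_le_tsum fun j => ?_
    by_cases h : ∃ i, j ∈ E i
    · obtain ⟨i, hi⟩ := h
      rw [Finset.sum_eq_single i]
      · simp [restrictTo_apply, hi]
      · intro i' _ hne
        have : j ∉ E i' := by
          intro hj
          rcases lt_or_gt_of_ne hne with h | h
          · exact lt_irrefl j (hE.1 _ _ h j hj j hi)
          · exact lt_irrefl j (hE.1 _ _ h j hi j hj)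
        simp [restrictTo_apply, this]
      · simp
    · push Not at h
      simp [restrictTo_apply, h]

theorem tsirelsonENorm_ne_top (F : Set (Finset ℕ+)) {θ : ℝ} (hθ : θ ≤ 1) (x : ℕ+ →₀ ℝ) :
    tsirelsonENorm F θ x ≠ ∞ := by
  refine ne_top_of_le_ne_top ?_ (iSup_le fun n => tsirelsonIter_le_tsum F hθ n x)
  rw [tsum_eq_sum (s := x.support) (fun j hj => by simpa using hj)]
  exact ENNReal.sum_ne_top.2 fun _ _ => enorm_ne_top

theorem tsirelsonIter_add_le (F : Set (Finset ℕ+)) (θ : ℝ) (n : ℕ) (x y : ℕ+ →₀ ℝ) :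
    tsirelsonIter F θ n (x + y) ≤ tsirelsonIter F θ n x + tsirelsonIter F θ n y := by
  have hsup : supENorm (x + y) ≤ supENorm x + supENorm y := by
    refine iSup_le fun j => (enorm_add_le (x j) (y j)).trans ?_
    exact add_le_add (le_iSup (fun j => ‖x j‖ₑ) j) (le_iSup (fun j => ‖y j‖ₑ) j)
  induction n generalizing x y with
  | zero => exact hsup
  | succ n ih =>
    have hsub : ∀ z : ℕ+ →₀ ℝ, supENorm z ≤ tsirelsonIter F θ (n + 1) z :=
      fun z => le_max_left _ _
    refine max_le (hsup.trans (add_le_add (hsub x) (hsub y))) ?_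
    simp only [ENNReal.mul_iSup]
    refine iSup_le fun k => iSup_le fun E => iSup_le fun hE => ?_
    have key : ∀ z : ℕ+ →₀ ℝ, ENNReal.ofReal θ * ∑ i, tsirelsonIter F θ n (restrictTo (E i) z)
        ≤ tsirelsonIter F θ (n + 1) z := by
      intro z
      refine le_trans ?_ (le_max_right _ _)
      gcongr
      exact le_iSup_of_le k (le_iSup_of_le E (le_iSup_of_le hE le_rfl))
    refine le_trans ?_ (add_le_add (key x) (key y))
    rw [← mul_add, ← Finset.sum_add_distrib]
    gcongr with i
    have : restrictTo (E i) (x + y) = restrictTo (E i) x + restrictTo (E i) y := Finsupp.filter_add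
    rw [this]
    refine ih _ _ ?_
    refine iSup_le fun j => (enorm_add_le _ _).trans ?_
    exact add_le_add (le_iSup (fun j => ‖restrictTo (E i) x j‖ₑ) j)
      (le_iSup (fun j => ‖restrictTo (E i) y j‖ₑ) j)

theorem tsirelsonIter_smul (F : Set (Finset ℕ+)) (θ : ℝ) (n : ℕ) (c : ℝ) (x : ℕ+ →₀ ℝ) :
    tsirelsonIter F θ n (c • x) = ‖c‖ₑ * tsirelsonIter F θ n x := by
  have hsup : ∀ x : ℕ+ →₀ ℝ, supENorm (c • x) = ‖c‖ₑ * supENorm x := by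
    intro x
    simp [supENorm, ENNReal.mul_iSup, enorm_mul]
  induction n generalizing x with
  | zero => exact hsup x
  | succ n ih =>
    have hr : ∀ E : Finset ℕ+, restrictTo E (c • x) = c • restrictTo E x :=
      fun E => Finsupp.filter_smul
    simp only [tsirelsonIter, hsup, hr, ih, ← Finset.mul_sum, ← ENNReal.mul_iSup]
    rw [mul_left_comm, ← mul_max_of_nonneg _ _ zero_le]

theorem tsirelsonENorm_add_le (F : Set (Finset ℕ+)) (θ : ℝ) (x y : ℕ+ →₀ ℝ) :
    tsirelsonENorm F θ (x + y) ≤ tsirelsonENorm F θ x + tsirelsonENorm F θ y :=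
  iSup_le fun n => (tsirelsonIter_add_le F θ n x y).trans
    (add_le_add (le_iSup (fun n => tsirelsonIter F θ n x) n)
      (le_iSup (fun n => tsirelsonIter F θ n y) n))

theorem tsirelsonENorm_smul (F : Set (Finset ℕ+)) (θ : ℝ) (c : ℝ) (x : ℕ+ →₀ ℝ) :
    tsirelsonENorm F θ (c • x) = ‖c‖ₑ * tsirelsonENorm F θ x := by
  simp only [tsirelsonENorm, tsirelsonIter_smul, ENNReal.mul_iSup]

theorem tsirelsonENorm_eq_zero_iff (F : Set (Finset ℕ+)) (θ : ℝ) (x : ℕ+ →₀ ℝ) :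
    tsirelsonENorm F θ x = 0 ↔ x = 0 := by
  constructor
  · intro h
    ext j
    have hj : ‖x j‖ₑ ≤ tsirelsonENorm F θ x :=
      (le_iSup (fun j => ‖x j‖ₑ) j).trans (le_iSup (fun n => tsirelsonIter F θ n x) 0)
    rw [h] at hj
    simpa using hj
  · rintro rfl
    have := tsirelsonENorm_smul F θ 0 0
    rwa [zero_smul, enorm_zero, zero_mul] at this

/-- `c₀₀` with the Tsirelson norm of `T[𝓕, θ]`. -/
def PreTsirelson (_F : Set (Finset ℕ+)) (_θ : Set.Ioo (0 : ℝ) 1) : Type := ℕ+ →₀ ℝ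

namespace PreTsirelson

variable (F : Set (Finset ℕ+)) (θ : Set.Ioo (0 : ℝ) 1)

instance : AddCommGroup (PreTsirelson F θ) := inferInstanceAs (AddCommGroup (ℕ+ →₀ ℝ))

instance : Module ℝ (PreTsirelson F θ) := inferInstanceAs (Module ℝ (ℕ+ →₀ ℝ))

instance : Norm (PreTsirelson F θ) := ⟨fun x => (tsirelsonENorm F (θ : ℝ) x).toReal⟩

theorem core : NormedSpace.Core ℝ (PreTsirelson F θ) where
  norm_nonneg _ := ENNReal.toReal_nonneg
  norm_smul c x := by
    refine (congrArg ENNReal.toReal (tsirelsonENorm_smul F θ c x)).trans ?_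
    rw [ENNReal.toReal_mul, toReal_enorm]
    rfl
  norm_triangle x y := by
    have hx := tsirelsonENorm_ne_top F θ.2.2.le x
    have hy := tsirelsonENorm_ne_top F θ.2.2.le y
    exact (ENNReal.toReal_mono (ENNReal.add_ne_top.2 ⟨hx, hy⟩)
      (tsirelsonENorm_add_le F θ x y)).trans_eq (ENNReal.toReal_add hx hy)
  norm_eq_zero_iff x := by
    refine Iff.trans ?_ (tsirelsonENorm_eq_zero_iff F θ x)
    exact (ENNReal.toReal_eq_zero_iff _).trans
      (or_iff_left (tsirelsonENorm_ne_top F θ.2.2.le x))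

instance : NormedAddCommGroup (PreTsirelson F θ) := NormedAddCommGroup.ofCore (core F θ)

instance : NormedSpace ℝ (PreTsirelson F θ) := NormedSpace.ofCore (core F θ)

/-- The unit vectors of `c₀₀`. -/
def unit (j : ℕ+) : PreTsirelson F θ := (Finsupp.single j 1 : ℕ+ →₀ ℝ)

end PreTsirelson

/-- The Tsirelson space `T[𝓕, θ]`: the completion of `c₀₀` under the Tsirelson norm. -/
abbrev TsirelsonSpace (F : Set (Finset ℕ+)) (θ : Set.Ioo (0 : ℝ) 1) : Type :=
  UniformSpace.Completion (PreTsirelson F θ)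

/-- The unit vectors `e_j` of `T[𝓕, θ]`. -/
def tsirelsonUnit (F : Set (Finset ℕ+)) (θ : Set.Ioo (0 : ℝ) 1) (j : ℕ+) : TsirelsonSpace F θ :=
  (PreTsirelson.unit F θ j : UniformSpace.Completion (PreTsirelson F θ))

/-! ### Bases -/

section Bases

variable {X : Type*} [NormedAddCommGroup X] [NormedSpace ℝ X]

/-- The basis is normalized. -/
def IsNormalizedBasis (b : UnconditionalSchauderBasis ℕ+ ℝ X) : Prop := ∀ j, ‖b j‖ = 1

/-- The basis is `1`-unconditional: changing signs of coefficients does not increase norms. -/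
def IsOneUnconditional (b : UnconditionalSchauderBasis ℕ+ ℝ X) : Prop :=
  ∀ (s : Finset ℕ+) (a ε : ℕ+ → ℝ), (∀ j, ε j = 1 ∨ ε j = -1) →
    ‖∑ j ∈ s, (ε j * a j) • b j‖ ≤ ‖∑ j ∈ s, a j • b j‖

/-- The vectors `x i` have pairwise disjoint supports with respect to the basis `b`. -/
def DisjointlySupported (b : UnconditionalSchauderBasis ℕ+ ℝ X) {ι : Type*} (x : ι → X) : Prop :=
  Pairwise fun i i' => Disjoint {j | b.coord j (x i) ≠ 0} {j | b.coord j (x i') ≠ 0}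

/-- `X_k`, the closed linear span of `(e_j : j ≥ k)`. -/
def basisTail (e : ℕ+ → X) (k : ℕ+) : Submodule ℝ X :=
  (Submodule.span ℝ (e '' Set.Ici k)).topologicalClosure

/-- `(f i)` is `c`-equivalent to the unit vector basis of `ℓ₁(ι)`: up to a scaling factor,
`c ∑ |aᵢ| ≤ ‖∑ aᵢ fᵢ‖ ≤ ∑ |aᵢ|` for all finite sums. -/
def IsL1Equivalent (c : ℝ) {ι : Type*} (f : ι → X) : Prop :=
  ∃ A B : ℝ, 0 < A ∧ 0 < B ∧ c * B ≤ A ∧ ∀ (s : Finset ι) (a : ι → ℝ),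
    A * ∑ i ∈ s, |a i| ≤ ‖∑ i ∈ s, a i • f i‖ ∧ ‖∑ i ∈ s, a i • f i‖ ≤ B * ∑ i ∈ s, |a i|

/-- The sequence `(e_j)` is equivalent to the unit vector basis of `ℓ₁`. -/
def IsEquivalentToL1Basis (e : ℕ+ → X) : Prop := ∃ c > 0, IsL1Equivalent c e

/-- For every `m ≥ 1` and every `m`-dimensional subspace `E` of `X_{L m}` there are an automorphism
`S` of `X_{L m}` with `‖S‖ ‖S⁻¹‖ ≤ 2` and a subspace `F ⊇ S(E)` of `X_{L m}` with a basis
`f₁, …, f_{L m}` which is `c`-equivalent to the unit vector basis of `ℓ₁^{L m}`. -/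
def TailsEmbedInL1 (e : ℕ+ → X) (c : ℝ) (L : ℕ+ → ℕ+) : Prop :=
  ∀ (m : ℕ+) (E : Submodule ℝ (basisTail e (L m))), Module.finrank ℝ E = m →
    ∃ (f : Fin (L m) → basisTail e (L m)) (S : basisTail e (L m) ≃L[ℝ] basisTail e (L m)),
      IsL1Equivalent c f ∧
      ‖(S : basisTail e (L m) →L[ℝ] basisTail e (L m))‖ *
        ‖(S.symm : basisTail e (L m) →L[ℝ] basisTail e (L m))‖ ≤ 2 ∧
      ∀ x ∈ E, S x ∈ Submodule.span ℝ (Set.range f)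

/-- `P` is a spatial projection: the coordinate projection onto the closed span of a subsequence
`(b j : j ∈ A)` of the basis. -/
def IsSpatialProjection (b : UnconditionalSchauderBasis ℕ+ ℝ X) (P : X →L[ℝ] X) : Prop :=
  ∃ A : Set ℕ+, A.Infinite ∧ ∀ j, (j ∈ A → P (b j) = b j) ∧ (j ∉ A → P (b j) = 0)

/-! ### Closed ideals -/

/-- The closed ideal of `𝓛(X)` generated by the set `𝒯` of operators. -/
def closedIdealGen (𝒯 : Set (X →L[ℝ] X)) : Set (X →L[ℝ] X) :=
  closure {R | ∃ (n : ℕ) (A T B : Fin n → X →L[ℝ] X),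
    (∀ j, T j ∈ 𝒯) ∧ R = ∑ j, (A j).comp ((T j).comp (B j))}

/-- Closed ideals of `𝓛(X)`. -/
structure IsClosedIdeal (J : Submodule ℝ (X →L[ℝ] X)) : Prop where
  isClosed : IsClosed (J : Set (X →L[ℝ] X))
  comp_left : ∀ (A : X →L[ℝ] X), ∀ T ∈ J, A.comp T ∈ J
  comp_right : ∀ (A : X →L[ℝ] X), ∀ T ∈ J, T.comp A ∈ J

/-- The tree condition (T) for the family `(T N)`, `N` ranging over the infinite sets of positive
integers (the values of `T` at finite sets are irrelevant). -/
def TreeCondition (T : Set ℕ+ → X →L[ℝ] X) : Prop :=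
  ∃ c : ℝ, 0 < c ∧ ∀ M N : Set ℕ+, M.Infinite → N.Infinite →
    (M ⊆ N → T M ∈ closedIdealGen {T N}) ∧
    ((M \ N).Infinite → c ≤ Metric.infDist (T M) (closedIdealGen {T N}))

end Bases

/-- `L` is a sequence such that in every Banach space with a `1`-unconditional basis, every
`m`-dimensional subspace `E` is moved by an automorphism `S` of the space with `‖S‖ ‖S⁻¹‖ ≤ 2`
into the span of `L m` pairwise disjointly supported vectors. -/
def IsDisjointificationBound (L : ℕ+ → ℕ+) : Prop :=
  ∀ (m : ℕ+) (X : Type u) [NormedAddCommGroup X] [NormedSpace ℝ X] [CompleteSpace X]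
    (b : UnconditionalSchauderBasis ℕ+ ℝ X), IsOneUnconditional b →
    ∀ E : Submodule ℝ X, Module.finrank ℝ E = m →
      ∃ (x : Fin (L m) → X) (S : X ≃L[ℝ] X), DisjointlySupported b x ∧
        ‖(S : X →L[ℝ] X)‖ * ‖(S.symm : X →L[ℝ] X)‖ ≤ 2 ∧
        ∀ y ∈ E, S y ∈ Submodule.span ℝ (Set.range x)

end

noncomputable section

/-! ### Diagonal operators with respect to a `1`-unconditional basis -/

section Diagonal

variable {X : Type*} [NormedAddCommGroup X] [NormedSpace ℝ X]
  {b : UnconditionalSchauderBasis ℕ+ ℝ X}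

theorem coord_basis (b : UnconditionalSchauderBasis ℕ+ ℝ X) (i j : ℕ+) :
    b.coord i (b j) = if i = j then 1 else 0 := by
  have h := b.ortho i j
  simp only [Pi.single_apply] at h
  rw [h]
  congr

theorem eq_of_coord_eq (b : UnconditionalSchauderBasis ℕ+ ℝ X) {x y : X}
    (h : ∀ j, b.coord j x = b.coord j y) : x = y := by
  have hx := b.expansion x
  have hy := b.expansion y
  simp only [h] at hx
  exact hx.unique hy

theorem coord_sum_smul_basis (b : UnconditionalSchauderBasis ℕ+ ℝ X) (s : Finset ℕ+) (a : ℕ+ → ℝ)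
    (j : ℕ+) : b.coord j (∑ i ∈ s, a i • b i) = if j ∈ s then a j else 0 := by
  simp [map_sum, coord_basis]

theorem IsOneUnconditional.norm_sum_mul_le (h1 : IsOneUnconditional b) (s : Finset ℕ+)
    (a c : ℕ+ → ℝ) (hc : ∀ j ∈ s, |c j| ≤ 1) :
    ‖∑ j ∈ s, (c j * a j) • b j‖ ≤ ‖∑ j ∈ s, a j • b j‖ := by
  classical
  have key : ∀ (t : Finset ℕ+) (c : ℕ+ → ℝ), (∀ j, |c j| ≤ 1) → (∀ j ∉ t, c j = 1 ∨ c j = -1) →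
      ‖∑ j ∈ s, (c j * a j) • b j‖ ≤ ‖∑ j ∈ s, a j • b j‖ := by
    intro t
    induction t using Finset.induction_on with
    | empty => exact fun c _ h => h1 s a c fun j => h j (Finset.notMem_empty j)
    | insert i t _ ih =>
      intro c hc h
      have hup : ∀ r : ℝ, (r = 1 ∨ r = -1) →
          ‖∑ j ∈ s, (Function.update c i r j * a j) • b j‖ ≤ ‖∑ j ∈ s, a j • b j‖ := by
        intro r hr
        refine ih _ (fun j => ?_) fun j hj => ?_
        · by_cases hji : j = i
          · subst hji
            rcases hr with rfl | rfl <;> simp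
          · simpa [hji] using hc j
        · by_cases hji : j = i
          · subst hji
            simpa using hr
          · simpa [hji] using h j (by simp [hji, hj])
      have hi := abs_le.1 (hc i)
      have heq : ∑ j ∈ s, (c j * a j) • b j =
          ((1 + c i) / 2) • ∑ j ∈ s, (Function.update c i 1 j * a j) • b j +
          ((1 - c i) / 2) • ∑ j ∈ s, (Function.update c i (-1) j * a j) • b j := by
        rw [Finset.smul_sum, Finset.smul_sum, ← Finset.sum_add_distrib]
        refine Finset.sum_congr rfl fun j _ => ?_
        rw [smul_smul, smul_smul, ← add_smul]
        congr 1
        by_cases hji : j = i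
        · subst hji
          simp
          ring
        · simp [hji]
          ring
      rw [heq]
      refine (norm_add_le _ _).trans ?_
      rw [norm_smul, norm_smul, Real.norm_of_nonneg (by linarith), Real.norm_of_nonneg (by linarith)]
      have h₁ := mul_le_mul_of_nonneg_left (hup 1 (Or.inl rfl))
        (show 0 ≤ (1 + c i) / 2 by linarith)
      have h₂ := mul_le_mul_of_nonneg_left (hup (-1) (Or.inr rfl))
        (show 0 ≤ (1 - c i) / 2 by linarith)
      linarith
  have := key s (fun j => if j ∈ s then c j else 1) (fun j => ?_) fun j hj => by simp [hj]
  · refine le_trans (le_of_eq ?_) this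
    congr 1
    exact Finset.sum_congr rfl fun j hj => by simp [hj]
  · by_cases hj : j ∈ s
    · simpa [hj] using hc j hj
    · simp [hj]

theorem IsOneUnconditional.norm_sum_le_of_abs_le (h1 : IsOneUnconditional b) (s : Finset ℕ+)
    (a a' : ℕ+ → ℝ) (h : ∀ j ∈ s, |a' j| ≤ |a j|) :
    ‖∑ j ∈ s, a' j • b j‖ ≤ ‖∑ j ∈ s, a j • b j‖ := by
  refine le_trans (le_of_eq ?_) (h1.norm_sum_mul_le s a (fun j => a' j / a j) fun j hj => ?_)
  · congr 1
    refine Finset.sum_congr rfl fun j hj => ?_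
    by_cases ha : a j = 0
    · have : a' j = 0 := by simpa [ha] using h j hj
      simp [ha, this]
    · rw [div_mul_cancel₀ _ ha]
  · rw [abs_div]
    exact div_le_one_of_le₀ (h j hj) (abs_nonneg _)

theorem IsOneUnconditional.norm_sum_mul_le_mul (h1 : IsOneUnconditional b) (s : Finset ℕ+)
    (a c : ℕ+ → ℝ) {C : ℝ} (hc : ∀ j ∈ s, |c j| ≤ C) :
    ‖∑ j ∈ s, (c j * a j) • b j‖ ≤ C * ‖∑ j ∈ s, a j • b j‖ := by
  rcases s.eq_empty_or_nonempty with rfl | ⟨i, hi⟩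
  · simp
  have hC : 0 ≤ C := (abs_nonneg _).trans (hc i hi)
  have h := h1.norm_sum_le_of_abs_le s (fun j => C * a j) (fun j => c j * a j) fun j hj => by
    rw [abs_mul, abs_mul, abs_of_nonneg hC]
    exact mul_le_mul_of_nonneg_right (hc j hj) (abs_nonneg _)
  refine h.trans (le_of_eq ?_)
  simp only [mul_smul, ← Finset.smul_sum, norm_smul, Real.norm_of_nonneg hC]

theorem mem_basisTail_iff {k : ℕ+} {x : X} :
    x ∈ basisTail b.basis k ↔ ∀ j < k, b.coord j x = 0 := by
  constructor
  · intro hx j hj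
    have hle : Submodule.span ℝ (b.basis '' Set.Ici k) ≤ (b.coord j).toLinearMap.ker := by
      rw [Submodule.span_le]
      rintro _ ⟨i, hi, rfl⟩
      simp [coord_basis, (hj.trans_le hi).ne]
    have hcl : IsClosed ((b.coord j).toLinearMap.ker : Set X) :=
      (b.coord j).isClosed_ker
    exact Submodule.topologicalClosure_minimal _ hle hcl hx
  · intro h
    refine mem_closure_of_tendsto (b.expansion x) (Filter.Eventually.of_forall fun s => ?_)
    refine Submodule.sum_mem _ fun i _ => ?_
    by_cases hi : i < k
    · rw [h i hi, zero_smul]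
      exact Submodule.zero_mem _
    · exact Submodule.smul_mem _ _ (Submodule.subset_span ⟨i, not_lt.1 hi, rfl⟩)

variable [CompleteSpace X]

theorem IsOneUnconditional.summable_mul (h1 : IsOneUnconditional b) {c : ℕ+ → ℝ} {C : ℝ}
    (hc : ∀ j, |c j| ≤ C) (x : X) : Summable fun j => (c j * b.coord j x) • b j := by
  have hC : 0 ≤ C := (abs_nonneg _).trans (hc 1)
  rw [summable_iff_vanishing_norm]
  intro ε hε
  obtain ⟨s, hs⟩ := summable_iff_vanishing_norm.1 (b.expansion x).summable (ε / (C + 1))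
    (by positivity)
  refine ⟨s, fun t ht => ?_⟩
  refine (h1.norm_sum_mul_le_mul t _ c fun j _ => hc j).trans_lt ?_
  have := hs t ht
  rw [lt_div_iff₀ (by positivity)] at this
  nlinarith [norm_nonneg (∑ j ∈ t, b.coord j x • b j)]

theorem IsOneUnconditional.norm_tsum_mul_le (h1 : IsOneUnconditional b) {c : ℕ+ → ℝ} {C : ℝ}
    (hc : ∀ j, |c j| ≤ C) (x : X) : ‖∑' j, (c j * b.coord j x) • b j‖ ≤ C * ‖x‖ :=
  le_of_tendsto_of_tendsto (h1.summable_mul hc x).hasSum.norm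
    ((b.expansion x).norm.const_mul C)
    (Filter.Eventually.of_forall fun s => h1.norm_sum_mul_le_mul s _ c fun j _ => hc j)

/-- The diagonal operator with the bounded entries `c j`. -/
def diagOp (h1 : IsOneUnconditional b) (c : ℕ+ → ℝ) {C : ℝ} (hc : ∀ j, |c j| ≤ C) : X →L[ℝ] X :=
  LinearMap.mkContinuous
    { toFun := fun x => ∑' j, (c j * b.coord j x) • b j
      map_add' := fun x y => by
        rw [← (h1.summable_mul hc x).tsum_add (h1.summable_mul hc y)]
        congr 1
        ext j
        rw [map_add, mul_add, add_smul]
      map_smul' := fun r x => by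
        rw [RingHom.id_apply, ← (h1.summable_mul hc x).tsum_const_smul]
        congr 1
        ext j
        rw [map_smul, smul_eq_mul, smul_smul]
        ring_nf }
    C (h1.norm_tsum_mul_le hc)

theorem diagOp_apply (h1 : IsOneUnconditional b) (c : ℕ+ → ℝ) {C : ℝ} (hc : ∀ j, |c j| ≤ C)
    (x : X) : diagOp h1 c hc x = ∑' j, (c j * b.coord j x) • b j := rfl

theorem norm_diagOp_apply_le (h1 : IsOneUnconditional b) (c : ℕ+ → ℝ) {C : ℝ}
    (hc : ∀ j, |c j| ≤ C) (x : X) : ‖diagOp h1 c hc x‖ ≤ C * ‖x‖ :=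
  h1.norm_tsum_mul_le hc x

@[simp]
theorem coord_diagOp (h1 : IsOneUnconditional b) (c : ℕ+ → ℝ) {C : ℝ} (hc : ∀ j, |c j| ≤ C)
    (x : X) (i : ℕ+) : b.coord i (diagOp h1 c hc x) = c i * b.coord i x := by
  rw [diagOp_apply, ((h1.summable_mul hc x).hasSum.mapL (b.coord i)).tsum_eq.symm]
  rw [tsum_eq_single i]
  · simp [coord_basis]
  · intro j hj
    simp [coord_basis, hj.symm]

theorem diagOp_basis (h1 : IsOneUnconditional b) (c : ℕ+ → ℝ) {C : ℝ} (hc : ∀ j, |c j| ≤ C)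
    (i : ℕ+) : diagOp h1 c hc (b i) = c i • b i := by
  refine eq_of_coord_eq b fun j => ?_
  rw [coord_diagOp, map_smul, coord_basis, smul_eq_mul]
  split_ifs with h
  · rw [h]
  · simp

theorem IsOneUnconditional.norm_le_of_coord_le (h1 : IsOneUnconditional b) {x y : X} {C : ℝ}
    (hC : 0 ≤ C) (h : ∀ j, |b.coord j y| ≤ C * |b.coord j x|) : ‖y‖ ≤ C * ‖x‖ := by
  have hc : ∀ j, |b.coord j y / b.coord j x| ≤ C := fun j => by
    rw [abs_div]
    exact div_le_of_le_mul₀ (abs_nonneg _) hC (h j)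
  have : y = diagOp h1 _ hc x := by
    refine eq_of_coord_eq b fun j => ?_
    rw [coord_diagOp]
    by_cases hx : b.coord j x = 0
    · have := h j
      rw [hx, abs_zero, mul_zero] at this
      rw [hx, mul_zero, abs_nonpos_iff.1 this]
    · rw [div_mul_cancel₀ _ hx]
  rw [this]
  exact norm_diagOp_apply_le h1 _ hc x

theorem abs_indicator_one_le (A : Set ℕ+) (j : ℕ+) : |A.indicator (fun _ => (1 : ℝ)) j| ≤ 1 := by
  by_cases h : j ∈ A <;> simp [h]

/-- The coordinate projection onto the closed span of `(b j : j ∈ A)`. -/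
def coordProj (h1 : IsOneUnconditional b) (A : Set ℕ+) : X →L[ℝ] X :=
  diagOp h1 (A.indicator fun _ => (1 : ℝ)) (abs_indicator_one_le A)

open scoped Classical in
@[simp]
theorem coord_coordProj (h1 : IsOneUnconditional b) (A : Set ℕ+) (x : X) (j : ℕ+) :
    b.coord j (coordProj h1 A x) = if j ∈ A then b.coord j x else 0 := by
  simp [coordProj, Set.indicator_apply]

theorem norm_coordProj_apply_le (h1 : IsOneUnconditional b) (A : Set ℕ+) (x : X) :
    ‖coordProj h1 A x‖ ≤ ‖x‖ :=
  (norm_diagOp_apply_le h1 _ _ x).trans_eq (one_mul _)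

open scoped Classical in
theorem coordProj_basis (h1 : IsOneUnconditional b) (A : Set ℕ+) (j : ℕ+) :
    coordProj h1 A (b j) = if j ∈ A then b j else 0 := by
  simp [coordProj, diagOp_basis, Set.indicator_apply]

theorem isSpatialProjection_coordProj (h1 : IsOneUnconditional b) {A : Set ℕ+}
    (hA : A.Infinite) : IsSpatialProjection b (coordProj h1 A) :=
  ⟨A, hA, fun j => ⟨fun h => by simp [coordProj_basis, h], fun h => by simp [coordProj_basis, h]⟩⟩

theorem coordProj_comp_of_subset (h1 : IsOneUnconditional b) {A B : Set ℕ+} (h : A ⊆ B) :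
    (coordProj h1 A).comp (coordProj h1 B) = coordProj h1 A := by
  ext x
  refine eq_of_coord_eq b fun j => ?_
  simp only [ContinuousLinearMap.comp_apply, coord_coordProj]
  split_ifs with h₁ h₂
  · rfl
  · exact absurd (h h₁) h₂
  · rfl

theorem coordProj_finset (h1 : IsOneUnconditional b) (F : Finset ℕ+) (x : X) :
    coordProj h1 (F : Set ℕ+) x = ∑ i ∈ F, b.coord i x • b i := by
  refine eq_of_coord_eq b fun j => ?_
  rw [coord_sum_smul_basis, coord_coordProj]
  simp

theorem abs_coord_mul_norm_le (h1 : IsOneUnconditional b) (j : ℕ+) (x : X) :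
    |b.coord j x| * ‖b j‖ ≤ ‖x‖ := by
  have h := norm_coordProj_apply_le h1 (({j} : Finset ℕ+) : Set ℕ+) x
  rwa [coordProj_finset, Finset.sum_singleton, norm_smul] at h

instance (e : ℕ+ → X) (k : ℕ+) : CompleteSpace (basisTail e k) :=
  (Submodule.isClosed_topologicalClosure _).completeSpace_coe

end Diagonal

/-! ### Grothendieck's inequality -/

section Grothendieck

variable {σ : Type} [DecidableEq σ]

/-- The Rademacher functions on `σ → Bool`. -/
def rademacher (i : σ) (ω : σ → Bool) : ℝ := if ω i then 1 else -1

omit [DecidableEq σ] in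
theorem rademacher_sq (i : σ) (ω : σ → Bool) : rademacher i ω ^ 2 = 1 := by
  unfold rademacher
  split_ifs <;> norm_num

/-- The involution of `σ → Bool` that changes the coordinate `i`. -/
def flipAt (i : σ) : Equiv.Perm (σ → Bool) :=
  Function.Involutive.toPerm (fun ω => Function.update ω i (!ω i)) fun ω => by
    ext j
    by_cases h : j = i
    · subst h
      simp
    · simp [h]

theorem flipAt_apply (i : σ) (ω : σ → Bool) : flipAt i ω = Function.update ω i (!ω i) := rfl

theorem rademacher_flipAt_self (i : σ) (ω : σ → Bool) :
    rademacher i (flipAt i ω) = -rademacher i ω := by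
  simp only [rademacher, flipAt_apply, Function.update_self]
  cases ω i <;> simp

theorem rademacher_flipAt_of_ne {i j : σ} (h : j ≠ i) (ω : σ → Bool) :
    rademacher j (flipAt i ω) = rademacher j ω := by
  simp [rademacher, flipAt_apply, h]

/-- The Rademacher sum `∑ l ∈ s, x l * r l`. -/
def rademacherSum (s : Finset σ) (x : σ → ℝ) (ω : σ → Bool) : ℝ := ∑ l ∈ s, x l * rademacher l ω

theorem rademacherSum_flipAt {s : Finset σ} {i : σ} (hi : i ∉ s) (x : σ → ℝ) (ω : σ → Bool) :
    rademacherSum s x (flipAt i ω) = rademacherSum s x ω :=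
  Finset.sum_congr rfl fun l hl => by
    rw [rademacher_flipAt_of_ne (ne_of_mem_of_not_mem hl hi)]

variable [Fintype σ]

theorem sum_mul_rademacher_eq_zero (i : σ) (f : (σ → Bool) → ℝ)
    (hf : ∀ ω, f (flipAt i ω) = f ω) : ∑ ω, f ω * rademacher i ω = 0 := by
  have h := Equiv.sum_comp (flipAt i) fun ω => f ω * rademacher i ω
  simp only [hf, rademacher_flipAt_self, mul_neg, Finset.sum_neg_distrib] at h
  linarith

theorem sum_rademacherSum_mul (s : Finset σ) (x y : σ → ℝ) :
    ∑ ω, rademacherSum s x ω * rademacherSum s y ω =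
      Fintype.card (σ → Bool) * ∑ l ∈ s, x l * y l := by
  induction s using Finset.induction_on with
  | empty => simp [rademacherSum]
  | insert i s hi ih =>
    have hx := sum_mul_rademacher_eq_zero i _ (rademacherSum_flipAt hi x)
    have hy := sum_mul_rademacher_eq_zero i _ (rademacherSum_flipAt hi y)
    have : ∀ ω, rademacherSum (insert i s) x ω * rademacherSum (insert i s) y ω =
        rademacherSum s x ω * rademacherSum s y ω + y i * (rademacherSum s x ω * rademacher i ω) +
        x i * (rademacherSum s y ω * rademacher i ω) + x i * y i := fun ω => by
      have h := rademacher_sq i ω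
      simp only [rademacherSum, Finset.sum_insert hi]
      linear_combination (x i * y i) * h
    simp only [this, Finset.sum_add_distrib, ← Finset.mul_sum, hx, hy, ih, Finset.sum_insert hi,
      Finset.sum_const, Finset.card_univ, nsmul_eq_mul]
    ring

theorem sum_rademacherSum_pow_four_le (s : Finset σ) (x : σ → ℝ) :
    ∑ ω, rademacherSum s x ω ^ 4 ≤ 3 * Fintype.card (σ → Bool) * (∑ l ∈ s, x l ^ 2) ^ 2 := by
  induction s using Finset.induction_on with
  | empty => simp [rademacherSum]
  | insert i s hi ih =>
    have hx := sum_mul_rademacher_eq_zero i _ (rademacherSum_flipAt hi x)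
    have hx3 := sum_mul_rademacher_eq_zero i (fun ω => rademacherSum s x ω ^ 3)
      fun ω => by rw [rademacherSum_flipAt hi]
    have h2 := sum_rademacherSum_mul s x x
    have : ∀ ω, rademacherSum (insert i s) x ω ^ 4 =
        rademacherSum s x ω ^ 4 + 4 * x i * (rademacherSum s x ω ^ 3 * rademacher i ω) +
        6 * x i ^ 2 * (rademacherSum s x ω * rademacherSum s x ω) +
        4 * x i ^ 3 * (rademacherSum s x ω * rademacher i ω) + x i ^ 4 := fun ω => by
      have h := rademacher_sq i ω
      simp only [rademacherSum, Finset.sum_insert hi]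
      set r := rademacher i ω
      set S := ∑ l ∈ s, x l * rademacher l ω
      have h3 : r ^ 3 = r := by rw [pow_succ, h, one_mul]
      have h4 : r ^ 4 = 1 := by rw [show r ^ 4 = (r ^ 2) ^ 2 by ring, h, one_pow]
      linear_combination (6 * S ^ 2 * x i ^ 2) * h + (4 * S * x i ^ 3) * h3 + x i ^ 4 * h4
    simp only [this, Finset.sum_add_distrib, ← Finset.mul_sum, hx, hx3, h2, Finset.sum_insert hi,
      Finset.sum_const, Finset.card_univ, nsmul_eq_mul]
    have hN : (0 : ℝ) ≤ Fintype.card (σ → Bool) := Nat.cast_nonneg _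
    simp only [← pow_two]
    nlinarith [mul_nonneg hN (sq_nonneg (x i ^ 2))]

variable {κ ι : Type*} [Fintype κ] [Fintype ι]

/-- `C` bounds the bilinear form of the matrix `a` on the unit balls of Euclidean spaces. -/
def IsGrothendieckBound (a : κ → ι → ℝ) (C : ℝ) : Prop :=
  ∀ (n : ℕ) (x : κ → Fin n → ℝ) (y : ι → Fin n → ℝ), (∀ k, ∑ l, x k l ^ 2 ≤ 1) →
    (∀ j, ∑ l, y j l ^ 2 ≤ 1) → ∑ k, ∑ j, a k j * ∑ l, x k l * y j l ≤ C

theorem IsGrothendieckBound.le_mul {a : κ → ι → ℝ} {C : ℝ} (h : IsGrothendieckBound a C)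
    {τ : Type*} [Fintype τ] (x : κ → τ → ℝ) (y : ι → τ → ℝ) {A B : ℝ} (hA : 0 < A) (hB : 0 < B)
    (hx : ∀ k, ∑ l, x k l ^ 2 ≤ A ^ 2) (hy : ∀ j, ∑ l, y j l ^ 2 ≤ B ^ 2) :
    ∑ k, ∑ j, a k j * ∑ l, x k l * y j l ≤ A * B * C := by
  let e := (Fintype.equivFin τ).symm
  have := h (Fintype.card τ) (fun k l => x k (e l) / A) (fun j l => y j (e l) / B)
    (fun k => by
      rw [e.sum_comp fun l => (x k l / A) ^ 2]
      simp only [div_pow, ← Finset.sum_div]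
      exact (div_le_one (by positivity)).2 (hx k))
    (fun j => by
      rw [e.sum_comp fun l => (y j l / B) ^ 2]
      simp only [div_pow, ← Finset.sum_div]
      exact (div_le_one (by positivity)).2 (hy j))
  refine le_trans (le_of_eq ?_) (mul_le_mul_of_nonneg_left this (mul_pos hA hB).le)
  rw [Finset.mul_sum]
  refine Finset.sum_congr rfl fun k _ => ?_
  rw [Finset.mul_sum]
  refine Finset.sum_congr rfl fun j _ => ?_
  rw [e.sum_comp fun l => x k l / A * (y j l / B), mul_left_comm, Finset.mul_sum (a := A * B)]
  congr 1
  refine Finset.sum_congr rfl fun l _ => ?_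
  field_simp

theorem exists_isGrothendieckBound (a : κ → ι → ℝ) : IsGrothendieckBound a (∑ k, ∑ j, |a k j|) := by
  intro n x y hx hy
  refine Finset.sum_le_sum fun k _ => Finset.sum_le_sum fun j _ => ?_
  refine (le_abs_self _).trans ?_
  rw [abs_mul]
  refine mul_le_of_le_one_right (abs_nonneg _) ?_
  rw [← sq_le_one_iff_abs_le_one]
  refine (Finset.sum_mul_sq_le_sq_mul_sq _ _ _).trans ?_
  exact mul_le_one₀ (hx k) (Finset.sum_nonneg fun _ _ => sq_nonneg _) (hy j)

/-- One step of the truncation argument. -/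
theorem IsGrothendieckBound.improve {a : κ → ι → ℝ} {C m : ℝ} (h : IsGrothendieckBound a C)
    (hm : ∀ (s : κ → ℝ) (t : ι → ℝ), (∀ k, |s k| ≤ 1) → (∀ j, |t j| ≤ 1) →
      ∑ k, ∑ j, a k j * (s k * t j) ≤ m) : IsGrothendieckBound a (49 * m + C / 2) := by
  intro n x y hx hy
  set N : ℝ := ((Fintype.card (Fin n → Bool) : ℕ) : ℝ) with hN
  have hNpos : 0 < N := by
    rw [hN]
    exact_mod_cast Fintype.card_pos
  let S : (Fin n → ℝ) → (Fin n → Bool) → ℝ := fun z => rademacherSum Finset.univ z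
  let T : (Fin n → ℝ) → (Fin n → Bool) → ℝ := fun z ω => if |S z ω| ≤ 7 then S z ω else 0
  have hT : ∀ z ω, |T z ω| ≤ 7 := fun z ω => by
    simp only [T]
    split_ifs with h'
    · exact h'
    · norm_num
  have hSS : ∀ z : Fin n → ℝ, ∑ l, z l ^ 2 ≤ 1 → ∑ ω, S z ω ^ 2 ≤ N := fun z hz => by
    simp only [S, pow_two (rademacherSum _ _ _), sum_rademacherSum_mul, ← hN]
    simp only [← pow_two]
    nlinarith
  have hTT : ∀ z : Fin n → ℝ, ∑ l, z l ^ 2 ≤ 1 → ∑ ω, T z ω ^ 2 ≤ N := fun z hz => by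
    refine (Finset.sum_le_sum fun ω _ => ?_).trans (hSS z hz)
    simp only [T]
    split_ifs
    · exact le_rfl
    · rw [zero_pow two_ne_zero]
      positivity
  have hD : ∀ z : Fin n → ℝ, ∑ l, z l ^ 2 ≤ 1 → ∑ ω, (S z ω - T z ω) ^ 2 ≤ N / 16 := fun z hz => by
    have h4 := sum_rademacherSum_pow_four_le Finset.univ z
    have hz0 : 0 ≤ ∑ l, z l ^ 2 := Finset.sum_nonneg fun _ _ => sq_nonneg _
    have h4' : ∑ ω, S z ω ^ 4 ≤ 3 * N := by
      refine h4.trans ?_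
      rw [← hN]
      have : (∑ l, z l ^ 2) ^ 2 ≤ 1 := pow_le_one₀ hz0 hz
      nlinarith
    have : ∑ ω, (S z ω - T z ω) ^ 2 ≤ ∑ ω, S z ω ^ 4 / 49 := by
      refine Finset.sum_le_sum fun ω _ => ?_
      simp only [T]
      split_ifs with h'
      · rw [sub_self, zero_pow two_ne_zero]
        positivity
      · rw [not_le] at h'
        have : 49 ≤ S z ω ^ 2 := by
          rw [← sq_abs]
          nlinarith
        rw [le_div_iff₀ (by norm_num)]
        nlinarith [sq_nonneg (S z ω)]
    rw [← Finset.sum_div] at this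
    linarith
  set R := √N
  have hR : R ^ 2 = N := Real.sq_sqrt hNpos.le
  have hRpos : 0 < R := Real.sqrt_pos.2 hNpos
  have h₂ := h.le_mul (fun k ω => T (x k) ω) (fun j ω => S (y j) ω - T (y j) ω) hRpos
    (show 0 < R / 4 by positivity) (fun k => by rw [hR]; exact hTT _ (hx k))
    (fun j => by rw [div_pow, hR]; norm_num; exact hD _ (hy j))
  have h₃ := h.le_mul (fun k ω => S (x k) ω - T (x k) ω) (fun j ω => S (y j) ω)
    (show 0 < R / 4 by positivity) hRpos
    (fun k => by rw [div_pow, hR]; norm_num; exact hD _ (hx k))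
    (fun j => by rw [hR]; exact hSS _ (hy j))
  have h₁ : ∑ k, ∑ j, a k j * ∑ ω, T (x k) ω * T (y j) ω ≤ N * (49 * m) := by
    have : ∑ k, ∑ j, a k j * ∑ ω, T (x k) ω * T (y j) ω =
        ∑ ω, 49 * ∑ k, ∑ j, a k j * (T (x k) ω / 7 * (T (y j) ω / 7)) := by
      simp only [Finset.mul_sum]
      rw [Finset.sum_comm (s := Finset.univ (α := Fin n → Bool))]
      refine Finset.sum_congr rfl fun k _ => ?_
      rw [Finset.sum_comm]
      refine Finset.sum_congr rfl fun ω _ => Finset.sum_congr rfl fun j _ => ?_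
      ring
    rw [this]
    refine (Finset.sum_le_card_nsmul _ _ (49 * m) fun ω _ => ?_).trans_eq ?_
    · refine mul_le_mul_of_nonneg_left (hm _ _ (fun k => ?_) fun j => ?_) (by norm_num)
      · rw [abs_div, abs_of_pos (by norm_num : (0 : ℝ) < 7)]
        exact div_le_one_of_le₀ (hT _ _) (by norm_num)
      · rw [abs_div, abs_of_pos (by norm_num : (0 : ℝ) < 7)]
        exact div_le_one_of_le₀ (hT _ _) (by norm_num)
    · rw [nsmul_eq_mul, Finset.card_univ]
  have key : N * ∑ k, ∑ j, a k j * ∑ l, x k l * y j l =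
      ∑ k, ∑ j, a k j * ∑ ω, T (x k) ω * T (y j) ω +
      ∑ k, ∑ j, a k j * ∑ ω, T (x k) ω * (S (y j) ω - T (y j) ω) +
      ∑ k, ∑ j, a k j * ∑ ω, (S (x k) ω - T (x k) ω) * S (y j) ω := by
    rw [Finset.mul_sum, ← Finset.sum_add_distrib, ← Finset.sum_add_distrib]
    refine Finset.sum_congr rfl fun k _ => ?_
    rw [Finset.mul_sum, ← Finset.sum_add_distrib, ← Finset.sum_add_distrib]
    refine Finset.sum_congr rfl fun j _ => ?_
    rw [← mul_add, ← mul_add, ← Finset.sum_add_distrib, ← Finset.sum_add_distrib, mul_left_comm,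
      hN, ← sum_rademacherSum_mul]
    congr 1
    refine Finset.sum_congr rfl fun ω _ => ?_
    simp only [S]
    ring
  have hfin : N * ∑ k, ∑ j, a k j * ∑ l, x k l * y j l ≤ N * (49 * m + C / 2) := by
    rw [key]
    have e₂ : R * (R / 4) * C = N * C / 4 := by rw [← hR]; ring
    have e₃ : R / 4 * R * C = N * C / 4 := by rw [← hR]; ring
    rw [e₂] at h₂
    rw [e₃] at h₃
    linarith
  exact le_of_mul_le_mul_left hfin hNpos

/-- **Grothendieck's inequality** (with a non-optimal constant). -/
theorem grothendieck {a : κ → ι → ℝ} {m : ℝ}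
    (hm : ∀ (s : κ → ℝ) (t : ι → ℝ), (∀ k, |s k| ≤ 1) → (∀ j, |t j| ≤ 1) →
      ∑ k, ∑ j, a k j * (s k * t j) ≤ m) : IsGrothendieckBound a (98 * m) := by
  set U : Set ℝ := {C | IsGrothendieckBound a C}
  have hne : U.Nonempty := ⟨_, exists_isGrothendieckBound a⟩
  have hbdd : BddBelow U := ⟨0, fun C hC => by
    have := hC 0 (fun _ => 0) (fun _ => 0) (by simp) (by simp)
    simpa using this⟩
  have hmem : IsGrothendieckBound a (sInf U) := fun n x y hx hy =>
    le_csInf hne fun C hC => hC n x y hx hy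
  have := csInf_le hbdd (hmem.improve hm)
  intro n x y hx hy
  have := hmem n x y hx hy
  linarith

end Grothendieck

/-! ### Johnson's theorem -/

section Johnson

variable {X : Type*} [NormedAddCommGroup X] [NormedSpace ℝ X]
  {b : UnconditionalSchauderBasis ℕ+ ℝ X}

/-- On the span of `(b j : j ∈ J)`, the operator `R` factors with constant `C` through a finite
dimensional `ℓ₁`. -/
def FactorsThroughL1 (b : UnconditionalSchauderBasis ℕ+ ℝ X) (J : Finset ℕ+) (R : X →L[ℝ] X)
    (C : ℝ) : Prop :=
  ∃ (n : ℕ) (u : Fin n → ℕ+ → ℝ) (v : Fin n → X), (∀ k, ‖v k‖ ≤ 1) ∧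
    (∀ j ∈ J, R (b j) = ∑ k, u k j • v k) ∧
    ∀ a : ℕ+ → ℝ, ∑ k, |∑ j ∈ J, a j * u k j| ≤ C * ‖∑ j ∈ J, a j • b j‖

/-- `C` bounds the `ℓ₁`-norm by the norm on the span of `(b j : j ∈ s)`. -/
def IsL1Bound (b : UnconditionalSchauderBasis ℕ+ ℝ X) (s : Finset ℕ+) (C : ℝ) : Prop :=
  ∀ a : ℕ+ → ℝ, ∑ j ∈ s, |a j| ≤ C * ‖∑ j ∈ s, a j • b j‖

theorem abs_coord_le [CompleteSpace X] (hn : IsNormalizedBasis b) (h1 : IsOneUnconditional b)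
    (j : ℕ+) (x : X) : |b.coord j x| ≤ ‖x‖ := by
  have := abs_coord_mul_norm_le h1 j x
  rwa [hn j, mul_one] at this

theorem FactorsThroughL1.sum_le [CompleteSpace X] (hn : IsNormalizedBasis b)
    (h1 : IsOneUnconditional b) {J : Finset ℕ+} {R : X →L[ℝ] X} {C D : ℝ}
    (hR : FactorsThroughL1 b J R C) (hD : 0 < D) (hJ : IsL1Bound b J D) (a : ℕ+ → ℝ) :
    ∑ j ∈ J, |a j * b.coord j (R (b j))| ≤ 98 * C * √D * ‖∑ j ∈ J, a j • b j‖ := by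
  classical
  obtain ⟨n, u, v, hv, hRu, hu⟩ := hR
  set m := C * ‖∑ j ∈ J, a j • b j‖ with hm
  have hG : IsGrothendieckBound (fun (k : Fin n) (j : J) => a j * u k j) (98 * m) := by
    refine grothendieck fun s t hs ht => ?_
    set t' : ℕ+ → ℝ := fun j => if h : j ∈ J then t ⟨j, h⟩ else 0 with ht'
    have ht'1 : ∀ j ∈ J, |t' j| ≤ 1 := fun j hj => by
      simp only [ht', hj, dif_pos]
      exact ht _
    have hC : ∑ k, |∑ j ∈ J, (t' j * a j) * u k j| ≤ m := by
      have hC0 : 0 ≤ C ∨ ‖∑ j ∈ J, a j • b j‖ = 0 := by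
        by_contra! h'
        have h₁ := hu a
        have h₂ : 0 ≤ ∑ k, |∑ j ∈ J, a j * u k j| := Finset.sum_nonneg fun _ _ => abs_nonneg _
        have h₃ : 0 < ‖∑ j ∈ J, a j • b j‖ := lt_of_le_of_ne (norm_nonneg _) (Ne.symm h'.2)
        nlinarith
      have h₀ := h1.norm_sum_mul_le J a t' ht'1
      rcases hC0 with hC0 | hC0
      · exact (hu _).trans (mul_le_mul_of_nonneg_left h₀ hC0)
      · have : ‖∑ j ∈ J, (t' j * a j) • b j‖ = 0 :=
          le_antisymm (h₀.trans_eq hC0) (norm_nonneg _)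
        refine (hu _).trans ?_
        rw [this, hm, hC0]
    refine le_trans (Finset.sum_le_sum fun k _ => ?_) hC
    have : ∑ j : J, a j * u k j * (s k * t j) = s k * ∑ j ∈ J, (t' j * a j) * u k j := by
      rw [Finset.mul_sum, ← Finset.sum_coe_sort J]
      refine Finset.sum_congr rfl fun j _ => ?_
      simp only [ht', j.2, dif_pos]
      ring
    rw [this]
    refine (le_abs_self _).trans ?_
    rw [abs_mul]
    exact mul_le_of_le_one_left (abs_nonneg _) (hs k)
  set ε : ℕ+ → ℝ := fun j => SignType.sign (a j * b.coord j (R (b j))) with hε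
  have h := hG.le_mul (τ := J) (fun k l => b.coord l (v k)) (fun j l => if j = l then ε j else 0)
    (Real.sqrt_pos.2 hD) one_pos (fun k => ?_) fun j => ?_
  · have hsum : ∑ k, ∑ j : J, a j * u k j * ∑ l : J, b.coord l (v k) *
        (if j = l then ε j else 0) = ∑ j ∈ J, |a j * b.coord j (R (b j))| := by
      rw [Finset.sum_comm, ← Finset.sum_coe_sort J]
      refine Finset.sum_congr rfl fun j _ => ?_
      simp only [mul_ite, mul_zero, Finset.sum_ite_eq, Finset.mem_univ, if_true]
      rw [← sign_mul_self]
      simp only [hRu j j.2, map_sum, map_smul, smul_eq_mul, Finset.mul_sum, hε]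
      refine Finset.sum_congr rfl fun k _ => ?_
      ring
    rw [hsum] at h
    refine h.trans_eq ?_
    rw [hm]
    ring
  · rw [Real.sq_sqrt hD.le]
    calc ∑ l : J, b.coord l (v k) ^ 2 ≤ ∑ l : J, |b.coord l (v k)| := by
          refine Finset.sum_le_sum fun l _ => ?_
          rw [← sq_abs]
          have := (abs_coord_le hn h1 l (v k)).trans (hv k)
          have h0 := abs_nonneg (b.coord l (v k))
          nlinarith
      _ = ∑ l ∈ J, |b.coord l (v k)| := Finset.sum_coe_sort J fun l => |b.coord l (v k)|
      _ ≤ D * ‖∑ l ∈ J, b.coord l (v k) • b l‖ := hJ _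
      _ ≤ D * 1 := by
          refine mul_le_mul_of_nonneg_left ?_ hD.le
          rw [← coordProj_finset h1]
          exact (norm_coordProj_apply_le h1 _ _).trans (hv k)
      _ = D := mul_one D
  · simp only [ite_pow, ne_eq, OfNat.ofNat_ne_zero, not_false_eq_true, zero_pow,
      Finset.sum_ite_eq, Finset.mem_univ, if_true, one_pow, hε]
    rcases SignType.sign (a j * b.coord j (R (b j))) with _ | _ | _ <;> simp

theorem exists_factorsThroughL1 [CompleteSpace X] (h1 : IsOneUnconditional b) {c : ℝ} (hc : 0 < c)
    {L : ℕ+ → ℕ+} (hL : TailsEmbedInL1 b.basis c L) (J : Finset ℕ+) (N : Set ℕ+)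
    (hN : ∀ d : ℕ+, (d : ℕ) ≤ J.card → ∀ j ∈ N, L d ≤ j) (A B : X →L[ℝ] X) :
    FactorsThroughL1 b J (A.comp ((coordProj h1 N).comp B)) (2 / c * (‖A‖ * ‖B‖)) := by
  classical
  set P := (coordProj h1 N).comp B with hP
  set V : Submodule ℝ X := Submodule.span ℝ (J.image fun j => P (b j) : Finset X) with hV
  have hVcard : Module.finrank ℝ V ≤ J.card :=
    (finrank_span_finset_le_card _).trans Finset.card_image_le
  have hmem : ∀ j ∈ J, P (b j) ∈ V := fun j hj =>
    Submodule.subset_span (Finset.mem_coe.2 (Finset.mem_image_of_mem _ hj))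
  rcases Nat.eq_zero_or_pos (Module.finrank ℝ V) with h0 | hpos
  · have hbot : V = ⊥ := Submodule.finrank_eq_zero.1 h0
    refine ⟨0, fun _ _ => 0, fun _ => 0, by simp, fun j hj => ?_, fun a => ?_⟩
    · have := hmem j hj
      rw [hbot, Submodule.mem_bot] at this
      simp [this]
    · simp only [Finset.univ_eq_empty, Finset.sum_empty]
      positivity
  · set d : ℕ+ := ⟨Module.finrank ℝ V, hpos⟩ with hd
    have hrange : ∀ x, P x ∈ basisTail b.basis (L d) := fun x => by
      rw [mem_basisTail_iff]
      intro j hj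
      have : j ∉ N := fun hjN => absurd (hN d hVcard j hjN) (not_le.2 hj)
      simp [hP, this]
    have hVle : V ≤ basisTail b.basis (L d) := by
      rw [hV, Submodule.span_le]
      intro x hx
      obtain ⟨j, _, rfl⟩ := Finset.mem_image.1 (Finset.mem_coe.1 hx)
      exact hrange _
    set E : Submodule ℝ (basisTail b.basis (L d)) := V.comap (basisTail b.basis (L d)).subtype
    have hE : Module.finrank ℝ E = d :=
      (Submodule.comapSubtypeEquivOfLe hVle).finrank_eq
    obtain ⟨f, S, ⟨A₀, B₀, hA₀, hB₀, hcAB, hf⟩, hS, hSE⟩ := hL d E hE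
    let g : X → basisTail b.basis (L d) := fun x => ⟨P x, hrange x⟩
    have hg : ∀ j ∈ J, ∃ u : Fin (L d) → ℝ, ∑ k, u k • f k = S (g (b j)) := fun j hj =>
      Submodule.mem_span_range_iff_exists_fun ℝ |>.1 (hSE _ (hmem j hj))
    choose! u hu using hg
    set W := ‖A‖ * ‖(S.symm : basisTail b.basis (L d) →L[ℝ] basisTail b.basis (L d))‖ * B₀ with hW
    have hW0 : 0 ≤ W := by positivity
    have hfk : ∀ k, ‖f k‖ ≤ B₀ := fun k => by
      have := (hf {k} fun _ => 1).2
      simpa using this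
    have hAf : ∀ k, ‖A (S.symm (f k) : basisTail b.basis (L d))‖ ≤ W := fun k => by
      refine (A.le_opNorm _).trans ?_
      rw [hW, mul_assoc]
      refine mul_le_mul_of_nonneg_left ?_ (norm_nonneg _)
      refine ((S.symm : basisTail b.basis (L d) →L[ℝ] basisTail b.basis (L d)).le_opNorm _).trans ?_
      exact mul_le_mul_of_nonneg_left (hfk k) (norm_nonneg _)
    refine ⟨L d, fun k j => W * u j k, fun k => W⁻¹ • A (S.symm (f k) : basisTail b.basis (L d)),
      fun k => ?_, fun j hj => ?_, fun a => ?_⟩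
    · rw [norm_smul, norm_inv, Real.norm_of_nonneg hW0, ← div_eq_inv_mul]
      exact div_le_one_of_le₀ (hAf k) hW0
    · have h₁ : g (b j) = S.symm (∑ k, u j k • f k) := by rw [hu j hj, S.symm_apply_apply]
      have h₂ : A (P (b j)) = A ((g (b j) : basisTail b.basis (L d)) : X) := rfl
      rw [ContinuousLinearMap.comp_apply, h₂, h₁]
      simp only [map_sum, map_smul, Submodule.coe_sum, Submodule.coe_smul]
      refine Finset.sum_congr rfl fun k _ => ?_
      rcases hW0.eq_or_lt with hW' | hW'
      · have := hAf k
        rw [← hW', norm_le_zero_iff] at this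
        rw [this, smul_zero, smul_zero, smul_zero]
      · rw [smul_smul]
        congr 1
        field_simp
    · have h₁ : ∀ k, ∑ j ∈ J, a j * (W * u j k) = W * ∑ j ∈ J, a j * u j k := fun k => by
        rw [Finset.mul_sum]
        exact Finset.sum_congr rfl fun j _ => by ring
      simp only [h₁, abs_mul, abs_of_nonneg hW0, ← Finset.mul_sum]
      have h₂ := (hf Finset.univ fun k => ∑ j ∈ J, a j * u j k).1
      have h₃ : ∑ k, (∑ j ∈ J, a j * u j k) • f k = S (g (∑ j ∈ J, a j • b j)) := by
        have : g (∑ j ∈ J, a j • b j) = ∑ j ∈ J, a j • g (b j) := by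
          apply Subtype.ext
          simp [g, map_sum]
        rw [this, map_sum]
        simp only [Finset.sum_smul]
        rw [Finset.sum_comm]
        refine Finset.sum_congr rfl fun j hj => ?_
        rw [map_smul, ← hu j hj, Finset.smul_sum]
        exact Finset.sum_congr rfl fun k _ => mul_smul _ _ _
      rw [h₃] at h₂
      set x := ∑ j ∈ J, a j • b j
      set SL := (S : basisTail b.basis (L d) →L[ℝ] basisTail b.basis (L d))
      set SR := (S.symm : basisTail b.basis (L d) →L[ℝ] basisTail b.basis (L d))
      have h₄ : ‖S (g x)‖ ≤ ‖SL‖ * (‖B‖ * ‖x‖) := by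
        refine (SL.le_opNorm _).trans (mul_le_mul_of_nonneg_left ?_ (norm_nonneg _))
        exact (norm_coordProj_apply_le h1 N _).trans (B.le_opNorm x)
      set Q := ∑ k, |∑ j ∈ J, a j * u j k|
      have h₅ : Q ≤ ‖SL‖ * (‖B‖ * ‖x‖) / A₀ := by
        rw [le_div_iff₀ hA₀, mul_comm]
        exact h₂.trans h₄
      have h₆ : B₀ / A₀ ≤ 1 / c := by
        rw [div_le_div_iff₀ hA₀ hc]
        linarith
      calc W * Q ≤ W * (‖SL‖ * (‖B‖ * ‖x‖) / A₀) := mul_le_mul_of_nonneg_left h₅ hW0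
        _ = ‖SL‖ * ‖SR‖ * (B₀ / A₀) * (‖A‖ * ‖B‖ * ‖x‖) := by
            rw [hW]
            ring
        _ ≤ 2 * (1 / c) * (‖A‖ * ‖B‖ * ‖x‖) := by
            refine mul_le_mul_of_nonneg_right ?_ (by positivity)
            exact mul_le_mul hS h₆ (by positivity) (by norm_num)
        _ = 2 / c * (‖A‖ * ‖B‖) * ‖x‖ := by ring

theorem sum_abs_coord_finiteRank_le [CompleteSpace X] (hn : IsNormalizedBasis b)
    (h1 : IsOneUnconditional b) (J F : Finset ℕ+) (A B : X →L[ℝ] X) :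
    ∑ j ∈ J, |b.coord j (A (coordProj h1 F (B (b j))))| ≤ F.card * (‖A‖ * ‖B‖) := by
  have key : ∀ l, ∑ j ∈ J, |b.coord l (B (b j)) * b.coord j (A (b l))| ≤ ‖A‖ * ‖B‖ := by
    intro l
    set ε : ℕ+ → ℝ := fun j => SignType.sign (b.coord l (B (b j)) * b.coord j (A (b l))) with hε
    have hε1 : ∀ j, |ε j| ≤ 1 := fun j => by
      simp only [hε]
      rcases SignType.sign (b.coord l (B (b j)) * b.coord j (A (b l))) with _ | _ | _ <;> simp
    have h : ∑ j ∈ J, |b.coord l (B (b j)) * b.coord j (A (b l))| =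
        b.coord l (B (∑ j ∈ J, (ε j * b.coord j (A (b l))) • b j)) := by
      simp only [map_sum, map_smul, smul_eq_mul]
      refine Finset.sum_congr rfl fun j _ => ?_
      rw [← sign_mul_self]
      simp only [hε]
      ring
    rw [h]
    refine (le_abs_self _).trans ((abs_coord_le hn h1 l _).trans ((B.le_opNorm _).trans ?_))
    rw [mul_comm]
    refine mul_le_mul_of_nonneg_right ?_ (norm_nonneg _)
    refine (h1.norm_sum_mul_le J _ ε fun j _ => hε1 j).trans ?_
    rw [← coordProj_finset h1]
    refine (norm_coordProj_apply_le h1 _ _).trans ((A.le_opNorm _).trans_eq ?_)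
    rw [hn l, mul_one]
  calc ∑ j ∈ J, |b.coord j (A (coordProj h1 F (B (b j))))|
      ≤ ∑ j ∈ J, ∑ l ∈ F, |b.coord l (B (b j)) * b.coord j (A (b l))| := by
        refine Finset.sum_le_sum fun j _ => ?_
        rw [coordProj_finset]
        simp only [map_sum, map_smul, smul_eq_mul]
        exact Finset.abs_sum_le_sum_abs _ _
    _ = ∑ l ∈ F, ∑ j ∈ J, |b.coord l (B (b j)) * b.coord j (A (b l))| := Finset.sum_comm
    _ ≤ ∑ _l ∈ F, ‖A‖ * ‖B‖ := Finset.sum_le_sum fun l _ => key l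
    _ = F.card * (‖A‖ * ‖B‖) := by rw [Finset.sum_const, nsmul_eq_mul]

/-- Even after the removal of any `r` coordinates, the `ℓ₁`-norm is not bounded by `K` times the
norm on the span of `(b j : j ∈ J)`. -/
def IsFarFromL1 (b : UnconditionalSchauderBasis ℕ+ ℝ X) (J : Finset ℕ+) (r : ℕ) (K : ℝ) : Prop :=
  ∀ G ⊆ J, (J \ G).card ≤ r → ∃ s ⊆ G, ∃ a : ℕ+ → ℝ, K * ‖∑ j ∈ s, a j • b j‖ < ∑ j ∈ s, |a j|

theorem exists_tail_not_l1 [CompleteSpace X] (hn : IsNormalizedBasis b) (h1 : IsOneUnconditional b)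
    (hne : ¬ IsEquivalentToL1Basis b.basis) (n : ℕ+) (K : ℝ) :
    ∃ s : Finset ℕ+, (∀ j ∈ s, n ≤ j) ∧ ∃ a : ℕ+ → ℝ,
      K * ‖∑ j ∈ s, a j • b j‖ < ∑ j ∈ s, |a j| := by
  classical
  by_contra! hcon
  set D : ℝ := (Finset.Iio n).card + |K| + 1 with hD
  have hDpos : 0 < D := by positivity
  refine hne ⟨D⁻¹, inv_pos.2 hDpos, D⁻¹, 1, inv_pos.2 hDpos, one_pos, (mul_one _).le,
    fun s a => ⟨?_, ?_⟩⟩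
  · rw [inv_mul_le_iff₀ hDpos]
    set x := ∑ j ∈ s, a j • b j with hx
    have hcx : ∀ j ∈ s, |a j| ≤ ‖x‖ := fun j hj => by
      have := abs_coord_le hn h1 j x
      rwa [hx, coord_sum_smul_basis, if_pos hj] at this
    have h₁ : ∑ j ∈ s with j < n, |a j| ≤ (Finset.Iio n).card * ‖x‖ := by
      refine (Finset.sum_le_card_nsmul _ _ ‖x‖ fun j hj => hcx j (Finset.mem_filter.1 hj).1).trans ?_
      rw [nsmul_eq_mul]
      refine mul_le_mul_of_nonneg_right ?_ (norm_nonneg _)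
      exact_mod_cast Finset.card_le_card fun j hj =>
        Finset.mem_Iio.2 (Finset.mem_filter.1 hj).2
    have h₂ : ∑ j ∈ s with ¬ j < n, |a j| ≤ |K| * ‖x‖ := by
      refine (hcon _ (fun j hj => not_lt.1 (Finset.mem_filter.1 hj).2) a).trans ?_
      refine (mul_le_mul_of_nonneg_right (le_abs_self K) (norm_nonneg _)).trans ?_
      refine mul_le_mul_of_nonneg_left ?_ (abs_nonneg K)
      rw [Finset.sum_filter]
      refine le_trans (le_of_eq ?_) (h1.norm_sum_mul_le s a (fun j => if ¬ j < n then 1 else 0)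
        fun j _ => by split_ifs <;> simp)
      congr 1
      refine Finset.sum_congr rfl fun j _ => ?_
      split_ifs <;> simp
    rw [← Finset.sum_filter_add_sum_filter_not s (· < n)]
    have h₃ := norm_nonneg x
    nlinarith
  · rw [one_mul]
    refine (norm_sum_le _ _).trans_eq (Finset.sum_congr rfl fun j _ => ?_)
    rw [norm_smul, hn j, mul_one, Real.norm_eq_abs]

theorem exists_isFarFromL1 [CompleteSpace X] (hn : IsNormalizedBasis b)
    (h1 : IsOneUnconditional b) (hne : ¬ IsEquivalentToL1Basis b.basis) (n : ℕ+) (r : ℕ) (K : ℝ) :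
    ∃ J : Finset ℕ+, (∀ j ∈ J, n ≤ j) ∧ IsFarFromL1 b J r K := by
  classical
  induction r with
  | zero =>
    obtain ⟨s, hs, a, ha⟩ := exists_tail_not_l1 hn h1 hne n K
    refine ⟨s, hs, fun G hG hc => ⟨s, ?_, a, ha⟩⟩
    rwa [Nat.le_zero, Finset.card_eq_zero, Finset.sdiff_eq_empty_iff_subset] at hc
  | succ r ih =>
    obtain ⟨J, hJ, hfar⟩ := ih
    obtain ⟨s, hs, a, ha⟩ := exists_tail_not_l1 hn h1 hne (n + J.sup id + 1) K
    refine ⟨J ∪ s, fun j hj => ?_, fun G hG hc => ?_⟩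
    · rcases Finset.mem_union.1 hj with hj | hj
      · exact hJ j hj
      · exact le_trans (by rw [add_assoc]; exact (PNat.lt_add_right n _).le) (hs j hj)
    · by_cases hsG : s ⊆ G
      · exact ⟨s, hsG, a, ha⟩
      · obtain ⟨i, his, hiG⟩ := Finset.not_subset.1 hsG
        have hiJ : i ∉ J := fun hiJ => by
          have h₁ : i ≤ J.sup id := Finset.le_sup (f := id) hiJ
          have h₂ := hs i his
          have h₃ : J.sup id < n + J.sup id + 1 :=
            (PNat.lt_add_left _ _).trans (PNat.lt_add_right _ _)
          exact absurd (h₂.trans h₁) (not_le.2 h₃)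
        obtain ⟨t, ht, a', ha'⟩ := hfar (J ∩ G) Finset.inter_subset_left (by
          have hss : insert i (J \ (J ∩ G)) ⊆ (J ∪ s) \ G := by
            intro k hk
            simp only [Finset.mem_insert, Finset.mem_sdiff, Finset.mem_inter, Finset.mem_union]
              at hk ⊢
            rcases hk with rfl | ⟨h₁, h₂⟩
            · exact ⟨Or.inr his, hiG⟩
            · exact ⟨Or.inl h₁, fun h => h₂ ⟨h₁, h⟩⟩
          have := (Finset.card_le_card hss).trans hc
          rw [Finset.card_insert_of_notMem (by simp [hiJ])] at this
          omega)
        exact ⟨t, ht.trans Finset.inter_subset_right, a', ha'⟩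

end Johnson

section Johnson

variable {X : Type*} [NormedAddCommGroup X] [NormedSpace ℝ X]
  {b : UnconditionalSchauderBasis ℕ+ ℝ X}

theorem IsL1Bound.mono {s : Finset ℕ+} {C D : ℝ} (h : IsL1Bound b s C) (hCD : C ≤ D) :
    IsL1Bound b s D := fun a => (h a).trans (mul_le_mul_of_nonneg_right hCD (norm_nonneg _))

theorem IsL1Bound.of_self_improving [CompleteSpace X] (hn : IsNormalizedBasis b)
    (h1 : IsOneUnconditional b) {s : Finset ℕ+} {Q : ℝ}
    (h : ∀ D, 0 < D → IsL1Bound b s D → IsL1Bound b s (Q * √D)) : IsL1Bound b s (Q ^ 2) := by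
  set U : Set ℝ := {D | 0 ≤ D ∧ IsL1Bound b s D}
  have hbdd : BddBelow U := ⟨0, fun D hD => hD.1⟩
  have hne : U.Nonempty := by
    refine ⟨s.card, Nat.cast_nonneg _, fun a => ?_⟩
    rw [← nsmul_eq_mul]
    refine Finset.sum_le_card_nsmul _ _ _ fun j hj => ?_
    have := abs_coord_le hn h1 j (∑ j ∈ s, a j • b j)
    rwa [coord_sum_smul_basis, if_pos hj] at this
  set D := sInf U
  have hD0 : 0 ≤ D := le_csInf hne fun C hC => hC.1
  have hD : IsL1Bound b s D := fun a => by
    rcases (norm_nonneg (∑ j ∈ s, a j • b j)).eq_or_lt with h0 | h0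
    · obtain ⟨C, hC⟩ := hne
      have := hC.2 a
      rwa [← h0, mul_zero] at this ⊢
    · rw [← div_le_iff₀ h0]
      exact le_csInf hne fun C hC => (div_le_iff₀ h0).2 (hC.2 a)
  rcases hD0.eq_or_lt with h0 | h0
  · exact hD.mono (by rw [← h0]; positivity)
  · have hQ := h D h0 hD
    have hsq : √D ^ 2 = D := Real.sq_sqrt hD0
    have hpos : 0 < √D := Real.sqrt_pos.2 h0
    rcases le_or_gt 0 (Q * √D) with hQD | hQD
    · have hle : D ≤ Q * √D := csInf_le hbdd ⟨hQD, hQ⟩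
      refine hD.mono ?_
      have : √D ≤ Q := by
        by_contra! hlt
        nlinarith
      nlinarith
    · exact (hQ.mono hQD.le).mono (sq_nonneg Q)

theorem sum_abs_coord_le_of_norm_sub_lt [CompleteSpace X] (hn : IsNormalizedBasis b)
    (h1 : IsOneUnconditional b) {c : ℝ} (hc : 0 < c) {L : ℕ+ → ℕ+}
    (hL : TailsEmbedInL1 b.basis c L) {J F : Finset ℕ+} {M N : Set ℕ+} (hJM : ∀ j ∈ J, j ∈ M)
    (hFN : Disjoint (F : Set ℕ+) N)
    (hN : ∀ d : ℕ+, (d : ℕ) ≤ J.card → ∀ j ∈ N, L d ≤ j) {n : ℕ} (A B : Fin n → X →L[ℝ] X)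
    (hlt : ‖coordProj h1 M - ∑ l, (A l).comp ((coordProj h1 (F ∪ N)).comp (B l))‖ < 1 / 4)
    {r : ℕ} {K : ℝ} (hr : F.card * (4 * ∑ l, ‖A l‖ * ‖B l‖) ≤ r)
    (hK : (196 * (2 / c) * ∑ l, ‖A l‖ * ‖B l‖) ^ 2 ≤ K) : ¬ IsFarFromL1 b J r K := by
  classical
  set S := ∑ l, ‖A l‖ * ‖B l‖ with hS
  set φ : ℕ+ → ℝ := fun j => ∑ l, b.coord j (A l (coordProj h1 F (B l (b j)))) with hφ
  set ψ : ℕ+ → ℝ := fun j => ∑ l, b.coord j (A l (coordProj h1 N (B l (b j)))) with hψ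
  have hproj : ∀ x, coordProj h1 (F ∪ N) x = coordProj h1 F x + coordProj h1 N x := fun x => by
    refine eq_of_coord_eq b fun j => ?_
    rw [map_add, coord_coordProj, coord_coordProj, coord_coordProj]
    by_cases hF : j ∈ (F : Set ℕ+)
    · have : j ∉ N := Set.disjoint_left.1 hFN hF
      simp [hF, this]
    · simp [hF]
  have hdiag : ∀ j ∈ J, |1 - (φ j + ψ j)| ≤ 1 / 4 := fun j hj => by
    set D := coordProj h1 M - ∑ l, (A l).comp ((coordProj h1 (F ∪ N)).comp (B l)) with hD
    have h₁ : b.coord j (D (b j)) = 1 - (φ j + ψ j) := by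
      simp only [hD, hφ, hψ, sub_apply, map_sub, coord_coordProj, hJM j hj,
        if_true, sum_apply, ContinuousLinearMap.comp_apply, hproj, map_add,
        map_sum, Finset.sum_add_distrib, coord_basis]
    rw [← h₁]
    refine (abs_coord_le hn h1 j _).trans ((D.le_opNorm _).trans ?_)
    rw [hn j, mul_one]
    exact hlt.le
  set G := J.filter fun j => |φ j| ≤ 1 / 4 with hG
  intro hfar
  have hcard : (J \ G).card ≤ r := by
    have h₁ : ((J \ G).card : ℝ) * (1 / 4) ≤ F.card * S := by
      calc ((J \ G).card : ℝ) * (1 / 4) = ∑ _j ∈ J \ G, (1 / 4 : ℝ) := by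
            rw [Finset.sum_const, nsmul_eq_mul]
        _ ≤ ∑ j ∈ J \ G, |φ j| := by
            refine Finset.sum_le_sum fun j hj => ?_
            rw [Finset.mem_sdiff, hG, Finset.mem_filter, not_and] at hj
            exact (not_le.1 (hj.2 hj.1)).le
        _ ≤ ∑ j ∈ J, |φ j| := Finset.sum_le_sum_of_subset_of_nonneg Finset.sdiff_subset
            fun _ _ _ => abs_nonneg _
        _ ≤ ∑ j ∈ J, ∑ l, |b.coord j (A l (coordProj h1 F (B l (b j))))| :=
            Finset.sum_le_sum fun j _ => Finset.abs_sum_le_sum_abs _ _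
        _ = ∑ l, ∑ j ∈ J, |b.coord j (A l (coordProj h1 F (B l (b j))))| := Finset.sum_comm
        _ ≤ ∑ l, F.card * (‖A l‖ * ‖B l‖) :=
            Finset.sum_le_sum fun l _ => sum_abs_coord_finiteRank_le hn h1 J F (A l) (B l)
        _ = F.card * S := by rw [← Finset.mul_sum]
    have : ((J \ G).card : ℝ) ≤ r := by linarith
    exact_mod_cast this
  obtain ⟨s, hsG, a, ha⟩ := hfar G (Finset.filter_subset _ _) hcard
  have hsJ : s ⊆ J := hsG.trans (Finset.filter_subset _ _)
  have hψ2 : ∀ j ∈ s, 1 / 2 ≤ |ψ j| := fun j hj => by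
    have h₁ := abs_le.1 (hdiag j (hsJ hj))
    have h₂ := abs_le.1 (Finset.mem_filter.1 (hsG hj)).2
    exact le_trans (by linarith [h₁.1, h₁.2, h₂.1, h₂.2]) (le_abs_self _)
  have hbound : IsL1Bound b s ((196 * (2 / c) * S) ^ 2) := by
    refine IsL1Bound.of_self_improving hn h1 fun D hD hDs a => ?_
    have hl : ∀ l, ∑ j ∈ s, |a j * b.coord j (A l (coordProj h1 N (B l (b j))))| ≤
        98 * (2 / c * (‖A l‖ * ‖B l‖)) * √D * ‖∑ j ∈ s, a j • b j‖ := fun l =>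
      (exists_factorsThroughL1 h1 hc hL s N
        (fun d hd => hN d (hd.trans (Finset.card_le_card hsJ))) (A l) (B l)).sum_le hn h1 hD hDs a
    calc ∑ j ∈ s, |a j| ≤ ∑ j ∈ s, 2 * |a j * ψ j| := by
          refine Finset.sum_le_sum fun j hj => ?_
          rw [abs_mul]
          have := hψ2 j hj
          nlinarith [abs_nonneg (a j)]
      _ ≤ ∑ j ∈ s, 2 * ∑ l, |a j * b.coord j (A l (coordProj h1 N (B l (b j))))| := by
          refine Finset.sum_le_sum fun j _ => mul_le_mul_of_nonneg_left ?_ (by norm_num)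
          simp only [hψ, Finset.mul_sum]
          exact Finset.abs_sum_le_sum_abs _ _
      _ = 2 * ∑ l, ∑ j ∈ s, |a j * b.coord j (A l (coordProj h1 N (B l (b j))))| := by
          rw [← Finset.mul_sum, Finset.sum_comm]
      _ ≤ 2 * ∑ l, 98 * (2 / c * (‖A l‖ * ‖B l‖)) * √D * ‖∑ j ∈ s, a j • b j‖ :=
          mul_le_mul_of_nonneg_left (Finset.sum_le_sum fun l _ => hl l) (by norm_num)
      _ = 196 * (2 / c) * S * √D * ‖∑ j ∈ s, a j • b j‖ := by
          rw [hS, ← Finset.sum_mul, ← Finset.sum_mul, ← Finset.mul_sum, ← Finset.mul_sum]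
          ring
  exact absurd ((hbound.mono hK) a) (not_le.2 ha)

theorem exists_blocks [CompleteSpace X] (hn : IsNormalizedBasis b)
    (h1 : IsOneUnconditional b) (hne : ¬ IsEquivalentToL1Basis b.basis) (L : ℕ+ → ℕ+) :
    ∃ J U : ℕ → Finset ℕ+, (∀ i, U (i + 1) = U i ∪ J i) ∧ (∀ i, ∀ u ∈ U i, ∀ j ∈ J i, u < j) ∧
      (∀ i, ∀ d : ℕ+, (d : ℕ) ≤ (U i).card → ∀ j ∈ J i, L d ≤ j) ∧
      ∀ i, IsFarFromL1 b (J i) (i * (U i).card) i := by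
  classical
  have hstep : ∀ (i : ℕ) (U : Finset ℕ+), ∃ J : Finset ℕ+,
      (∀ j ∈ J, U.sup id + (Finset.Iic (U.card.succPNat)).sup L ≤ j) ∧
        IsFarFromL1 b J (i * U.card) i := fun i U => exists_isFarFromL1 hn h1 hne _ _ _
  choose step hstep₁ hstep₂ using hstep
  let U : ℕ → Finset ℕ+ := fun i => Nat.rec ∅ (fun i U => U ∪ step i U) i
  refine ⟨fun i => step i (U i), U, fun i => rfl, fun i u hu j hj => ?_, fun i d hd j hj => ?_,
    fun i => hstep₂ i (U i)⟩
  · have h₁ : u ≤ (U i).sup id := Finset.le_sup (f := id) hu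
    exact (h₁.trans_lt (PNat.lt_add_right _ _)).trans_le (hstep₁ i (U i) j hj)
  · have h₁ : L d ≤ (Finset.Iic ((U i).card.succPNat)).sup L := Finset.le_sup <| by
      rw [Finset.mem_Iic, ← PNat.coe_le_coe, Nat.succPNat_coe]
      omega
    exact (h₁.trans (PNat.lt_add_left _ _).le).trans (hstep₁ i (U i) j hj)

/-- **Johnson's theorem**: if the tails of the basis embed well into `ℓ₁`, but the basis is not
equivalent to that of `ℓ₁`, then there are spatial projections with the tree condition. -/
theorem exists_treeCondition [CompleteSpace X] (hn : IsNormalizedBasis b)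
    (h1 : IsOneUnconditional b) (hne : ¬ IsEquivalentToL1Basis b.basis)
    (h : ∃ c > 0, ∃ L : ℕ+ → ℕ+, TailsEmbedInL1 b.basis c L) :
    ∃ T : Set ℕ+ → X →L[ℝ] X,
      (∀ N : Set ℕ+, N.Infinite → IsSpatialProjection b (T N)) ∧ TreeCondition T := by
  classical
  obtain ⟨c, hc, L, hL⟩ := h
  obtain ⟨J, U, hU, hlt, hLJ, hfar⟩ := exists_blocks hn h1 hne L
  have hUmono : Monotone U := monotone_nat_of_le_succ fun i => by
    rw [hU]
    exact Finset.subset_union_left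
  have hJU : ∀ {i k}, i < k → J i ⊆ U k := fun {i k} hik =>
    (show J i ⊆ U (i + 1) by rw [hU]; exact Finset.subset_union_right).trans (hUmono hik)
  have hJne : ∀ i, (J i).Nonempty := fun i => by
    obtain ⟨s, hs, a, ha⟩ := hfar i (J i) (Finset.Subset.refl _) (by simp)
    refine Finset.nonempty_iff_ne_empty.2 fun hJ => ?_
    rw [hJ, Finset.subset_empty] at hs
    simp [hs] at ha
  have hJinj : ∀ {i k j}, j ∈ J i → j ∈ J k → i = k := fun {i k j} hi hk => by
    by_contra hik
    rcases lt_or_gt_of_ne hik with h | h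
    · exact lt_irrefl j (hlt k j (hJU h hi) j hk)
    · exact lt_irrefl j (hlt i j (hJU h hk) j hi)
  let A : Set ℕ+ → Set ℕ+ := fun N => {j | ∃ n ∈ N, j ∈ J n}
  have hAmono : ∀ {M N}, M ⊆ N → A M ⊆ A N := fun h j ⟨n, hn, hj⟩ => ⟨n, h hn, hj⟩
  refine ⟨fun N => coordProj h1 (A N), fun N hN => isSpatialProjection_coordProj h1 ?_, 1 / 4,
    by norm_num, fun M N hM hN => ⟨fun hMN => ?_, fun hMN => ?_⟩⟩
  · have hinf := hN.to_subtype
    choose f hf using hJne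
    refine Set.infinite_of_injective_forall_mem (f := fun n : N => f n) (fun m n hmn => ?_)
      fun n => ⟨n, n.2, hf n⟩
    have hmn' : f (m : ℕ+) = f (n : ℕ+) := hmn
    have := hJinj (hf (m : ℕ+)) (hmn' ▸ hf (n : ℕ+))
    exact Subtype.ext (PNat.coe_injective this)
  · refine subset_closure ⟨1, fun _ => coordProj h1 (A M), fun _ => coordProj h1 (A N),
      fun _ => ContinuousLinearMap.id ℝ X, fun _ => rfl, ?_⟩
    simp [coordProj_comp_of_subset h1 (hAmono hMN)]
  · rw [closedIdealGen, Metric.infDist_closure]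
    refine (Metric.le_infDist ?_).2 ?_
    · exact ⟨0, 0, fun _ => 0, fun _ => 0, fun _ => 0, by simp, by simp⟩
    rintro R ⟨n, A', T, B', hT, rfl⟩
    simp only [Set.mem_singleton_iff] at hT
    simp only [hT]
    by_contra! hd
    rw [dist_eq_norm] at hd
    set S := ∑ l, ‖A' l‖ * ‖B' l‖ with hS
    obtain ⟨q, hq⟩ := exists_nat_ge (4 * S + (196 * (2 / c) * S) ^ 2)
    obtain ⟨i, ⟨hiM, hiN⟩, hi⟩ : ∃ i ∈ M \ N, q.succPNat < i := by
      by_contra! hcon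
      exact hMN ((Set.finite_Iic (q.succPNat)).subset fun i hi => hcon i hi)
    have hqi : (q : ℝ) ≤ (i : ℕ) := by
      have := PNat.coe_lt_coe _ _ |>.2 hi
      rw [Nat.succPNat_coe] at this
      exact_mod_cast (Nat.le_succ q).trans this.le
    have hS0 : 0 ≤ S := Finset.sum_nonneg fun l _ => by positivity
    set F := (U i).filter (· ∈ A N) with hF
    set N' : Set ℕ+ := {j | ∃ n ∈ N, i < n ∧ j ∈ J n} with hN'
    have hAN : A N = (F : Set ℕ+) ∪ N' := by
      ext j
      simp only [hF, hN', Set.mem_union, Finset.coe_filter, Set.mem_ofPred_eq]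
      constructor
      · rintro ⟨n, hn, hj⟩
        rcases lt_trichotomy n i with h | h | h
        · exact Or.inl ⟨hJU (PNat.coe_lt_coe _ _ |>.2 h) hj, n, hn, hj⟩
        · exact absurd (h ▸ hn) hiN
        · exact Or.inr ⟨n, hn, h, hj⟩
      · rintro (⟨_, h⟩ | ⟨n, hn, _, hj⟩)
        · exact h
        · exact ⟨n, hn, hj⟩
    refine sum_abs_coord_le_of_norm_sub_lt hn h1 hc hL (J := J i) (F := F) (M := A M) (N := N')
      (fun j hj => ⟨i, hiM, hj⟩) ?_ ?_ A' B' (by rwa [← hAN]) (r := i * (U i).card) (K := (i : ℕ))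
      ?_ ?_ (hfar i)
    · rw [Set.disjoint_left]
      rintro j hj ⟨n, _, hin, hjn⟩
      have h₁ : j ∈ U n := hUmono (PNat.coe_le_coe _ _ |>.2 hin.le)
        (Finset.mem_filter.1 (Finset.mem_coe.1 hj)).1
      exact lt_irrefl j (hlt n j h₁ j hjn)
    · rintro d hd j ⟨n, _, hin, hjn⟩
      exact hLJ n d (hd.trans (Finset.card_le_card (hJU (PNat.coe_lt_coe _ _ |>.2 hin)))) j hjn
    · have h₁ : (F.card : ℝ) ≤ (U i).card := by
        exact_mod_cast Finset.card_le_card (Finset.filter_subset _ _)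
      push_cast
      rw [mul_comm]
      refine mul_le_mul ?_ h₁ (Nat.cast_nonneg _) (Nat.cast_nonneg _)
      nlinarith [sq_nonneg (196 * (2 / c) * S)]
    · linarith

end Johnson

/-! ### The number of closed ideals -/

section Ideals

variable {X : Type*} [NormedAddCommGroup X] [NormedSpace ℝ X]

/-- The ideal of `𝓛(X)` generated by `𝒯`, as a subspace. -/
def idealGen (𝒯 : Set (X →L[ℝ] X)) : Submodule ℝ (X →L[ℝ] X) where
  carrier := {R | ∃ (n : ℕ) (A T B : Fin n → X →L[ℝ] X),
    (∀ j, T j ∈ 𝒯) ∧ R = ∑ j, (A j).comp ((T j).comp (B j))}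
  zero_mem' := ⟨0, 0, 0, 0, fun j => j.elim0, by simp⟩
  add_mem' := by
    rintro _ _ ⟨n, A, T, B, hT, rfl⟩ ⟨n', A', T', B', hT', rfl⟩
    refine ⟨n + n', Fin.append A A', Fin.append T T', Fin.append B B', fun j => ?_, ?_⟩
    · refine Fin.addCases (fun i => ?_) (fun i => ?_) j
      · simpa using hT i
      · simpa using hT' i
    · simp [Fin.sum_univ_add]
  smul_mem' := by
    rintro c _ ⟨n, A, T, B, hT, rfl⟩
    refine ⟨n, fun j => c • A j, T, B, hT, ?_⟩
    simp [Finset.smul_sum]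

theorem isClosedIdeal_idealGen (𝒯 : Set (X →L[ℝ] X)) :
    IsClosedIdeal (idealGen 𝒯).topologicalClosure where
  isClosed := Submodule.isClosed_topologicalClosure _
  comp_left A T hT := by
    refine map_mem_closure (f := fun R : X →L[ℝ] X => A.comp R) (by fun_prop) hT ?_
    rintro _ ⟨n, A', T', B', hT', rfl⟩
    refine ⟨n, fun j => A.comp (A' j), T', B', hT', ?_⟩
    ext x
    simp
  comp_right A T hT := by
    refine map_mem_closure (f := fun R : X →L[ℝ] X => R.comp A) (by fun_prop) hT ?_
    rintro _ ⟨n, A', T', B', hT', rfl⟩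
    refine ⟨n, A', T', fun j => (B' j).comp A, hT', ?_⟩
    ext x
    simp

theorem mem_closedIdealGen_of_mem {𝒯 : Set (X →L[ℝ] X)} {T : X →L[ℝ] X} (hT : T ∈ 𝒯) :
    T ∈ closedIdealGen 𝒯 :=
  subset_closure ⟨1, fun _ => .id ℝ X, fun _ => T, fun _ => .id ℝ X, fun _ => hT, by simp⟩

/-- The set of (codes of) the initial segments of the branch `x` of the binary tree. -/
def branchSet (x : ℕ → Bool) : Set ℕ+ :=
  Set.range fun n => (Encodable.encode (List.ofFn fun i : Fin n => x i)).succPNat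

theorem ofFn_injective_aux {x y : ℕ → Bool} {m n : ℕ}
    (h : (Encodable.encode (List.ofFn fun i : Fin m => x i)).succPNat =
      (Encodable.encode (List.ofFn fun i : Fin n => y i)).succPNat) :
    m = n ∧ ∀ i < m, x i = y i := by
  have h := Encodable.encode_injective (Nat.succPNat_injective h)
  have hmn : m = n := by simpa using congrArg List.length h
  subst hmn
  refine ⟨rfl, fun i hi => ?_⟩
  have := List.ofFn_injective h
  exact congrFun this ⟨i, hi⟩

theorem infinite_branchSet (x : ℕ → Bool) : (branchSet x).Infinite :=
  Set.infinite_range_of_injective fun _ _ h => (ofFn_injective_aux h).1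

theorem finite_branchSet_inter {x y : ℕ → Bool} (h : x ≠ y) :
    (branchSet x ∩ branchSet y).Finite := by
  obtain ⟨k, hk⟩ := Function.ne_iff.1 h
  refine ((Set.finite_Iic k).image fun n =>
    (Encodable.encode (List.ofFn fun i : Fin n => x i)).succPNat).subset ?_
  rintro _ ⟨⟨m, rfl⟩, ⟨n, hn⟩⟩
  refine ⟨m, ?_, rfl⟩
  obtain ⟨rfl, h⟩ := ofFn_injective_aux hn
  by_contra hlt
  exact hk (h k (not_le.1 hlt)).symm

theorem TreeCondition.injective_ideal {T : Set ℕ+ → X →L[ℝ] X} (hT : TreeCondition T) :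
    Function.Injective fun 𝒜 : Set (ℕ → Bool) =>
      (idealGen ((fun x => T (branchSet x)) '' 𝒜)).topologicalClosure := by
  have key : ∀ 𝒜 ℬ : Set (ℕ → Bool),
      closedIdealGen ((fun x => T (branchSet x)) '' 𝒜) ⊆
        closedIdealGen ((fun x => T (branchSet x)) '' ℬ) → 𝒜 ⊆ ℬ := by
    intro 𝒜 ℬ hsub x hx
    by_contra hxB
    obtain ⟨c, hc, hT⟩ := hT
    have hmem := hsub (mem_closedIdealGen_of_mem (Set.mem_image_of_mem _ hx))
    obtain ⟨R, ⟨n, A, S, B, hS, rfl⟩, hR⟩ := Metric.mem_closure_iff.1 hmem c hc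
    choose y hy hyS using hS
    set z : ℕ → Bool := fun n => !x n
    have hz : x ≠ z := fun h => by simpa [z] using congrFun h 0
    set N : Set ℕ+ := branchSet z ∪ ⋃ j, branchSet (y j) with hN
    have hNinf : N.Infinite := (infinite_branchSet z).mono Set.subset_union_left
    have hdiff : (branchSet x \ N).Infinite := by
      have hfin : (branchSet x ∩ N).Finite := by
        rw [hN, Set.inter_union_distrib_left, Set.inter_iUnion]
        refine (finite_branchSet_inter hz).union (Set.finite_iUnion fun j => ?_)
        exact finite_branchSet_inter fun h => hxB (h ▸ hy j)
      rw [← Set.sdiff_self_inter]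
      exact (infinite_branchSet x).sdiff hfin
    have hsum : ∑ j, (A j).comp ((S j).comp (B j)) ∈ (idealGen {T N}).topologicalClosure := by
      refine Submodule.sum_mem _ fun j _ => ?_
      refine (isClosedIdeal_idealGen _).comp_left _ _ ((isClosedIdeal_idealGen _).comp_right _ _ ?_)
      rw [← hyS j]
      exact (hT _ _ (infinite_branchSet _) hNinf).1
        ((Set.subset_iUnion (fun j => branchSet (y j)) j).trans Set.subset_union_right)
    have h₁ := (hT _ _ (infinite_branchSet x) hNinf).2 hdiff
    have h₂ : Metric.infDist (T (branchSet x)) (closedIdealGen {T N}) ≤ _ :=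
      Metric.infDist_le_dist_of_mem hsum
    exact absurd (h₁.trans h₂) (not_le.2 hR)
  intro 𝒜 ℬ h
  have h' := congrArg (fun J : Submodule ℝ (X →L[ℝ] X) => (J : Set (X →L[ℝ] X))) h
  exact Set.Subset.antisymm (key _ _ h'.subset) (key _ _ h'.symm.subset)

end Ideals

theorem mk_continuousLinearMap_le_continuum {X : Type} [NormedAddCommGroup X] [NormedSpace ℝ X]
    (b : UnconditionalSchauderBasis ℕ+ ℝ X) :
    Cardinal.mk (X →L[ℝ] X) ≤ Cardinal.continuum := by
  have hX : Cardinal.mk X ≤ Cardinal.continuum := by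
    have hinj : Function.Injective fun (x : X) (j : ℕ+) => b.coord j x :=
      fun x y h => eq_of_coord_eq b fun j => congrFun h j
    refine (Cardinal.mk_le_of_injective hinj).trans ?_
    simp [Cardinal.mk_real]
  have hinj : Function.Injective fun (T : X →L[ℝ] X) (j : ℕ+) => T (b j) := by
    intro T S h
    ext x
    have h₁ := (b.expansion x).mapL T
    have h₂ := (b.expansion x).mapL S
    simp only [map_smul] at h₁ h₂
    have h₃ : ∀ j, T (b j) = S (b j) := fun j => congrFun h j
    simp only [h₃] at h₁
    exact h₁.unique h₂
  refine (Cardinal.mk_le_of_injective hinj).trans ?_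
  simp only [Cardinal.mk_pi, Cardinal.prod_const, Cardinal.mk_pnat, Cardinal.lift_uzero]
  refine (Cardinal.power_le_power_right hX).trans ?_
  simp

theorem TreeCondition.mk_closedIdeals {X : Type} [NormedAddCommGroup X] [NormedSpace ℝ X]
    (b : UnconditionalSchauderBasis ℕ+ ℝ X) {T : Set ℕ+ → X →L[ℝ] X} (hT : TreeCondition T) :
    Cardinal.mk {J : Submodule ℝ (X →L[ℝ] X) // IsClosedIdeal J} = 2 ^ Cardinal.continuum := by
  apply le_antisymm
  · have hinj : Function.Injective fun J : {J : Submodule ℝ (X →L[ℝ] X) // IsClosedIdeal J} =>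
        (J.1 : Set (X →L[ℝ] X)) := fun J K h => Subtype.ext (SetLike.coe_injective h)
    refine (Cardinal.mk_le_of_injective hinj).trans ?_
    rw [Cardinal.mk_set]
    exact Cardinal.power_le_power_left two_ne_zero (mk_continuousLinearMap_le_continuum b)
  · have hinj : Function.Injective fun 𝒜 : Set (ℕ → Bool) =>
        (⟨_, isClosedIdeal_idealGen ((fun x => T (branchSet x)) '' 𝒜)⟩ :
          {J : Submodule ℝ (X →L[ℝ] X) // IsClosedIdeal J}) :=
      fun 𝒜 ℬ h => hT.injective_ideal (congrArg Subtype.val h)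
    refine le_trans (le_of_eq ?_) (Cardinal.mk_le_of_injective hinj)
    simp [Cardinal.mk_set]

/-! ### Moving finite dimensional subspaces into the span of disjoint vectors -/

section Disjointification

variable {X : Type*} [NormedAddCommGroup X] [NormedSpace ℝ X]

theorem exists_biorthogonal (m : ℕ) (E : Submodule ℝ X) [FiniteDimensional ℝ E]
    (hE : Module.finrank ℝ E = m) :
    ∃ (x : Fin m → X) (f : Fin m → StrongDual ℝ X), (∀ l, x l ∈ E) ∧ (∀ l, ‖x l‖ ≤ 1) ∧
      (∀ l, ‖f l‖ ≤ 2 ^ m) ∧ ∀ y ∈ E, y = ∑ l, f l y • x l := by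
  induction m generalizing E with
  | zero =>
    refine ⟨0, 0, fun l => l.elim0, fun l => l.elim0, fun l => l.elim0, fun y hy => ?_⟩
    rw [Submodule.finrank_eq_zero.1 hE, Submodule.mem_bot] at hy
    simp [hy]
  | succ m ih =>
    have hnt : Nontrivial E := Module.nontrivial_of_finrank_pos (R := ℝ) (by omega)
    obtain ⟨⟨v, hvE⟩, hv⟩ := exists_ne (0 : E)
    have hv0 : v ≠ 0 := fun h => hv (Subtype.ext h)
    set x₀ := ‖v‖⁻¹ • v with hx₀
    have hx₀E : x₀ ∈ E := E.smul_mem _ hvE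
    have hx₀n : ‖x₀‖ = 1 := by
      rw [hx₀, norm_smul, norm_inv, norm_norm, inv_mul_cancel₀ (norm_ne_zero_iff.2 hv0)]
    have hx₀0 : x₀ ≠ 0 := fun h => by simp [h] at hx₀n
    obtain ⟨f₀, hf₀n, hf₀⟩ := exists_dual_vector ℝ x₀ (norm_ne_zero_iff.2 hx₀0)
    have hf₀1 : f₀ x₀ = 1 := by simpa [hx₀n] using hf₀
    set g : E →ₗ[ℝ] ℝ := f₀.toLinearMap.comp E.subtype with hg
    have hgs : Function.Surjective g := fun r => ⟨r • ⟨x₀, hx₀E⟩, by simp [hg, hf₀1]⟩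
    have hker : Module.finrank ℝ (g.ker.map E.subtype) = m := by
      have h₁ := g.finrank_range_add_finrank_ker
      rw [LinearMap.range_eq_top.2 hgs, finrank_top, Module.finrank_self, hE] at h₁
      rw [Submodule.finrank_map_subtype_eq]
      omega
    obtain ⟨x, f, hxE, hx, hf, hy⟩ := ih (g.ker.map E.subtype) hker
    refine ⟨Fin.cons x₀ x, Fin.cons f₀ fun l => f l - f l x₀ • f₀, ?_, ?_, ?_, ?_⟩
    · refine Fin.cases hx₀E fun l => ?_
      obtain ⟨w, _, hw⟩ := hxE l
      simp only [Fin.cons_succ, ← hw]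
      exact w.2
    · exact Fin.cases hx₀n.le hx
    · refine Fin.cases ?_ fun l => ?_
      · simp only [Fin.cons_zero, hf₀n]
        exact one_le_pow₀ (by norm_num)
      · simp only [Fin.cons_succ]
        refine (norm_sub_le _ _).trans ?_
        rw [norm_smul, hf₀n, mul_one, pow_succ]
        have := (f l).le_opNorm x₀
        rw [hx₀n, mul_one] at this
        have := hf l
        linarith
    · intro y hyE
      have hmem : y - f₀ y • x₀ ∈ g.ker.map E.subtype :=
        ⟨⟨y - f₀ y • x₀, E.sub_mem hyE (E.smul_mem _ hx₀E)⟩, by simp [hg, hf₀1], rfl⟩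
      have := hy _ hmem
      rw [sub_eq_iff_eq_add] at this
      rw [Fin.sum_univ_succ]
      simp only [Fin.cons_zero, Fin.cons_succ]
      refine this.trans ?_
      rw [add_comm]
      congr 1
      refine Finset.sum_congr rfl fun l _ => ?_
      congr 1
      simp
      ring

theorem exists_automorphism [CompleteSpace X] (K : X →L[ℝ] X) (hK : ‖K‖ ≤ 1 / 3) :
    ∃ S : X ≃L[ℝ] X, (∀ x, S x = x + K x) ∧
      ‖(S : X →L[ℝ] X)‖ * ‖(S.symm : X →L[ℝ] X)‖ ≤ 2 := by
  have hlt : ‖-K‖ < 1 := by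
    rw [norm_neg]
    linarith
  set S : X ≃L[ℝ] X := ContinuousLinearEquiv.unitsEquiv ℝ X (Units.oneSub (-K) hlt) with hSdef
  have hS : ∀ x, S x = x + K x := fun x => by
    change (Units.oneSub (-K) hlt : X →L[ℝ] X) x = x + K x
    simp [Units.oneSub]
  refine ⟨S, hS, ?_⟩
  have h₁ : ‖(S : X →L[ℝ] X)‖ ≤ 4 / 3 :=
    ContinuousLinearMap.opNorm_le_bound _ (by norm_num) fun x => by
      rw [ContinuousLinearEquiv.coe_coe, hS]
      have := (K.le_opNorm x).trans (mul_le_mul_of_nonneg_right hK (norm_nonneg x))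
      have := norm_add_le x (K x)
      linarith
  have h₂ : ‖(S.symm : X →L[ℝ] X)‖ ≤ 3 / 2 :=
    ContinuousLinearMap.opNorm_le_bound _ (by norm_num) fun y => by
      rw [ContinuousLinearEquiv.coe_coe]
      set x := S.symm y with hx
      have hy : y = x + K x := by rw [← hS, hx, S.apply_symm_apply]
      have := (K.le_opNorm x).trans (mul_le_mul_of_nonneg_right hK (norm_nonneg x))
      have := norm_sub_le (x + K x) (K x)
      rw [add_sub_cancel_right, ← hy] at this
      linarith
  calc ‖(S : X →L[ℝ] X)‖ * ‖(S.symm : X →L[ℝ] X)‖ ≤ 4 / 3 * (3 / 2) :=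
        mul_le_mul h₁ h₂ (norm_nonneg _) (by norm_num)
    _ = 2 := by norm_num

/-- The mesh of the partition used for `m`-dimensional subspaces. -/
def meshNumber (m : ℕ) : ℕ := 3 * m ^ 2 * 2 ^ m

/-- The number of disjoint vectors used for `m`-dimensional subspaces. -/
def cellNumber (m : ℕ) : ℕ := (2 * meshNumber m + 1) ^ m

theorem exists_quantization {q : ℕ} (hq : 0 < q) {t : ℝ} (ht : |t| ≤ 1) :
    ∃ i : Fin (2 * q + 1), |t - ((i : ℕ) / q - 1)| ≤ 1 / q := by
  have hq' : (0 : ℝ) < q := by exact_mod_cast hq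
  have ht' := abs_le.1 ht
  have h0 : 0 ≤ (t + 1) * q := mul_nonneg (by linarith) hq'.le
  refine ⟨⟨⌊(t + 1) * q⌋₊, ?_⟩, ?_⟩
  · rw [Nat.floor_lt h0]
    push_cast
    nlinarith
  · have h₁ := Nat.floor_le h0
    have h₂ := Nat.lt_floor_add_one ((t + 1) * q)
    have : t - ((⌊(t + 1) * q⌋₊ : ℝ) / q - 1) = ((t + 1) * q - ⌊(t + 1) * q⌋₊) / q := by
      field_simp
      ring
    simp only [this]
    rw [abs_of_nonneg (div_nonneg (by linarith) hq'.le)]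
    gcongr
    linarith

variable {b : UnconditionalSchauderBasis ℕ+ ℝ X}

theorem DisjointlySupported.eq_of_ne {ι : Type*} {x : ι → X} (h : DisjointlySupported b x) {j : ℕ+}
    {i i' : ι} (hi : b.coord j (x i) ≠ 0) (hi' : b.coord j (x i') ≠ 0) : i = i' := by
  by_contra hne
  have h₁ : j ∈ {j | b.coord j (x i) ≠ 0} := hi
  exact Set.disjoint_left.1 (h hne) h₁ hi'

variable [CompleteSpace X]

theorem exists_sum_abs (h1 : IsOneUnconditional b) {m : ℕ} (x : Fin m → X)
    (hx : ∀ l, ‖x l‖ ≤ 1) : ∃ Y : X, ‖Y‖ ≤ m ∧ ∀ j, b.coord j Y = ∑ l, |b.coord j (x l)| := by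
  have hs : ∀ l j, |(SignType.sign (b.coord j (x l)) : ℝ)| ≤ 1 := fun l j => by
    rcases SignType.sign (b.coord j (x l)) with _ | _ | _ <;> simp
  refine ⟨∑ l, diagOp h1 (fun j => (SignType.sign (b.coord j (x l)) : ℝ)) (hs l) (x l), ?_,
    fun j => ?_⟩
  · refine (norm_sum_le_of_le _ fun l _ => (norm_diagOp_apply_le h1 _ (hs l) (x l)).trans
      (mul_le_mul_of_nonneg_left (hx l) zero_le_one)).trans_eq ?_
    simp
  · simp [map_sum, sign_mul_self]

theorem exists_disjoint_approx (h1 : IsOneUnconditional b) {m : ℕ} (hm : 0 < m)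
    (E : Submodule ℝ X) (hE : Module.finrank ℝ E = m) :
    ∃ (K : X →L[ℝ] X) (z : Fin (cellNumber m) → X), ‖K‖ ≤ 1 / 3 ∧ DisjointlySupported b z ∧
      (∀ y ∈ E, y + K y ∈ Submodule.span ℝ (Set.range z)) ∧
      ∀ j, (∀ y ∈ E, b.coord j y = 0) →
        (∀ y, b.coord j (K y) = 0) ∧ ∀ i, b.coord j (z i) = 0 := by
  classical
  have : FiniteDimensional ℝ E := .of_finrank_pos (by omega)
  obtain ⟨x, f, hxE, hx, hf, hfx⟩ := exists_biorthogonal m E hE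
  obtain ⟨Y, hY, hYc⟩ := exists_sum_abs h1 x hx
  set q := meshNumber m with hqdef
  have hq : 0 < q := by
    simp only [hqdef, meshNumber]
    positivity
  have hq' : (0 : ℝ) < q := by exact_mod_cast hq
  have hle : ∀ j l, |b.coord j (x l)| ≤ b.coord j Y := fun j l => by
    rw [hYc]
    exact Finset.single_le_sum (f := fun l => |b.coord j (x l)|) (fun _ _ => abs_nonneg _)
      (Finset.mem_univ l)
  have hY0 : ∀ j, 0 ≤ b.coord j Y := fun j => (abs_nonneg _).trans (hle j ⟨0, hm⟩)
  have hω : ∀ j l, |b.coord j (x l) / b.coord j Y| ≤ 1 := fun j l => by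
    rw [abs_div, abs_of_nonneg (hY0 j)]
    exact div_le_one_of_le₀ (hle j l) (hY0 j)
  choose cell hcell using fun j l => exists_quantization hq (hω j l)
  let val : Fin (2 * q + 1) → ℝ := fun i => (i : ℕ) / q - 1
  have hcard : Fintype.card (Fin m → Fin (2 * q + 1)) = cellNumber m := by
    simp [cellNumber, hqdef]
  let e := Fintype.equivFinOfCardEq hcard
  let z : Fin (cellNumber m) → X := fun i => coordProj h1 {j | cell j = e.symm i} Y
  have hz : ∀ j i, b.coord j (z i) = if cell j = e.symm i then b.coord j Y else 0 := fun j i => by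
    simp [z]
  let x' : Fin m → X := fun l => ∑ i, val (e.symm i l) • z i
  have hx' : ∀ j l, b.coord j (x' l) = val (cell j l) * b.coord j Y := fun j l => by
    simp only [x', map_sum, map_smul, smul_eq_mul, hz, mul_ite, mul_zero]
    rw [← e.sum_comp]
    simp
  have hdiff : ∀ l, ‖x' l - x l‖ ≤ 1 / q * m := fun l => by
    refine le_trans (h1.norm_le_of_coord_le (x := Y) (C := 1 / q) (by positivity) fun j => ?_)
      (mul_le_mul_of_nonneg_left hY (by positivity))
    rw [map_sub, hx', abs_sub_comm]
    have h₁ : b.coord j (x l) = b.coord j (x l) / b.coord j Y * b.coord j Y := by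
      by_cases h0 : b.coord j Y = 0
      · have := hle j l
        rw [h0] at this
        rw [h0, mul_zero, abs_nonpos_iff.1 this]
      · rw [div_mul_cancel₀ _ h0]
    have h₂ : b.coord j (x l) - val (cell j l) * b.coord j Y =
        (b.coord j (x l) / b.coord j Y - val (cell j l)) * b.coord j Y := by
      linear_combination h₁
    rw [h₂, abs_mul]
    exact mul_le_mul_of_nonneg_right (hcell j l) (abs_nonneg _)
  refine ⟨∑ l, (f l).smulRight (x' l - x l), z, ?_, ?_, ?_, ?_⟩
  · have : ‖∑ l, (f l).smulRight (x' l - x l)‖ ≤ ∑ _l : Fin m, 2 ^ m * (1 / (q : ℝ) * m) := by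
      refine norm_sum_le_of_le _ fun l _ => ?_
      rw [ContinuousLinearMap.norm_smulRight_apply]
      exact mul_le_mul (hf l) (hdiff l) (norm_nonneg _) (by positivity)
    refine this.trans (le_of_eq ?_)
    rw [Finset.sum_const, Finset.card_univ, Fintype.card_fin, nsmul_eq_mul]
    have hm' : (m : ℝ) ≠ 0 := by exact_mod_cast hm.ne'
    simp only [hqdef, meshNumber]
    push_cast
    field_simp
  · intro i i' hii
    rw [Set.disjoint_left]
    intro j hj hj'
    have h₁ : b.coord j (z i) ≠ 0 := hj
    have h₂ : b.coord j (z i') ≠ 0 := hj'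
    rw [hz] at h₁ h₂
    have h₃ : cell j = e.symm i := by
      by_contra h
      simp [h] at h₁
    have h₄ : cell j = e.symm i' := by
      by_contra h
      simp [h] at h₂
    exact hii (e.symm.injective (h₃.symm.trans h₄))
  · intro y hy
    have : y + (∑ l, (f l).smulRight (x' l - x l)) y = ∑ l, f l y • x' l := by
      have hK : (∑ l, (f l).smulRight (x' l - x l)) y = ∑ l, f l y • x' l - ∑ l, f l y • x l := by
        simp [sum_apply, smul_sub]
      rw [hK, ← hfx y hy, add_sub_cancel]
    rw [this]
    refine Submodule.sum_mem _ fun l _ => Submodule.smul_mem _ _ ?_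
    exact Submodule.sum_mem _ fun i _ => Submodule.smul_mem _ _ (Submodule.subset_span ⟨i, rfl⟩)
  · intro j hj
    have hxj : ∀ l, b.coord j (x l) = 0 := fun l => hj _ (hxE l)
    have hYj : b.coord j Y = 0 := by simp [hYc, hxj]
    refine ⟨fun y => ?_, fun i => ?_⟩
    · simp [sum_apply, map_sum, hx', hxj, hYj]
    · rw [hz, hYj, ite_self]

theorem isDisjointificationBound {L : ℕ+ → ℕ+} (hL : ∀ m : ℕ+, cellNumber m ≤ L m) :
    IsDisjointificationBound.{u} L := by
  intro m X _ _ _ b h1 E hE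
  obtain ⟨K, z, hK, hz, hspan, -⟩ := exists_disjoint_approx h1 m.pos E hE
  obtain ⟨S, hS, hSn⟩ := exists_automorphism K hK
  refine ⟨fun i => if h : (i : ℕ) < cellNumber m then z ⟨i, h⟩ else 0, S, ?_, hSn, fun y hy => ?_⟩
  · intro i i' hii
    rw [Set.disjoint_left]
    intro j hj hj'
    by_cases h : (i : ℕ) < cellNumber m
    · by_cases h' : (i' : ℕ) < cellNumber m
      · have := hz.eq_of_ne (j := j) (i := ⟨i, h⟩) (i' := ⟨i', h'⟩) (by simpa [h] using hj)
          (by simpa [h'] using hj')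
        exact hii (Fin.ext (Fin.mk.inj this))
      · simp [h'] at hj'
    · simp [h] at hj
  · rw [hS]
    refine Submodule.span_mono ?_ (hspan y hy)
    rintro _ ⟨i, rfl⟩
    exact ⟨⟨i, i.2.trans_le (hL m)⟩, by simp⟩

/-- Properties preserved when zero vectors are replaced by multiples of basis vectors. -/
structure IsFilling (b : UnconditionalSchauderBasis ℕ+ ℝ X) (k : ℕ+) (n : ℕ) {L : ℕ}
    (x : Fin L → X) : Prop where
  disjoint : DisjointlySupported b x
  tail : ∀ i, ∀ j < k, b.coord j (x i) = 0
  unit : ∀ i : Fin L, n ≤ i → ∃ (j : ℕ+) (c : ℝ), x i = c • b j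

omit [CompleteSpace X] in
theorem IsFilling.of_support {k : ℕ+} {n L : ℕ} {x : Fin L → X}
    (hd : ∀ j i i', b.coord j (x i) ≠ 0 → b.coord j (x i') ≠ 0 → i = i')
    (ht : ∀ i, ∀ j < k, b.coord j (x i) = 0)
    (hu : ∀ i : Fin L, n ≤ i → ∃ (j : ℕ+) (c : ℝ), x i = c • b j) : IsFilling b k n x :=
  ⟨fun _ _ hii => Set.disjoint_left.2 fun j hj hj' => hii (hd j _ _ hj hj'), ht, hu⟩

omit [CompleteSpace X] in
theorem IsFilling.eq_of_ne {k : ℕ+} {n L : ℕ} {x : Fin L → X} (h : IsFilling b k n x) {j : ℕ+}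
    {i i' : Fin L} (hi : b.coord j (x i) ≠ 0) (hi' : b.coord j (x i') ≠ 0) : i = i' := by
  exact h.disjoint.eq_of_ne hi hi'

omit [CompleteSpace X] in
theorem IsFilling.step {k : ℕ+} {n L : ℕ} {x : Fin L → X} (h : IsFilling b k n x) {i : Fin L}
    (hi : x i = 0) : ∃ y : Fin L → X, IsFilling b k n y ∧ y i ≠ 0 ∧ (∀ l, x l ≠ 0 → y l ≠ 0) ∧
      ∀ l, x l ∈ Submodule.span ℝ (Set.range y) := by
  classical
  have hbne : ∀ j, b j ≠ 0 := fun j h0 => by simpa [h0] using coord_basis b j j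
  by_cases hA : ∃ i' j, b.coord j (x i') ≠ 0 ∧ x i' ≠ b.coord j (x i') • b j
  · obtain ⟨i', j, hj, hne⟩ := hA
    have hii : i' ≠ i := fun hc => hj (by rw [hc, hi, map_zero])
    have hi'n : (i' : ℕ) < n := by
      by_contra! hn
      obtain ⟨j', c, hc⟩ := h.unit i' hn
      rw [hc, map_smul, coord_basis, smul_eq_mul] at hj hne
      by_cases hjj : j = j'
      · subst hjj
        simp at hne
      · simp [hjj] at hj
    set w := b.coord j (x i') • b j with hw
    have hkj : ¬ j < k := fun hjk => hj (h.tail i' j hjk)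
    have hwc : ∀ l, b.coord l w = if l = j then b.coord j (x i') else 0 := fun l => by
      rw [hw, map_smul, coord_basis, smul_eq_mul, mul_ite, mul_one, mul_zero]
    set y : Fin L → X := Function.update (Function.update x i' (x i' - w)) i w with hy
    have hyi : y i = w := by simp [hy]
    have hyi' : y i' = x i' - w := by simp [hy, hii]
    have hyl : ∀ l, l ≠ i → l ≠ i' → y l = x l := fun l h₁ h₂ => by simp [hy, h₁, h₂]
    have hsupp : ∀ l p, b.coord p (y l) ≠ 0 →
        (p = j ∧ l = i) ∨ (p ≠ j ∧ b.coord p (x l) ≠ 0) := by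
      intro l p hp
      by_cases h₁ : l = i
      · subst h₁
        rw [hyi, hwc] at hp
        by_cases hpj : p = j
        · exact Or.inl ⟨hpj, rfl⟩
        · simp [hpj] at hp
      · by_cases h₂ : l = i'
        · subst h₂
          rw [hyi', map_sub, hwc] at hp
          by_cases hpj : p = j
          · subst hpj
            simp at hp
          · exact Or.inr ⟨hpj, by simpa [hpj] using hp⟩
        · rw [hyl l h₁ h₂] at hp
          refine Or.inr ⟨fun hpj => ?_, hp⟩
          subst hpj
          exact h₂ (h.eq_of_ne hp hj)
    refine ⟨y, IsFilling.of_support (fun p l l' hl hl' => ?_) (fun l p hp => ?_) fun l hl => ?_,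
      ?_, fun l hl => ?_, fun l => ?_⟩
    · rcases hsupp l p hl with ⟨h₁, h₂⟩ | ⟨h₁, h₂⟩ <;> rcases hsupp l' p hl' with ⟨h₃, h₄⟩ | ⟨h₃, h₄⟩
      · rw [h₂, h₄]
      · exact absurd h₁ h₃
      · exact absurd h₃ h₁
      · exact h.eq_of_ne h₂ h₄
    · by_contra hne'
      rcases hsupp l p hne' with ⟨h₁, -⟩ | ⟨-, h₂⟩
      · exact hkj (h₁ ▸ hp)
      · exact h₂ (h.tail l p hp)
    · by_cases h₁ : l = i
      · exact ⟨j, b.coord j (x i'), by rw [h₁, hyi]⟩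
      · rw [hyl l h₁ fun h₂ => by subst h₂; omega]
        exact h.unit l hl
    · rw [hyi, hw]
      exact smul_ne_zero hj (hbne j)
    · by_cases h₁ : l = i
      · exact absurd (h₁ ▸ hi) hl
      · by_cases h₂ : l = i'
        · rw [h₂, hyi']
          exact sub_ne_zero.2 hne
        · rwa [hyl l h₁ h₂]
    · by_cases h₁ : l = i
      · rw [h₁, hi]
        exact Submodule.zero_mem _
      · by_cases h₂ : l = i'
        · have : x l = y i' + y i := by rw [hyi, hyi', h₂, sub_add_cancel]
          rw [this]
          exact Submodule.add_mem _ (Submodule.subset_span ⟨_, rfl⟩) (Submodule.subset_span ⟨_, rfl⟩)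
        · rw [← hyl l h₁ h₂]
          exact Submodule.subset_span ⟨_, rfl⟩
  · push Not at hA
    have hfin : (⋃ l, {j | b.coord j (x l) ≠ 0}).Finite := by
      refine Set.finite_iUnion fun l => Set.Subsingleton.finite fun p hp p' hp' => ?_
      have h₁ : b.coord p (x l) ≠ 0 := hp
      have h₂ : b.coord p' (x l) ≠ 0 := hp'
      rw [hA l p h₁, map_smul, coord_basis] at h₂
      by_contra hne
      simp [Ne.symm hne] at h₂
    obtain ⟨j, hjk, hj⟩ := ((Set.Ici_infinite k).sdiff hfin).nonempty
    have hjk' : k ≤ j := hjk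
    simp only [Set.mem_iUnion, not_exists] at hj
    have hj' : ∀ l, b.coord j (x l) = 0 := fun l => by
      by_contra hne
      exact hj l hne
    set y : Fin L → X := Function.update x i (b j) with hy
    have hyi : y i = b j := by simp [hy]
    have hyl : ∀ l, l ≠ i → y l = x l := fun l h₁ => by simp [hy, h₁]
    have hsupp : ∀ l p, b.coord p (y l) ≠ 0 →
        (p = j ∧ l = i) ∨ (p ≠ j ∧ b.coord p (x l) ≠ 0) := by
      intro l p hp
      by_cases h₁ : l = i
      · subst h₁
        rw [hyi, coord_basis] at hp
        by_cases hpj : p = j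
        · exact Or.inl ⟨hpj, rfl⟩
        · simp [hpj] at hp
      · rw [hyl l h₁] at hp
        exact Or.inr ⟨fun hpj => hp (hpj ▸ hj' l), hp⟩
    refine ⟨y, IsFilling.of_support (fun p l l' hl hl' => ?_) (fun l p hp => ?_) fun l hl => ?_,
      ?_, fun l hl => ?_, fun l => ?_⟩
    · rcases hsupp l p hl with ⟨h₁, h₂⟩ | ⟨h₁, h₂⟩ <;> rcases hsupp l' p hl' with ⟨h₃, h₄⟩ | ⟨h₃, h₄⟩
      · rw [h₂, h₄]
      · exact absurd h₁ h₃
      · exact absurd h₃ h₁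
      · exact h.eq_of_ne h₂ h₄
    · by_contra hne'
      rcases hsupp l p hne' with ⟨h₁, -⟩ | ⟨-, h₂⟩
      · exact absurd hjk' (not_le.2 (h₁ ▸ hp))
      · exact h₂ (h.tail l p hp)
    · by_cases h₁ : l = i
      · exact ⟨j, 1, by rw [h₁, hyi, one_smul]⟩
      · rw [hyl l h₁]
        exact h.unit l hl
    · rw [hyi]
      exact hbne j
    · rw [hyl l fun h₁ => hl (h₁ ▸ hi)]
      exact hl
    · by_cases h₁ : l = i
      · rw [h₁, hi]
        exact Submodule.zero_mem _
      · rw [← hyl l h₁]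
        exact Submodule.subset_span ⟨_, rfl⟩

omit [CompleteSpace X] in
theorem IsFilling.exists_ne_zero {k : ℕ+} {n L : ℕ} {x : Fin L → X} (h : IsFilling b k n x) :
    ∃ y : Fin L → X, IsFilling b k n y ∧ (∀ l, y l ≠ 0) ∧
      ∀ l, x l ∈ Submodule.span ℝ (Set.range y) := by
  classical
  induction hN : (Finset.univ.filter fun l => x l = 0).card using Nat.strong_induction_on
    generalizing x with
  | _ N ih =>
    by_cases hx : ∀ l, x l ≠ 0
    · exact ⟨x, h, hx, fun l => Submodule.subset_span ⟨l, rfl⟩⟩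
    · push Not at hx
      obtain ⟨i, hi⟩ := hx
      obtain ⟨y, hy, hyi, hyl, hspan⟩ := h.step hi
      obtain ⟨w, hw, hw0, hws⟩ := ih _ (by
        rw [← hN]
        refine Finset.card_lt_card (Finset.ssubset_iff_of_subset (fun l hl => ?_) |>.2
          ⟨i, by simp [hi], by simp [hyi]⟩)
        simp only [Finset.mem_filter, Finset.mem_univ, true_and] at hl ⊢
        by_contra hne
        exact hyl l hne hl) hy rfl
      refine ⟨w, hw, hw0, fun l => ?_⟩
      refine (Submodule.span_le.2 ?_) (hspan l)
      rintro _ ⟨l', rfl⟩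
      exact hws l'

end Disjointification

/-! ### Regular families and decompositions into successive blocks -/

section Blocks

/-- `G` is obtained from a subset of `F` by moving its elements to the right. -/
def IsSpread (G F : Finset ℕ+) : Prop :=
  ∃ π : ℕ+ → ℕ+, (∀ g ∈ G, π g ∈ F ∧ π g ≤ g) ∧ StrictMonoOn π (G : Set ℕ+)

/-- The family is hereditary and spreading. -/
def Regular (𝓕 : Set (Finset ℕ+)) : Prop := ∀ F ∈ 𝓕, ∀ G, IsSpread G F → G ∈ 𝓕

/-- `Q` is the union of `R` successive members of `𝓕`, indexed by the values of `c`. -/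
def Blocks (𝓕 : Set (Finset ℕ+)) (R : ℕ) (Q : Finset ℕ+) : Prop :=
  ∃ c : ℕ+ → ℕ, Monotone c ∧ (∀ q ∈ Q, c q < R) ∧ ∀ i, Q.filter (c · = i) ∈ 𝓕

variable {𝓕 : Set (Finset ℕ+)}

theorem IsSpread.of_subset {G F : Finset ℕ+} (h : G ⊆ F) : IsSpread G F :=
  ⟨id, fun _ hg => ⟨h hg, le_rfl⟩, strictMono_id.strictMonoOn _⟩

theorem Regular.subset (h𝓕 : Regular 𝓕) {F G : Finset ℕ+} (hF : F ∈ 𝓕) (h : G ⊆ F) : G ∈ 𝓕 :=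
  h𝓕 F hF G (.of_subset h)

theorem Regular.empty (h𝓕 : Regular 𝓕) {F : Finset ℕ+} (hF : F ∈ 𝓕) : ∅ ∈ 𝓕 :=
  h𝓕.subset hF (Finset.empty_subset F)

theorem exists_monotone_extension {c : ℕ+ → ℕ} {Q : Finset ℕ+} (hc : MonotoneOn c (Q : Set ℕ+)) :
    ∃ c' : ℕ+ → ℕ, Monotone c' ∧ ∀ q ∈ Q, c' q = c q := by
  obtain ⟨g, hg, hgc⟩ := hc.exists_monotone_extension
    ((Q.finite_toSet.image c).bddBelow) ((Q.finite_toSet.image c).bddAbove)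
  exact ⟨g, hg, fun q hq => (hgc hq).symm⟩

theorem Blocks.of_monotoneOn {R : ℕ} {Q : Finset ℕ+} (c : ℕ+ → ℕ)
    (hc : MonotoneOn c (Q : Set ℕ+)) (hR : ∀ q ∈ Q, c q < R)
    (hF : ∀ i, Q.filter (c · = i) ∈ 𝓕) : Blocks 𝓕 R Q := by
  obtain ⟨c', hc', h⟩ := exists_monotone_extension hc
  refine ⟨c', hc', fun q hq => (h q hq).trans_lt (hR q hq), fun i => ?_⟩
  rw [Finset.filter_congr fun q hq => by rw [h q hq]]
  exact hF i

theorem Blocks.mono {R R' : ℕ} {Q : Finset ℕ+} (h : Blocks 𝓕 R Q) (hR : R ≤ R') :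
    Blocks 𝓕 R' Q := by
  obtain ⟨c, hc, hcR, hcF⟩ := h
  exact ⟨c, hc, fun q hq => (hcR q hq).trans_le hR, hcF⟩

theorem Blocks.spread (h𝓕 : Regular 𝓕) {R : ℕ} {Q G : Finset ℕ+} (h : Blocks 𝓕 R Q)
    (hG : IsSpread G Q) : Blocks 𝓕 R G := by
  obtain ⟨c, hc, hcR, hcF⟩ := h
  obtain ⟨π, hπ, hmono⟩ := hG
  refine Blocks.of_monotoneOn (fun q => c (π q))
    (fun q hq q' hq' h => hc (hmono.monotoneOn hq hq' h)) (fun q hq => hcR _ (hπ q hq).1)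
    fun i => h𝓕 _ (hcF i) _ ⟨π, fun g hg => ?_, hmono.mono fun g hg => ?_⟩
  · rw [Finset.mem_filter] at hg
    exact ⟨Finset.mem_filter.2 ⟨(hπ g hg.1).1, hg.2⟩, (hπ g hg.1).2⟩
  · exact (Finset.mem_filter.1 (Finset.mem_coe.1 hg)).1

theorem Blocks.subset (h𝓕 : Regular 𝓕) {R : ℕ} {Q G : Finset ℕ+} (h : Blocks 𝓕 R Q)
    (hG : G ⊆ Q) : Blocks 𝓕 R G := h.spread h𝓕 (.of_subset hG)

theorem Blocks.of_mem (h𝓕 : Regular 𝓕) {Q : Finset ℕ+} (h : Q ∈ 𝓕) : Blocks 𝓕 1 Q :=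
  ⟨fun _ => 0, monotone_const, fun _ _ => one_pos, fun _ => h𝓕.subset h (Finset.filter_subset _ _)⟩

theorem Blocks.of_card_le {R : ℕ} {Q : Finset ℕ+} (h0 : ∅ ∈ 𝓕) (h1 : ∀ q, {q} ∈ 𝓕)
    (hR : Q.card ≤ R) : Blocks 𝓕 R Q := by
  refine ⟨fun q => (Q.filter (· < q)).card, fun q q' h => ?_, fun q hq => ?_, fun i => ?_⟩
  · exact Finset.card_le_card fun x hx => by
      rw [Finset.mem_filter] at hx ⊢
      exact ⟨hx.1, hx.2.trans_le h⟩
  · refine (Finset.card_lt_card (Finset.ssubset_iff_of_subset (Finset.filter_subset _ _) |>.2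
      ⟨q, hq, by simp⟩)).trans_le hR
  · rcases Finset.eq_empty_or_nonempty (Q.filter fun q => (Q.filter (· < q)).card = i)
      with he | ⟨q, hq⟩
    · rw [he]
      exact h0
    · convert h1 q
      refine Finset.eq_singleton_iff_unique_mem.2 ⟨hq, fun q' hq' => ?_⟩
      rw [Finset.mem_filter] at hq hq'
      beta_reduce at hq hq'
      have key : ∀ x ∈ Q, ∀ y, x < y → (Q.filter (· < x)).card < (Q.filter (· < y)).card := by
        intro x hx y hxy
        refine Finset.card_lt_card (Finset.ssubset_iff_of_subset (fun z hz => ?_) |>.2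
          ⟨x, by simp [hx, hxy], by simp⟩)
        rw [Finset.mem_filter] at hz ⊢
        exact ⟨hz.1, hz.2.trans hxy⟩
      rcases lt_trichotomy q q' with h | h | h
      · exact absurd (key q hq.1 q' h) (by omega)
      · exact h.symm
      · exact absurd (key q' hq'.1 q h) (by omega)

theorem Blocks.comp {R R' : ℕ} {Q : Finset ℕ+} {c : ℕ+ → ℕ} (hc : Monotone c)
    (hR : ∀ q ∈ Q, c q < R) (h : ∀ i, Blocks 𝓕 R' (Q.filter (c · = i))) :
    Blocks 𝓕 (R * R') Q := by
  choose d hd hdR hdF using h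
  have hdQ : ∀ q ∈ Q, d (c q) q < R' := fun q hq =>
    hdR _ q (Finset.mem_filter.2 ⟨hq, rfl⟩)
  have hlex : ∀ q ∈ Q, ∀ q' ∈ Q, R' * c q + d (c q) q = R' * c q' + d (c q') q' → c q = c q' := by
    intro q hq q' hq' heq
    have h₁ := congrArg (· / R') heq
    have hpos : 0 < R' := (Nat.zero_le _).trans_lt (hdQ q hq)
    simpa [Nat.mul_add_div hpos, Nat.div_eq_of_lt (hdQ q hq), Nat.div_eq_of_lt (hdQ q' hq')] using h₁
  refine Blocks.of_monotoneOn (fun q => R' * c q + d (c q) q) (fun q hq q' hq' hle => ?_)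
    (fun q hq => ?_) fun i => ?_
  · rcases (hc hle).eq_or_lt with h | h
    · simp only [h]
      exact Nat.add_le_add_left (hd _ hle) _
    · have := hdQ q hq
      calc R' * c q + d (c q) q ≤ R' * c q + R' := by omega
        _ = R' * (c q + 1) := by ring
        _ ≤ R' * c q' := Nat.mul_le_mul_left _ h
        _ ≤ _ := Nat.le_add_right _ _
  · have h₁ := hdQ q hq
    have h₂ := hR q hq
    calc R' * c q + d (c q) q < R' * (c q + 1) := by rw [mul_add_one]; omega
      _ ≤ R' * R := Nat.mul_le_mul_left _ h₂
      _ = R * R' := mul_comm _ _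
  · rcases Finset.eq_empty_or_nonempty (Q.filter fun q => R' * c q + d (c q) q = i)
      with he | ⟨q, hq⟩
    · rw [he]
      have := hdF (Q.sup c + 1) 0
      convert this
      refine (Finset.filter_eq_empty_iff.2 fun q hq => ?_).symm
      rw [Finset.mem_filter] at hq
      have := Finset.le_sup (f := c) hq.1
      omega
    · rw [Finset.mem_filter] at hq
      convert hdF (c q) (d (c q) q) using 1
      ext q'
      simp only [Finset.mem_filter]
      constructor
      · rintro ⟨h₁, h₂⟩
        have h₃ := hlex q' h₁ q hq.1 (h₂.trans hq.2.symm)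
        refine ⟨⟨h₁, h₃⟩, ?_⟩
        have := h₂.trans hq.2.symm
        rw [h₃] at this
        omega
      · rintro ⟨⟨h₁, h₂⟩, h₃⟩
        refine ⟨h₁, ?_⟩
        rw [h₂, h₃]
        exact hq.2

theorem card_filter_le_add {Q : Finset ℕ+} {q₀ q : ℕ+} (hQ : ∀ k ∈ Q, q₀ ≤ k) (hq : q ∈ Q) :
    q₀ + (Q.filter (· ≤ q)).card ≤ (q : ℕ) + 1 := by
  have hsub : Q.filter (· ≤ q) ⊆ Finset.Icc q₀ q := fun k hk => by
    rw [Finset.mem_filter] at hk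
    exact Finset.mem_Icc.2 ⟨hQ k hk.1, hk.2⟩
  have h₁ := Finset.card_le_card hsub
  rw [PNat.card_Icc] at h₁
  have h₂ : (q₀ : ℕ) ≤ q := hQ q hq
  omega

theorem Blocks.compress (h𝓕 : Regular 𝓕) {R : ℕ} {Q : Finset ℕ+} (h : Blocks 𝓕 R Q) {q₀ : ℕ+}
    (hQ : ∀ k ∈ Q, q₀ ≤ k) : ∃ c : ℕ+ → ℕ, Monotone c ∧ (∀ q ∈ Q, c q < R) ∧
      (∀ i, Q.filter (c · = i) ∈ 𝓕) ∧ ∀ q ∈ Q, q₀ + c q ≤ (q : ℕ) := by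
  obtain ⟨c, hc, hcR, hcF⟩ := h
  set I : ℕ+ → Finset ℕ := fun q => (Q.filter (· ≤ q)).image c with hI
  have hImono : Monotone I := fun q q' h => Finset.image_subset_image fun x hx => by
    rw [Finset.mem_filter] at hx ⊢
    exact ⟨hx.1, hx.2.trans h⟩
  have hIq : ∀ q ∈ Q, c q ∈ I q := fun q hq =>
    Finset.mem_image_of_mem c (Finset.mem_filter.2 ⟨hq, le_rfl⟩)
  have hIpos : ∀ q ∈ Q, 0 < (I q).card := fun q hq => Finset.card_pos.2 ⟨_, hIq q hq⟩
  have hle : ∀ q ∈ Q, ∀ q' ∈ Q, q ≤ q' → (I q).card - 1 = (I q').card - 1 → c q = c q' := by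
    intro q hq q' hq' hqq hcard
    have h₁ := hIpos q hq
    have h₂ := hIpos q' hq'
    have heq : I q = I q' := Finset.eq_of_subset_of_card_le (hImono hqq) (by omega)
    have hmem : c q' ∈ I q := heq ▸ hIq q' hq'
    obtain ⟨x, hx, hxc⟩ := Finset.mem_image.1 hmem
    exact le_antisymm (hc hqq) (hxc ▸ hc (Finset.mem_filter.1 hx).2)
  refine ⟨fun q => (I q).card - 1, fun q q' h => Nat.sub_le_sub_right
    (Finset.card_le_card (hImono h)) 1, fun q hq => ?_, fun i => ?_, fun q hq => ?_⟩
  · have h₁ := hIpos q hq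
    have h₂ : (I q).card ≤ R := by
      have : I q ⊆ Finset.range R := fun x hx => by
        obtain ⟨y, hy, rfl⟩ := Finset.mem_image.1 hx
        exact Finset.mem_range.2 (hcR y (Finset.mem_filter.1 hy).1)
      simpa using Finset.card_le_card this
    beta_reduce
    omega
  · rcases Finset.eq_empty_or_nonempty (Q.filter fun q => (I q).card - 1 = i) with he | ⟨q, hq⟩
    · rw [he]
      exact h𝓕.empty (hcF 0)
    · rw [Finset.mem_filter] at hq
      refine h𝓕.subset (hcF (c q)) fun q' hq' => ?_
      rw [Finset.mem_filter] at hq' ⊢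
      refine ⟨hq'.1, ?_⟩
      rcases le_total q q' with h | h
      · exact (hle q hq.1 q' hq'.1 h (hq.2.trans hq'.2.symm)).symm
      · exact hle q' hq'.1 q hq.1 h (hq'.2.trans hq.2.symm)
  · have h₁ := card_filter_le_add hQ hq
    have h₂ : (I q).card ≤ (Q.filter (· ≤ q)).card := Finset.card_image_le
    have h₃ := hIpos q hq
    beta_reduce
    omega

/-- Many successive members of `𝓕` can be grouped into few groups, each consisting of few members
compared to its minimum, since the minima of the blocks grow. -/
theorem Blocks.group (h𝓕 : Regular 𝓕) {R M w : ℕ} {Q : Finset ℕ+} {q₀ : ℕ+} (h : Blocks 𝓕 R Q)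
    (hQ : ∀ k ∈ Q, q₀ ≤ k) (hM : 0 < M) (hMq : M ≤ q₀) (hR : R ≤ (2 ^ w - 1) * q₀) :
    Blocks {G | ∃ p, (∀ k ∈ G, M * p ≤ (k : ℕ)) ∧ Blocks 𝓕 p G} (2 * M * w) Q := by
  obtain ⟨c, hc, hcR, hcF, hcq⟩ := h.compress h𝓕 hQ
  have hq₀ : 0 < (q₀ : ℕ) := q₀.pos
  set J : ℕ → ℕ := fun i => Nat.log 2 (i / q₀ + 1) with hJ
  set s : ℕ → ℕ := fun i => 2 ^ J i * q₀ / M with hs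
  set o : ℕ → ℕ := fun i => (2 ^ J i - 1) * q₀ with ho
  have hJmono : Monotone J := fun i i' hi =>
    Nat.log_mono_right (Nat.add_le_add_right (Nat.div_le_div_right hi) 1)
  have hlow : ∀ i, o i ≤ i := fun i => by
    have h₁ : 2 ^ J i ≤ i / q₀ + 1 := Nat.pow_log_le_self 2 (Nat.succ_ne_zero _)
    calc o i ≤ (i / q₀) * q₀ := Nat.mul_le_mul_right _ (Nat.sub_le_iff_le_add.2 h₁)
      _ ≤ i := Nat.div_mul_le_self i q₀
  have hlow' : ∀ i, 2 ^ J i * q₀ ≤ q₀ + i := fun i => by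
    have h₁ := hlow i
    have h₂ : 1 ≤ 2 ^ J i := Nat.one_le_two_pow
    calc 2 ^ J i * (q₀ : ℕ) = (2 ^ J i - 1 + 1) * q₀ := by rw [Nat.sub_add_cancel h₂]
      _ = o i + q₀ := by rw [add_mul, one_mul]
      _ ≤ _ := by omega
  have hup : ∀ i, i - o i < 2 ^ J i * q₀ := fun i => by
    have h₁ : i / q₀ + 1 < 2 ^ (J i + 1) := Nat.lt_pow_succ_log_self (by norm_num) _
    have h₂ : i < (i / q₀ + 1) * q₀ := by
      have := Nat.lt_div_mul_add (a := i) hq₀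
      rw [add_mul, one_mul]
      exact this
    have h₃ : (i / q₀ + 1) * (q₀ : ℕ) ≤ (2 ^ (J i + 1) - 1) * q₀ :=
      Nat.mul_le_mul_right _ (Nat.le_sub_one_of_lt h₁)
    have h₄ : (2 ^ (J i + 1) - 1) * (q₀ : ℕ) = o i + 2 ^ J i * q₀ := by
      rw [ho, ← add_mul]
      congr 1
      have : 1 ≤ 2 ^ J i := Nat.one_le_two_pow
      rw [pow_succ]
      omega
    have h₅ := h₂.trans_le (h₃.trans_eq h₄)
    have h₆ := hlow i
    omega
  have hspos : ∀ i, 0 < s i := fun i => Nat.div_pos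
    (hMq.trans (Nat.le_mul_of_pos_left _ (by positivity))) hM
  have hs2 : ∀ i, 2 ^ J i * q₀ ≤ 2 * M * s i := fun i => by
    have h₁ := Nat.lt_div_mul_add (a := 2 ^ J i * q₀) hM
    have h₂ := hspos i
    have h₃ : M ≤ s i * M := Nat.le_mul_of_pos_left _ h₂
    have h₄ : 2 ^ J i * q₀ / M * M = s i * M := rfl
    nlinarith
  have hrem : ∀ i, (i - o i) / s i < 2 * M := fun i => by
    rw [Nat.div_lt_iff_lt_mul (hspos i)]
    exact (hup i).trans_le (hs2 i)
  set g : ℕ → ℕ := fun i => 2 * M * J i + (i - o i) / s i with hg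
  have hgdiv : ∀ i, g i / (2 * M) = J i := fun i => by
    rw [hg]
    simp only
    rw [Nat.mul_add_div (by omega), Nat.div_eq_of_lt (hrem i), add_zero]
  have hgmono : Monotone g := fun i i' hi => by
    rcases (hJmono hi).eq_or_lt with h | h
    · have ho' : o i = o i' := by simp only [ho, h]
      have hs' : s i = s i' := by simp only [hs, h]
      simp only [hg, h, ho', hs']
      gcongr
    · have h₁ := hrem i
      calc g i ≤ 2 * M * (J i + 1) := by
            rw [mul_add, mul_one]
            simp only [hg]
            omega
        _ ≤ 2 * M * J i' := Nat.mul_le_mul_left _ h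
        _ ≤ g i' := Nat.le_add_right _ _
  refine ⟨fun q => g (c q), hgmono.comp hc, fun q hq => ?_, fun v => ?_⟩
  · have h₁ := hcR q hq
    have h₂ : J (c q) < w := by
      by_contra! hw
      have h₃ : (2 ^ w - 1) * (q₀ : ℕ) ≤ o (c q) := Nat.mul_le_mul_right _
        (Nat.sub_le_sub_right (Nat.pow_le_pow_right (by norm_num) hw) 1)
      have := hlow (c q)
      omega
    have h₄ := hrem (c q)
    calc g (c q) < 2 * M * J (c q) + 2 * M := by
          simp only [hg]
          omega
      _ = 2 * M * (J (c q) + 1) := by ring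
      _ ≤ 2 * M * w := Nat.mul_le_mul_left _ h₂
  · rcases Finset.eq_empty_or_nonempty (Q.filter fun q => g (c q) = v) with he | ⟨q₁, hq₁⟩
    · rw [he]
      exact ⟨0, by simp, fun _ => 0, monotone_const, by simp, fun i => by
        rw [Finset.filter_empty]
        exact h𝓕.empty (hcF 0)⟩
    · rw [Finset.mem_filter] at hq₁
      have hsame : ∀ q ∈ Q, g (c q) = v → J (c q) = J (c q₁) ∧
          (c q - o (c q₁)) / s (c q₁) = (c q₁ - o (c q₁)) / s (c q₁) ∧ o (c q₁) ≤ c q := by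
        intro q hq hv
        have h₁ : J (c q) = J (c q₁) := by rw [← hgdiv, ← hgdiv, hv, hq₁.2]
        have ho' : o (c q) = o (c q₁) := by simp only [ho, h₁]
        have hs' : s (c q) = s (c q₁) := by simp only [hs, h₁]
        refine ⟨h₁, ?_, ho' ▸ hlow (c q)⟩
        have h₂ : g (c q) = g (c q₁) := hv.trans hq₁.2.symm
        simp only [hg, h₁, ho', hs'] at h₂
        omega
      set b₀ := o (c q₁) + s (c q₁) * ((c q₁ - o (c q₁)) / s (c q₁)) with hb₀
      have hrange : ∀ q ∈ Q, g (c q) = v → b₀ ≤ c q ∧ c q < b₀ + s (c q₁) := by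
        intro q hq hv
        obtain ⟨-, h₂, h₃⟩ := hsame q hq hv
        have h₄ := Nat.div_add_mod (c q - o (c q₁)) (s (c q₁))
        have h₅ := Nat.mod_lt (c q - o (c q₁)) (hspos (c q₁))
        rw [h₂] at h₄
        omega
      refine ⟨s (c q₁), fun k hk => ?_, Blocks.of_monotoneOn (fun q => c q - b₀) ?_ ?_ ?_⟩
      · rw [Finset.mem_filter] at hk
        obtain ⟨h₁, -, -⟩ := hsame k hk.1 hk.2
        calc M * s (c q₁) ≤ 2 ^ J (c q₁) * q₀ := Nat.mul_div_le _ _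
          _ ≤ q₀ + c k := h₁ ▸ hlow' (c k)
          _ ≤ k := hcq k hk.1
      · exact fun q _ q' _ h => Nat.sub_le_sub_right (hc h) _
      · intro q hq
        rw [Finset.mem_filter] at hq
        have := hrange q hq.1 hq.2
        omega
      · intro i
        refine h𝓕.subset (hcF (i + b₀)) fun q hq => ?_
        rw [Finset.mem_filter, Finset.mem_filter] at hq
        rw [Finset.mem_filter]
        have := hrange q hq.1.1 hq.1.2
        exact ⟨hq.1.1, by omega⟩

end Blocks

/-! ### Schreier families -/

section Schreier

variable {α : Ordinal.{0} → ℕ+ → Ordinal.{0}}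

theorem mem_schreierFamily_zero_iff {F : Finset ℕ+} : F ∈ schreierFamily α 0 ↔ F.card ≤ 1 := by
  constructor
  · intro h
    have : ∀ γ, Schreier α γ F → γ = 0 → F.card ≤ 1 := by
      intro γ h hγ
      cases h with
      | zero_empty => simp
      | zero_singleton n => simp
      | succ => exact absurd hγ (Order.succ_ne_bot _)
      | limit hξ => exact absurd hγ hξ.ne_bot
    exact this 0 h rfl
  · intro h
    rcases Finset.card_le_one_iff_subset_singleton.1 h with ⟨x, hx⟩
    rcases Finset.subset_singleton_iff.1 hx with rfl | rfl
    · exact .zero_empty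
    · exact .zero_singleton x

theorem mem_schreierFamily_succ_of_blocks {γ : Ordinal.{0}} {F : Finset ℕ+} {p : ℕ}
    (hp : ∀ k ∈ F, p ≤ (k : ℕ)) (h : Blocks (schreierFamily α γ) p F) :
    F ∈ schreierFamily α (γ + 1) := by
  obtain ⟨c, hc, hcp, hcF⟩ := h
  refine Schreier.succ (n := p) (fun i => F.filter (c · = i)) (fun i k hk => ?_)
    (fun i j hij a ha a' ha' => ?_) (fun i => hcF i) ?_
  · exact hp k (Finset.mem_filter.1 hk).1
  · rw [Finset.mem_filter] at ha ha'
    by_contra! hle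
    have := hc hle
    rw [ha.2, ha'.2] at this
    exact absurd hij (not_lt.2 this)
  · ext q
    simp only [Finset.mem_biUnion, Finset.mem_univ, true_and, Finset.mem_filter]
    exact ⟨fun hq => ⟨⟨c q, hcp q hq⟩, hq, rfl⟩, fun ⟨_, hq, _⟩ => hq⟩

theorem exists_blocks_of_successive {𝓕 : Set (Finset ℕ+)} (h0 : ∅ ∈ 𝓕) {n : ℕ} {F : Finset ℕ+}
    (E : Fin n → Finset ℕ+) (hlt : ∀ i j, i < j → ∀ a ∈ E i, ∀ b ∈ E j, a < b)
    (hE : ∀ i, E i ∈ 𝓕) (hF : F = Finset.univ.biUnion E) : Blocks 𝓕 n F := by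
  classical
  have hmem : ∀ q ∈ F, ∃ i, q ∈ E i := fun q hq => by simpa [hF] using hq
  choose idx hidx using hmem
  have hEF : ∀ i, ∀ q ∈ E i, q ∈ F := fun i q hq => by
    rw [hF]
    exact Finset.mem_biUnion.2 ⟨i, Finset.mem_univ _, hq⟩
  have huniq : ∀ i, ∀ q ∈ E i, ∀ j, q ∈ E j → i = j := fun i q hi j hj => by
    by_contra hne
    rcases lt_or_gt_of_ne hne with h | h
    · exact lt_irrefl q (hlt i j h q hi q hj)
    · exact lt_irrefl q (hlt j i h q hj q hi)
  refine Blocks.of_monotoneOn (fun q => if h : q ∈ F then (idx q h : ℕ) else 0)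
    (fun q hq q' hq' h => ?_) (fun q hq => ?_) fun i => ?_
  · rw [Finset.mem_coe] at hq hq'
    simp only [hq, hq', dif_pos]
    by_contra! hlt'
    exact absurd h (not_le.2 (hlt _ _ (Fin.lt_def.2 hlt') q' (hidx q' hq') q (hidx q hq)))
  · simp [hq]
  · by_cases hi : i < n
    · convert hE ⟨i, hi⟩
      ext q
      rw [Finset.mem_filter]
      constructor
      · rintro ⟨hq, h⟩
        simp only [hq, dif_pos] at h
        have : idx q hq = ⟨i, hi⟩ := Fin.ext h
        exact this ▸ hidx q hq
      · intro hq
        have hqF := hEF _ q hq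
        refine ⟨hqF, ?_⟩
        simp only [hqF, dif_pos]
        exact congrArg Fin.val (huniq _ q (hidx q hqF) _ hq)
    · convert h0
      refine Finset.filter_eq_empty_iff.2 fun q hq => ?_
      simp only [hq, dif_pos]
      have := (idx q hq).2
      omega

theorem IsSpread.card_le {G F : Finset ℕ+} (h : IsSpread G F) : G.card ≤ F.card := by
  obtain ⟨π, hπ, hmono⟩ := h
  exact Finset.card_le_card_of_injOn π (fun g hg => (hπ g hg).1) hmono.injOn

theorem regular_schreierFamily (γ : Ordinal.{0}) : Regular (schreierFamily α γ) := by
  intro F hF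
  induction hF with
  | zero_empty =>
    intro G hG
    exact mem_schreierFamily_zero_iff.2 ((IsSpread.card_le hG).trans (by simp))
  | zero_singleton n =>
    intro G hG
    exact mem_schreierFamily_zero_iff.2 ((IsSpread.card_le hG).trans (by simp))
  | @succ γ n F E hn hlt hE hF ih =>
    rintro G ⟨π, hπ, hmono⟩
    have hF' : ∀ q, q ∈ F ↔ ∃ i, q ∈ E i := fun q => by simp [hF]
    refine Schreier.succ (n := n) (fun i => G.filter fun g => π g ∈ E i) (fun i k hk => ?_)
      (fun i j hij a ha a' ha' => ?_) (fun i => ih i _ ⟨π, fun g hg => ?_, hmono.mono ?_⟩) ?_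
    · rw [Finset.mem_filter] at hk
      exact (hn i _ hk.2).trans (hπ k hk.1).2
    · rw [Finset.mem_filter] at ha ha'
      exact (hmono.lt_iff_lt ha.1 ha'.1).1 (hlt i j hij _ ha.2 _ ha'.2)
    · rw [Finset.mem_filter] at hg
      exact ⟨hg.2, (hπ g hg.1).2⟩
    · exact Finset.coe_subset.2 (Finset.filter_subset _ _)
    · ext g
      simp only [Finset.mem_biUnion, Finset.mem_univ, true_and, Finset.mem_filter]
      refine ⟨fun hg => ?_, fun ⟨_, hg, _⟩ => hg⟩
      obtain ⟨i, hi⟩ := (hF' _).1 (hπ g hg).1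
      exact ⟨i, hg, hi⟩
  | limit hξ n hn hE ih =>
    intro G hG
    have hG' := hG
    obtain ⟨π, hπ, hmono⟩ := hG
    exact Schreier.limit hξ n (fun k hk => (hn _ (hπ k hk).1).trans (hπ k hk).2) (ih G hG')

theorem lt_omega_one_of_succ {γ : Ordinal.{0}} (h : γ + 1 < Ordinal.omega 1) :
    γ < Ordinal.omega 1 := (Order.lt_succ γ).trans h

theorem singleton_mem_schreierFamily (hα : IsApproximating α) {γ : Ordinal.{0}}
    (hγ : γ < Ordinal.omega 1) (n : ℕ+) : {n} ∈ schreierFamily α γ := by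
  induction γ using WellFoundedLT.induction with
  | _ γ ih =>
    rcases Ordinal.zero_or_succ_or_isSuccLimit γ with rfl | ⟨β, rfl⟩ | hlim
    · exact .zero_singleton n
    · exact mem_schreierFamily_succ_of_blocks (p := 1) (fun k _ => k.pos)
        (Blocks.of_mem (regular_schreierFamily β)
          (ih β (Order.lt_succ β) (lt_omega_one_of_succ hγ)))
    · exact Schreier.limit hlim 1 (fun k _ => one_le)
        (ih _ (hα.lt γ hγ hlim 1) ((hα.lt γ hγ hlim 1).trans hγ))

theorem empty_mem_schreierFamily (hα : IsApproximating α) {γ : Ordinal.{0}}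
    (hγ : γ < Ordinal.omega 1) : ∅ ∈ schreierFamily α γ :=
  (regular_schreierFamily γ).empty (singleton_mem_schreierFamily hα hγ 1)

theorem exists_blocks_of_mem_schreierFamily_succ (hα : IsApproximating α) {γ : Ordinal.{0}}
    (hγ : γ < Ordinal.omega 1) {F : Finset ℕ+} (hF : F ∈ schreierFamily α (γ + 1)) :
    ∃ p : ℕ, (∀ k ∈ F, p ≤ (k : ℕ)) ∧ Blocks (schreierFamily α γ) p F := by
  have : ∀ ξ, Schreier α ξ F → ξ = γ + 1 →
      ∃ p : ℕ, (∀ k ∈ F, p ≤ (k : ℕ)) ∧ Blocks (schreierFamily α γ) p F := by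
    intro ξ h hξ
    cases h with
    | zero_empty => exact absurd hξ.symm (Order.succ_ne_bot _)
    | zero_singleton n => exact absurd hξ.symm (Order.succ_ne_bot _)
    | @succ γ' n _ E hn hlt hE hFE =>
      obtain rfl : γ' = γ := Order.succ_injective hξ
      refine ⟨n, fun k hk => ?_,
        exists_blocks_of_successive (empty_mem_schreierFamily hα hγ) E hlt hE hFE⟩
      rw [hFE] at hk
      obtain ⟨i, -, hi⟩ := Finset.mem_biUnion.1 hk
      exact hn i k hi
    | limit hlim =>
      rw [hξ] at hlim
      exact absurd hlim (Order.not_isSuccLimit_succ γ)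
  exact this _ hF rfl

theorem exists_mem_of_mem_schreierFamily_limit {ξ : Ordinal.{0}} (hlim : Order.IsSuccLimit ξ)
    {F : Finset ℕ+} (hF : F ∈ schreierFamily α ξ) :
    ∃ n : ℕ+, (∀ k ∈ F, n ≤ k) ∧ F ∈ schreierFamily α (α ξ n) := by
  have : ∀ ξ', Schreier α ξ' F → ξ' = ξ →
      ∃ n : ℕ+, (∀ k ∈ F, n ≤ k) ∧ F ∈ schreierFamily α (α ξ n) := by
    intro ξ' h hξ
    cases h with
    | zero_empty => exact absurd hξ.symm hlim.ne_bot
    | zero_singleton n => exact absurd hξ.symm hlim.ne_bot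
    | @succ γ =>
      rw [← hξ] at hlim
      exact absurd hlim (Order.not_isSuccLimit_succ γ)
    | limit _ n hn hE => exact ⟨n, hn, hξ ▸ hE⟩
  exact this _ hF rfl

theorem mem_schreierFamily_one_of_card_le {F : Finset ℕ+}
    (h : ∀ k ∈ F, F.card ≤ (k : ℕ)) : F ∈ schreierFamily α 1 := by
  rw [← zero_add (1 : Ordinal)]
  exact mem_schreierFamily_succ_of_blocks h
    (Blocks.of_card_le .zero_empty .zero_singleton le_rfl)

theorem mem_schreierFamily_of_card_le (hα : IsApproximating α) {ξ : Ordinal.{0}} (h1 : 1 ≤ ξ)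
    (hξ : ξ < Ordinal.omega 1) {F : Finset ℕ+} (h : ∀ k ∈ F, F.card ≤ (k : ℕ)) :
    F ∈ schreierFamily α ξ := by
  rcases Ordinal.zero_or_succ_or_isSuccLimit ξ with rfl | ⟨β, rfl⟩ | hlim
  · exact absurd h1 (by simp)
  · have hβ := lt_omega_one_of_succ hξ
    exact mem_schreierFamily_succ_of_blocks h (Blocks.of_card_le (empty_mem_schreierFamily hα hβ)
      (singleton_mem_schreierFamily hα hβ) le_rfl)
  · refine Schreier.limit hlim 1 (fun k _ => one_le) ?_
    rw [hα.one ξ hξ hlim]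
    exact mem_schreierFamily_one_of_card_le h

section Limit

variable (hα : IsApproximating α) {ξ : Ordinal.{0}} (hξ : ξ < Ordinal.omega 1)
  (hlim : Order.IsSuccLimit ξ)

include hα hξ hlim

theorem schreierFamily_limit_mono {n n' : ℕ+} (h : n ≤ n') {F : Finset ℕ+}
    (hF : F ∈ schreierFamily α (α ξ n)) (h1 : ∀ k ∈ F, 1 < k) :
    F ∈ schreierFamily α (α ξ n') := by
  induction n' using PNat.recOn with
  | one => rwa [le_antisymm h one_le] at hF
  | succ m ih =>
    rcases h.eq_or_lt with rfl | h
    · exact hF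
    · have hm := ih (PNat.lt_add_one_iff.1 h)
      simpa using hα.union ξ hξ hlim m F ∅ hm ((regular_schreierFamily _).empty hm) h1 (by simp)

theorem mem_schreierFamily_limit_of_blocks {n p : ℕ+} {R : ℕ} {Q : Finset ℕ+}
    (h : Blocks (schreierFamily α (α ξ n)) R Q) (h1 : ∀ k ∈ Q, 1 < k) (hp : n + R ≤ (p : ℕ)) :
    Q ∈ schreierFamily α (α ξ p) := by
  obtain ⟨c, hc, hcR, hcF⟩ := h
  induction R generalizing p Q with
  | zero =>
    rw [Finset.eq_empty_of_forall_notMem fun q hq => absurd (hcR q hq) (Nat.not_lt_zero _)]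
    exact empty_mem_schreierFamily hα ((hα.lt ξ hξ hlim p).trans hξ)
  | succ R ih =>
    set m : ℕ+ := ⟨n + R, by positivity⟩ with hm
    have hA : Q.filter (c · < R) ∈ schreierFamily α (α ξ m) := by
      refine ih (fun k hk => h1 k (Finset.mem_filter.1 hk).1) le_rfl
        (fun q hq => (Finset.mem_filter.1 hq).2) fun i => ?_
      exact (regular_schreierFamily _).subset (hcF i)
        (Finset.filter_subset_filter _ (Finset.filter_subset _ _))
    have hB : Q.filter (c · = R) ∈ schreierFamily α (α ξ m) :=
      schreierFamily_limit_mono hα hξ hlim (PNat.coe_le_coe _ _ |>.1 (Nat.le_add_right _ _))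
        (hcF R) fun k hk => h1 k (Finset.mem_filter.1 hk).1
    have hU := hα.union ξ hξ hlim m _ _ hA hB (fun k hk => h1 k (Finset.mem_filter.1 hk).1)
      fun a ha b hb => by
        rw [Finset.mem_filter] at ha hb
        by_contra! hle
        have := hc hle
        omega
    rw [← Finset.filter_or, Finset.filter_true_of_mem fun q hq => by
      have := hcR q hq
      omega] at hU
    exact schreierFamily_limit_mono hα hξ hlim (PNat.coe_le_coe _ _ |>.1 (by
      rw [PNat.add_coe, hm]
      simpa [add_assoc] using hp))
      hU h1

end Limit

end Schreier

section Blocks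

variable {𝓕 𝓖 : Set (Finset ℕ+)}

theorem Blocks.mono_family {R : ℕ} {Q : Finset ℕ+} (h : Blocks 𝓕 R Q) (h𝓖 : 𝓕 ⊆ 𝓖) :
    Blocks 𝓖 R Q := by
  obtain ⟨c, hc, hcR, hcF⟩ := h
  exact ⟨c, hc, hcR, fun i => h𝓖 (hcF i)⟩

theorem Blocks.empty (h0 : ∅ ∈ 𝓕) (R : ℕ) : Blocks 𝓕 R ∅ :=
  ⟨fun _ => 0, monotone_const, by simp, fun i => by simpa using h0⟩

/-- The union of finitely many sets can be cut at the minima of these sets. -/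
theorem Blocks.biUnion_of_stages (h0 : ∅ ∈ 𝓕) {N R : ℕ} (F : Fin N → Finset ℕ+)
    (h : ∀ Q ⊆ Finset.univ.biUnion F, ∀ q₀ ∈ Q, (∀ q ∈ Q, q₀ ≤ q) →
      (∀ i, ∀ q ∈ F i, q ∈ Q → ∃ e ∈ F i, e ≤ q₀) → Blocks 𝓕 R Q) :
    Blocks 𝓕 ((N + 1) * R) (Finset.univ.biUnion F) := by
  classical
  set I : ℕ+ → Finset (Fin N) := fun q => Finset.univ.filter fun i => ∃ e ∈ F i, e ≤ q with hI
  have hImono : Monotone I := fun q q' h i hi => by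
    simp only [hI, Finset.mem_filter, Finset.mem_univ, true_and] at hi ⊢
    obtain ⟨e, he, hle⟩ := hi
    exact ⟨e, he, hle.trans h⟩
  refine Blocks.comp (c := fun q => (I q).card) (fun q q' h => Finset.card_le_card (hImono h))
    (fun q _ => Nat.lt_succ_of_le ((Finset.card_le_univ _).trans_eq (by simp))) fun v => ?_
  set Q := (Finset.univ.biUnion F).filter fun q => (I q).card = v with hQ
  rcases Q.eq_empty_or_nonempty with he | hne
  · rw [he]
    exact Blocks.empty h0 R
  refine h Q (Finset.filter_subset _ _) (Q.min' hne) (Q.min'_mem hne)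
    (fun q hq => Q.min'_le q hq) fun i q hqi hq => ?_
  have h₁ : (I (Q.min' hne)).card = v := (Finset.mem_filter.1 (Q.min'_mem hne)).2
  have h₂ : (I q).card = v := (Finset.mem_filter.1 hq).2
  have h₃ : I (Q.min' hne) = I q :=
    Finset.eq_of_subset_of_card_le (hImono (Q.min'_le q hq)) (h₂.trans h₁.symm).le
  have h₄ : i ∈ I q := by
    simp only [hI, Finset.mem_filter, Finset.mem_univ, true_and]
    exact ⟨q, hqi, le_rfl⟩
  rw [← h₃] at h₄
  simpa [hI] using h₄

/-- The common refinement of several decompositions into successive blocks. -/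
theorem Blocks.biUnion_of_blocks (h𝓕 : Regular 𝓕) {N R : ℕ} {p : Fin N → ℕ}
    (F : Fin N → Finset ℕ+) (hF : ∀ i, Blocks 𝓕 (p i) (F i))
    (h : ∀ G : Fin N → Finset ℕ+, (∀ i, G i ∈ 𝓕) → (∀ i, G i ⊆ F i) →
      Blocks 𝓕 R (Finset.univ.biUnion G)) :
    Blocks 𝓕 ((∑ i, (p i - 1) + 1) * R) (Finset.univ.biUnion F) := by
  classical
  choose c hc hcR hcF using hF
  set C : ℕ+ → ℕ := fun q => ∑ i, min (c i q) (p i - 1) with hC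
  have hmono : ∀ i, Monotone fun q => min (c i q) (p i - 1) := fun i q q' h =>
    min_le_min_right _ (hc i h)
  refine Blocks.comp (c := C) (fun q q' h => Finset.sum_le_sum fun i _ => hmono i h)
    (fun q _ => Nat.lt_succ_of_le (Finset.sum_le_sum fun i _ => min_le_right _ _)) fun v => ?_
  have hle : ∀ q q', q ≤ q' → C q = v → C q' = v → ∀ i,
      min (c i q) (p i - 1) = min (c i q') (p i - 1) := fun q q' hqq h₁ h₂ i =>
    (Finset.sum_eq_sum_iff_of_le fun j _ => hmono j hqq).1 (h₁.trans h₂.symm) i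
      (Finset.mem_univ i)
  have heq : ∀ i, ∀ q ∈ F i, ∀ q' ∈ F i, C q = v → C q' = v → c i q = c i q' := by
    intro i q hq q' hq' h₁ h₂
    have h₃ : min (c i q) (p i - 1) = min (c i q') (p i - 1) := by
      rcases le_total q q' with h | h
      · exact hle q q' h h₁ h₂ i
      · exact (hle q' q h h₂ h₁ i).symm
    have h₄ := hcR i q hq
    have h₅ := hcR i q' hq'
    omega
  have hU : (Finset.univ.biUnion F).filter (C · = v)
      = Finset.univ.biUnion fun i => (F i).filter (C · = v) := by
    ext q
    simp
  rw [hU]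
  refine h _ (fun i => ?_) fun i => Finset.filter_subset _ _
  rcases ((F i).filter (C · = v)).eq_empty_or_nonempty with he | ⟨q, hq⟩
  · rw [he]
    exact h𝓕.empty (hcF i 0)
  · rw [Finset.mem_filter] at hq
    refine h𝓕.subset (hcF i (c i q)) fun q' hq' => ?_
    rw [Finset.mem_filter] at hq' ⊢
    exact ⟨hq'.1, heq i q' hq'.1 q hq.1 hq'.2 hq.2⟩

/-- A set which is covered by boundedly many elements to the right of each element of `P` is a
union of boundedly many spreads of `P`. -/
theorem exists_isSpread_layers {P Q : Finset ℕ+} {c : ℕ+ → ℕ} {n : ℕ} (hc : Monotone c)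
    (hQ : ∀ q ∈ Q, ∃ p ∈ P, p ≤ q ∧ c p = c q)
    (hcard : ∀ i, (Q.filter (c · = i)).card ≤ n) :
    ∃ F : Fin n → Finset ℕ+, (∀ i, IsSpread (F i) P) ∧ Finset.univ.biUnion F = Q := by
  classical
  choose! π hπP hπle hπc using hQ
  set r : ℕ+ → ℕ := fun q => (Q.filter fun q' => c q' = c q ∧ q' < q).card with hr
  have hrlt : ∀ q ∈ Q, ∀ q', q < q' → c q = c q' → r q < r q' := by
    intro q hq q' hqq hcc
    refine Finset.card_lt_card (Finset.ssubset_iff_of_subset (fun z hz => ?_) |>.2 ⟨q, ?_, ?_⟩)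
    · rw [Finset.mem_filter] at hz ⊢
      exact ⟨hz.1, hz.2.1.trans hcc, hz.2.2.trans hqq⟩
    · rw [Finset.mem_filter]
      exact ⟨hq, hcc, hqq⟩
    · simp
  have hrn : ∀ q ∈ Q, r q < n := by
    intro q hq
    refine (Finset.card_lt_card (Finset.ssubset_iff_of_subset (fun z hz => ?_) |>.2
      ⟨q, ?_, ?_⟩)).trans_le (hcard (c q))
    · rw [Finset.mem_filter] at hz ⊢
      exact ⟨hz.1, hz.2.1⟩
    · simp [hq]
    · simp
  refine ⟨fun i => Q.filter (r · = i), fun i => ⟨π, fun g hg => ?_, fun q hq q' hq' h => ?_⟩, ?_⟩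
  · have := (Finset.mem_filter.1 hg).1
    exact ⟨hπP g this, hπle g this⟩
  · rw [Finset.mem_coe, Finset.mem_filter] at hq hq'
    by_contra! hle
    have h₁ : c q' ≤ c q := by
      rw [← hπc q' hq'.1, ← hπc q hq.1]
      exact hc hle
    have h₂ := hrlt q hq.1 q' h (le_antisymm (hc h.le) h₁)
    omega
  · ext q
    simp only [Finset.mem_biUnion, Finset.mem_univ, true_and, Finset.mem_filter]
    exact ⟨fun ⟨_, h, _⟩ => h, fun h => ⟨⟨r q, hrn q h⟩, h, rfl⟩⟩

end Blocks

section Schreier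

variable {α : Ordinal.{0} → ℕ+ → Ordinal.{0}}

/-- Any `N` sets in a Schreier family, supported far to the right, are covered by `blockBound N`
successive members of the family. -/
def blockBound (N : ℕ) : ℕ := (N + 1) * (2 * (4 * N + 10))

theorem mul_blockBound_le (N : ℕ) : N * blockBound N ≤ 20 * (N + 1) ^ 3 := by
  have h₁ : N ≤ N + 1 := by omega
  have h₂ : 2 * (4 * N + 10) ≤ 20 * (N + 1) := by omega
  calc N * ((N + 1) * (2 * (4 * N + 10))) ≤ (N + 1) * ((N + 1) * (20 * (N + 1))) := by gcongr
    _ = _ := by ring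

theorem mul_blockBound_le_two_pow (N : ℕ) : N * blockBound N ≤ 2 ^ (4 * N + 10) - 1 := by
  have h₁ : N + 1 ≤ 2 ^ N := Nat.lt_two_pow_self
  have h₂ : (N + 1) ^ 3 * 1024 ≤ 2 ^ (4 * N + 10) := by
    calc (N + 1) ^ 3 * 1024 ≤ (2 ^ N) ^ 3 * 1024 := by gcongr
      _ ≤ (2 ^ N) ^ 4 * 1024 := by
        gcongr
        · exact Nat.one_le_two_pow
        · norm_num
      _ = 2 ^ (4 * N + 10) := by
        rw [pow_add, ← pow_mul, mul_comm N]
        norm_num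
  have h₃ := mul_blockBound_le N
  have h₄ : 0 < (N + 1) ^ 3 := by positivity
  omega

theorem blocks_biUnion (hα : IsApproximating α) {γ : Ordinal.{0}} (hγ : γ < Ordinal.omega 1)
    {N : ℕ} (F : Fin N → Finset ℕ+) (hF : ∀ i, F i ∈ schreierFamily α γ)
    (hL : ∀ i, ∀ k ∈ F i, blockBound N + 2 ≤ (k : ℕ)) :
    Blocks (schreierFamily α γ) (blockBound N) (Finset.univ.biUnion F) := by
  classical
  induction γ using WellFoundedLT.induction generalizing F with
  | _ γ ih =>
  have h0 := empty_mem_schreierFamily hα hγ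
  have hLU : ∀ k ∈ Finset.univ.biUnion F, blockBound N + 2 ≤ (k : ℕ) := fun k hk => by
    obtain ⟨i, -, hi⟩ := Finset.mem_biUnion.1 hk
    exact hL i k hi
  have hcut : ∀ Q ⊆ Finset.univ.biUnion F,
      (Finset.univ.biUnion fun i => (F i).filter (· ∈ Q)) = Q := by
    intro Q hQ
    ext q
    simp only [Finset.mem_biUnion, Finset.mem_univ, true_and, Finset.mem_filter]
    refine ⟨fun ⟨_, _, h⟩ => h, fun h => ?_⟩
    obtain ⟨i, -, hi⟩ := Finset.mem_biUnion.1 (hQ h)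
    exact ⟨i, hi, h⟩
  rcases Ordinal.zero_or_succ_or_isSuccLimit γ with rfl | ⟨β, rfl⟩ | hlim
  · refine Blocks.of_card_le h0 (singleton_mem_schreierFamily hα hγ) ?_
    calc (Finset.univ.biUnion F).card ≤ ∑ i, (F i).card := Finset.card_biUnion_le
      _ ≤ ∑ _i : Fin N, 1 := Finset.sum_le_sum fun i _ => mem_schreierFamily_zero_iff.1 (hF i)
      _ = N := by simp
      _ ≤ blockBound N := by
        rw [blockBound]
        nlinarith
  · have hβ := lt_omega_one_of_succ hγ
    choose p hp hB using fun i => exists_blocks_of_mem_schreierFamily_succ hα hβ (hF i)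
    refine Blocks.biUnion_of_stages h0 F fun Q hQ q₀ hq₀ hmin hst => ?_
    have hGB : ∀ i, Blocks (schreierFamily α β) q₀ ((F i).filter (· ∈ Q)) := by
      intro i
      rcases ((F i).filter (· ∈ Q)).eq_empty_or_nonempty with he | ⟨q, hq⟩
      · rw [he]
        exact Blocks.empty (empty_mem_schreierFamily hα hβ) _
      · rw [Finset.mem_filter] at hq
        obtain ⟨e, he, hle⟩ := hst i q hq.1 hq.2
        exact ((hB i).subset (regular_schreierFamily β) (Finset.filter_subset _ _)).mono
          ((hp i e he).trans hle)
    have h₁ := Blocks.biUnion_of_blocks (R := blockBound N) (regular_schreierFamily β) _ hGB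
      fun G hG hGF => ih β (Order.lt_succ β) hβ G hG fun i k hk =>
        hL i k (Finset.mem_filter.1 (hGF i hk)).1
    rw [hcut Q hQ] at h₁
    have hN : 1 ≤ N := by
      obtain ⟨i, -, -⟩ := Finset.mem_biUnion.1 (hQ hq₀)
      exact i.pos
    have hR : (∑ _i : Fin N, ((q₀ : ℕ) - 1) + 1) * blockBound N ≤ (2 ^ (4 * N + 10) - 1) * q₀ := by
      have h₂ : ∑ _i : Fin N, ((q₀ : ℕ) - 1) + 1 ≤ N * q₀ := by
        obtain ⟨r, hr⟩ : ∃ r, (q₀ : ℕ) = r + 1 := ⟨q₀ - 1, by have := q₀.pos; omega⟩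
        simp only [hr, Finset.sum_const, Finset.card_univ, Fintype.card_fin, smul_eq_mul,
          Nat.add_sub_cancel]
        nlinarith
      calc _ ≤ N * q₀ * blockBound N := Nat.mul_le_mul_right _ h₂
        _ = N * blockBound N * q₀ := by ring
        _ ≤ _ := Nat.mul_le_mul_right _ (mul_blockBound_le_two_pow N)
    have h₃ := h₁.group (regular_schreierFamily β) hmin one_pos q₀.pos hR
    rw [mul_one] at h₃
    refine h₃.mono_family ?_
    rintro G ⟨r, hr, hG⟩
    exact mem_schreierFamily_succ_of_blocks (by simpa using hr) hG
  · choose n hn hB using fun i => exists_mem_of_mem_schreierFamily_limit hlim (hF i)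
    have hg : 2 ≤ 2 * (4 * N + 10) := by omega
    refine Blocks.biUnion_of_stages h0 F fun Q hQ q₀ hq₀ hmin hst => Blocks.mono ?_ hg
    have h1Q : ∀ k ∈ Q, 1 < k := fun k hk => by
      have := hLU k (hQ hk)
      rw [← PNat.coe_lt_coe, PNat.one_coe]
      omega
    have hGB : ∀ i, (F i).filter (· ∈ Q) ∈ schreierFamily α (α γ q₀) := by
      intro i
      rcases ((F i).filter (· ∈ Q)).eq_empty_or_nonempty with he | ⟨q, hq⟩
      · rw [he]
        exact empty_mem_schreierFamily hα ((hα.lt γ hγ hlim _).trans hγ)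
      · rw [Finset.mem_filter] at hq
        obtain ⟨e, he, hle⟩ := hst i q hq.1 hq.2
        exact schreierFamily_limit_mono hα hγ hlim ((hn i e he).trans hle)
          ((regular_schreierFamily _).subset (hB i) (Finset.filter_subset _ _))
          fun k hk => h1Q k (Finset.mem_filter.1 hk).2
    have h₁ := ih _ (hα.lt γ hγ hlim q₀) ((hα.lt γ hγ hlim _).trans hγ) _ hGB
      fun i k hk => hL i k (Finset.mem_filter.1 hk).1
    rw [hcut Q hQ] at h₁
    set t : ℕ+ := ⟨q₀ + blockBound N, by positivity⟩ with ht
    have h₂ := mem_schreierFamily_limit_of_blocks (p := t) hα hγ hlim h₁ h1Q le_rfl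
    refine ⟨fun q => if q < t then 0 else 1, fun q q' h => ?_, fun q _ => ?_, fun v => ?_⟩
    · beta_reduce
      split_ifs with h₃ h₄
      · exact le_rfl
      · exact zero_le_one
      · exact absurd (h.trans_lt ‹_›) h₃
      · exact le_rfl
    · beta_reduce
      split_ifs <;> norm_num
    · have hsplit : ∀ v, (Q.filter fun q => (if q < t then 0 else 1) = v) ⊆ Q.filter (· < t) ∨
          (Q.filter fun q => (if q < t then 0 else 1) = v) ⊆ Q.filter (t ≤ ·) := by
        intro v
        rcases Nat.eq_zero_or_pos v with rfl | hv
        · left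
          intro q hq
          simpa using hq
        · right
          intro q hq
          rw [Finset.mem_filter] at hq ⊢
          refine ⟨hq.1, ?_⟩
          by_contra! hlt
          rw [if_pos hlt] at hq
          omega
      rcases hsplit v with h₃ | h₃
      · refine (regular_schreierFamily γ).subset (mem_schreierFamily_of_card_le hα
          (Order.one_le_iff_pos.2 hlim.bot_lt) hγ fun k hk => ?_) h₃
        rw [Finset.mem_filter] at hk
        have h₄ : Q.filter (· < t) ⊆ Finset.Ico q₀ t := fun q hq => by
          rw [Finset.mem_filter] at hq
          exact Finset.mem_Ico.2 ⟨hmin q hq.1, hq.2⟩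
        have h₅ := Finset.card_le_card h₄
        rw [PNat.card_Ico] at h₅
        have h₆ := hLU k (hQ hk.1)
        have h₇ : (t : ℕ) = q₀ + blockBound N := rfl
        omega
      · refine (regular_schreierFamily γ).subset (Schreier.limit hlim t (fun k hk => ?_)
          ((regular_schreierFamily _).subset h₂ (Finset.filter_subset (t ≤ ·) Q))) h₃
        exact (Finset.mem_filter.1 hk).2

end Schreier

section Schreier

variable {α : Ordinal.{0} → ℕ+ → Ordinal.{0}} {ξ : Ordinal.{0}} {M : ℕ}

/-- `F ⊆ [q, ∞)` is much smaller than the members of `𝓢_ξ` in `[q, ∞)`. -/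
def IsSmall (α : Ordinal.{0} → ℕ+ → Ordinal.{0}) (ξ : Ordinal.{0}) (M : ℕ) (q : ℕ+)
    (F : Finset ℕ+) : Prop :=
  (∀ k ∈ F, q ≤ k) ∧
    ((∃ γ p, ξ = γ + 1 ∧ M * p ≤ q ∧ Blocks (schreierFamily α γ) p F) ∨
      (Order.IsSuccLimit ξ ∧ ∃ p : ℕ+, p + M ≤ (q : ℕ) ∧ F ∈ schreierFamily α (α ξ p)))

/-- The sets which are small compared to their minimum. -/
def smallFamily (α : Ordinal.{0} → ℕ+ → Ordinal.{0}) (ξ : Ordinal.{0}) (M : ℕ) :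
    Set (Finset ℕ+) :=
  {F | ∀ q ∈ F, (∀ k ∈ F, q ≤ k) → IsSmall α ξ M q F}

theorem IsSmall.spread {q q' : ℕ+} {F G : Finset ℕ+} (h : IsSmall α ξ M q F) (hG : IsSpread G F)
    (hq : q ≤ q') (hGq : ∀ k ∈ G, q' ≤ k) : IsSmall α ξ M q' G := by
  have hq' : (q : ℕ) ≤ q' := hq
  refine ⟨hGq, ?_⟩
  rcases h.2 with ⟨γ, p, h₁, h₂, h₃⟩ | ⟨h₁, p, h₂, h₃⟩
  · exact .inl ⟨γ, p, h₁, h₂.trans hq', h₃.spread (regular_schreierFamily γ) hG⟩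
  · exact .inr ⟨h₁, p, h₂.trans hq', regular_schreierFamily _ F h₃ G hG⟩

theorem IsSmall.subset {q : ℕ+} {F G : Finset ℕ+} (h : IsSmall α ξ M q F) (hG : G ⊆ F) :
    IsSmall α ξ M q G :=
  h.spread (.of_subset hG) le_rfl fun k hk => h.1 k (hG hk)

theorem regular_smallFamily : Regular (smallFamily α ξ M) := by
  rintro F hF G ⟨π, hπ, hmono⟩ q hq hqG
  have hne : F.Nonempty := ⟨π q, (hπ q hq).1⟩
  refine (hF (F.min' hne) (F.min'_mem hne) fun k hk => F.min'_le k hk).spread ⟨π, hπ, hmono⟩ ?_ hqG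
  exact (F.min'_le _ (hπ q hq).1).trans (hπ q hq).2

theorem isSmall_of_card_le (hα : IsApproximating α) (h1 : 1 ≤ ξ) (hξ : ξ < Ordinal.omega 1)
    {q : ℕ+} {F : Finset ℕ+} (hq : ∀ k ∈ F, q ≤ k) (hM : 1 + M ≤ (q : ℕ))
    (hFM : M * F.card ≤ q) (hF : F.card ≤ (q : ℕ)) : IsSmall α ξ M q F := by
  refine ⟨hq, ?_⟩
  rcases Ordinal.zero_or_succ_or_isSuccLimit ξ with rfl | ⟨β, rfl⟩ | hlim
  · exact absurd h1 (by simp)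
  · have hβ := lt_omega_one_of_succ hξ
    exact .inl ⟨β, F.card, rfl, hFM, Blocks.of_card_le (empty_mem_schreierFamily hα hβ)
      (singleton_mem_schreierFamily hα hβ) le_rfl⟩
  · refine .inr ⟨hlim, 1, hM, ?_⟩
    rw [hα.one ξ hξ hlim]
    exact mem_schreierFamily_one_of_card_le fun k hk => hF.trans (hq k hk)

/-- The union of `N` small sets belongs to `𝓢_ξ`. -/
theorem biUnion_mem_schreierFamily (hα : IsApproximating α) (hξ : ξ < Ordinal.omega 1) {N : ℕ}
    {q : ℕ+} (hM : M = blockBound N * (N + 1)) (hq : blockBound N + 2 ≤ (q : ℕ))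
    (hMq : M ≤ (q : ℕ)) (F : Fin N → Finset ℕ+) (hF : ∀ i, IsSmall α ξ M q (F i)) :
    Finset.univ.biUnion F ∈ schreierFamily α ξ := by
  classical
  rcases Nat.eq_zero_or_pos N with rfl | hN
  · simpa using empty_mem_schreierFamily hα hξ
  have hLU : ∀ k ∈ Finset.univ.biUnion F, q ≤ k := fun k hk => by
    obtain ⟨i, -, hi⟩ := Finset.mem_biUnion.1 hk
    exact (hF i).1 k hi
  have hb : 0 < blockBound N := by
    rw [blockBound]
    positivity
  rcases Ordinal.zero_or_succ_or_isSuccLimit ξ with rfl | ⟨β, rfl⟩ | hlim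
  · rcases (hF ⟨0, hN⟩).2 with ⟨γ, p, h, -⟩ | ⟨h, -⟩
    · exact absurd h.symm (Order.succ_ne_bot _)
    · exact absurd rfl h.ne_bot
  · have hβ := lt_omega_one_of_succ hξ
    have hF' : ∀ i, ∃ p, M * p ≤ q ∧ Blocks (schreierFamily α β) p (F i) := by
      intro i
      rcases (hF i).2 with ⟨γ, p, h, h₁, h₂⟩ | ⟨h, -⟩
      · obtain rfl : β = γ := Order.succ_injective h
        exact ⟨p, h₁, h₂⟩
      · exact absurd h (Order.not_isSuccLimit_succ β)
    choose p hp hB using hF'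
    have h₁ := Blocks.biUnion_of_blocks (R := blockBound N) (regular_schreierFamily β) F hB
      fun G hG hGF => blocks_biUnion hα hβ G hG fun i k hk =>
        hq.trans ((hF i).1 k (hGF i hk))
    refine mem_schreierFamily_succ_of_blocks (fun k hk => ?_) h₁
    have hMpos : 0 < M := by
      rw [hM]
      positivity
    set r := (q : ℕ) / M with hr
    have hr1 : 1 ≤ r := Nat.div_pos hMq hMpos
    have hpr : ∀ i, p i ≤ r := fun i => by
      rw [hr, Nat.le_div_iff_mul_le hMpos, mul_comm]
      exact hp i
    calc (∑ i, (p i - 1) + 1) * blockBound N ≤ (∑ _i : Fin N, r + r) * blockBound N := by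
          gcongr with i
          exact (Nat.sub_le _ _).trans (hpr i)
      _ = r * M := by
          rw [hM]
          simp only [Finset.sum_const, Finset.card_univ, Fintype.card_fin, smul_eq_mul]
          ring
      _ ≤ q := Nat.div_mul_le_self _ _
      _ ≤ k := hLU k hk
  · have hF' : ∀ i, ∃ p : ℕ+, p + M ≤ (q : ℕ) ∧ F i ∈ schreierFamily α (α ξ p) := by
      intro i
      rcases (hF i).2 with ⟨γ, p, h, -⟩ | ⟨-, h⟩
      · rw [h] at hlim
        exact absurd hlim (Order.not_isSuccLimit_succ γ)
      · exact h
    choose p hp hB using hF'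
    have hne : (Finset.univ : Finset (Fin N)).Nonempty := ⟨⟨0, hN⟩, Finset.mem_univ _⟩
    obtain ⟨i₀, -, hi₀⟩ := Finset.exists_max_image Finset.univ p hne
    have h1 : ∀ k ∈ Finset.univ.biUnion F, 1 < k := fun k hk => by
      have h₂ : (q : ℕ) ≤ k := hLU k hk
      rw [← PNat.coe_lt_coe, PNat.one_coe]
      omega
    have h₁ := blocks_biUnion hα ((hα.lt ξ hξ hlim (p i₀)).trans hξ) F
      (fun i => schreierFamily_limit_mono hα hξ hlim (hi₀ i (Finset.mem_univ i)) (hB i) fun k hk =>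
        h1 k (Finset.mem_biUnion.2 ⟨i, Finset.mem_univ i, hk⟩))
      fun i k hk => hq.trans ((hF i).1 k hk)
    have h₃ : blockBound N ≤ M := by
      rw [hM]
      exact Nat.le_mul_of_pos_right _ (Nat.succ_pos N)
    refine Schreier.limit hlim q hLU (mem_schreierFamily_limit_of_blocks hα hξ hlim h₁ h1 ?_)
    have := hp i₀
    omega

theorem Blocks.card_le {R : ℕ} {Q : Finset ℕ+} (h : Blocks (schreierFamily α 0) R Q) :
    Q.card ≤ R := by
  obtain ⟨c, hc, hcR, hcF⟩ := h
  rw [← Finset.card_range R]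
  refine Finset.card_le_card_of_injOn c (fun q hq => by simpa using hcR q hq)
    fun q hq q' hq' h => ?_
  exact Finset.card_le_one.1 (mem_schreierFamily_zero_iff.1 (hcF (c q'))) q
    (Finset.mem_filter.2 ⟨hq, h⟩) q' (Finset.mem_filter.2 ⟨hq', rfl⟩)

/-- Boundedly many successive small sets attached to the elements of a member of `𝓢_ξ`. -/
theorem blocks_smallFamily (hα : IsApproximating α) (h1 : 1 ≤ ξ) (hξ : ξ < Ordinal.omega 1)
    (hM : 0 < M) {w n : ℕ} (hn : n = 8 * M * w) (hw : n * blockBound n + 1 ≤ 2 ^ w)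
    {P Q : Finset ℕ+} (hP : P ∈ schreierFamily α ξ) {c : ℕ+ → ℕ} (hc : Monotone c)
    (hPQ : ∀ q ∈ Q, ∃ p ∈ P, p ≤ q ∧ c p = c q) (hcard : ∀ i, (Q.filter (c · = i)).card ≤ n)
    (hQ : ∀ q ∈ Q, blockBound n + M + 2 ≤ (q : ℕ)) : Blocks (smallFamily α ξ M) n Q := by
  classical
  have h0 : ∅ ∈ smallFamily α ξ M := by simp [smallFamily]
  rcases Q.eq_empty_or_nonempty with rfl | hne
  · exact Blocks.empty h0 n
  obtain ⟨F, hF, rfl⟩ := exists_isSpread_layers hc hPQ hcard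
  set Q := Finset.univ.biUnion F with hQdef
  set q₀ := Q.min' hne with hq₀
  have hq₀Q : q₀ ∈ Q := Q.min'_mem hne
  have hmin : ∀ k ∈ Q, q₀ ≤ k := fun k hk => Q.min'_le k hk
  have hq₀L := hQ q₀ hq₀Q
  have hFQ : ∀ i, ∀ k ∈ F i, k ∈ Q := fun i k hk => Finset.mem_biUnion.2 ⟨i, Finset.mem_univ i, hk⟩
  have hn0 : 0 < n := by
    obtain ⟨i, -, -⟩ := Finset.mem_biUnion.1 hq₀Q
    exact i.pos
  have hb : 0 < blockBound n := by
    rw [blockBound]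
    positivity
  rcases Ordinal.zero_or_succ_or_isSuccLimit ξ with rfl | ⟨β, rfl⟩ | hlim
  · exact absurd h1 (by simp)
  · have hβ := lt_omega_one_of_succ hξ
    obtain ⟨r, hr, hB⟩ := exists_blocks_of_mem_schreierFamily_succ hα hβ hP
    have h₁ := Blocks.biUnion_of_blocks (R := blockBound n) (regular_schreierFamily β) F
      (fun i => hB.spread (regular_schreierFamily β) (hF i))
      fun G hG hGF => blocks_biUnion hα hβ G hG fun i k hk => by
        have := hQ k (hFQ i k (hGF i hk))
        omega
    have hrq : r ≤ q₀ := by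
      obtain ⟨p, hp, hpq, -⟩ := hPQ q₀ hq₀Q
      exact (hr p hp).trans hpq
    have hR : (∑ _i : Fin n, (r - 1) + 1) * blockBound n ≤ (2 ^ w - 1) * q₀ := by
      have h₂ : ∑ _i : Fin n, (r - 1) + 1 ≤ n * q₀ := by
        obtain ⟨s, hs⟩ : ∃ s, (q₀ : ℕ) = s + 1 := ⟨q₀ - 1, by have := q₀.pos; omega⟩
        have h₃ : r - 1 ≤ s := by omega
        simp only [hs, Finset.sum_const, Finset.card_univ, Fintype.card_fin, smul_eq_mul]
        nlinarith
      calc _ ≤ n * q₀ * blockBound n := Nat.mul_le_mul_right _ h₂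
        _ = n * blockBound n * q₀ := by ring
        _ ≤ _ := Nat.mul_le_mul_right _ (by omega)
    have h₃ := (h₁.group (regular_schreierFamily β) hmin hM (by omega) hR).mono
      (show 2 * M * w ≤ n by rw [hn]; gcongr; norm_num)
    refine h₃.mono_family ?_
    rintro G ⟨p, hp, hG⟩ q hq hqG
    exact ⟨hqG, .inl ⟨β, p, rfl, hp q hq, hG⟩⟩
  · obtain ⟨p, hp, hPp⟩ := exists_mem_of_mem_schreierFamily_limit hlim hP
    have hpq : p ≤ q₀ := by
      obtain ⟨p', hp', hpq, -⟩ := hPQ q₀ hq₀Q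
      exact (hp p' hp').trans hpq
    have h1Q : ∀ k ∈ Q, 1 < k := fun k hk => by
      have := hQ k hk
      rw [← PNat.coe_lt_coe, PNat.one_coe]
      omega
    have h₁ := blocks_biUnion hα ((hα.lt ξ hξ hlim p).trans hξ) F
      (fun i => regular_schreierFamily _ P hPp _ (hF i)) fun i k hk => by
        have := hQ k (hFQ i k hk)
        omega
    set s : ℕ+ := ⟨p + blockBound n, by positivity⟩ with hs
    set t : ℕ+ := ⟨p + blockBound n + M, by positivity⟩ with ht
    have hs' : (s : ℕ) = p + blockBound n := rfl
    have ht' : (t : ℕ) = p + blockBound n + M := rfl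
    have h₂ := mem_schreierFamily_limit_of_blocks (p := s) hα hξ hlim h₁ h1Q le_rfl
    have hn' : n = 2 * (4 * M * w) := by
      rw [hn]
      ring
    rw [hn']
    have hcut : Monotone fun q : ℕ+ => if q < t then 0 else 1 := fun q q' h => by
      beta_reduce
      split_ifs with h₃ h₄
      · exact le_rfl
      · exact zero_le_one
      · exact absurd (h.trans_lt ‹_›) h₃
      · exact le_rfl
    refine Blocks.comp hcut (fun q _ => ?_) fun v => ?_
    · split_ifs <;> norm_num
    · rcases Nat.eq_zero_or_pos v with rfl | hv
      · set Q' := Q.filter fun q => (if q < t then 0 else 1) = 0 with hQ'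
        have hlt : ∀ q ∈ Q', q ∈ Q ∧ q < t := fun q hq => by simpa [hQ'] using hq
        have hcard' : Q'.card ≤ blockBound n + M := by
          have h₄ : Q' ⊆ Finset.Ico q₀ t := fun q hq =>
            Finset.mem_Ico.2 ⟨hmin q (hlt q hq).1, (hlt q hq).2⟩
          have h₅ := Finset.card_le_card h₄
          rw [PNat.card_Ico] at h₅
          have h₆ : (p : ℕ) ≤ q₀ := hpq
          omega
        have h₃ : Blocks (schreierFamily α 0) (blockBound n + M) Q' :=
          Blocks.of_card_le .zero_empty .zero_singleton hcard'
        have hR : blockBound n + M ≤ (2 ^ w - 1) * q₀ := by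
          have h₄ : 1 ≤ 2 ^ w - 1 := by
            have : 1 ≤ n * blockBound n := Nat.mul_pos hn0 hb
            omega
          have h₅ : 1 * (q₀ : ℕ) ≤ (2 ^ w - 1) * q₀ := Nat.mul_le_mul_right _ h₄
          omega
        refine ((h₃.group (regular_schreierFamily 0) (fun k hk => hmin k (hlt k hk).1)
          (Nat.succ_pos M) (by omega) hR).mono ?_).mono_family ?_
        · calc 2 * (M + 1) * w ≤ 2 * (M + M) * w := by
                gcongr
                exact hM
            _ = 4 * M * w := by ring
        rintro G ⟨r, hr, hG⟩ q hq hqG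
        have hGr := Blocks.card_le hG
        have hGpos : 0 < G.card := Finset.card_pos.2 ⟨q, hq⟩
        have h₆ := hr q hq
        have h₇ : M * G.card ≤ M * r := Nat.mul_le_mul_left _ hGr
        have h₈ : M * 1 ≤ M * r := Nat.mul_le_mul_left _ (by omega)
        rw [Nat.succ_mul] at h₆
        exact isSmall_of_card_le hα h1 hξ hqG (by omega) (by omega) (by omega)
      · refine (Blocks.of_mem regular_smallFamily fun q hq hqG => ?_).mono
          (show 1 ≤ 4 * M * w by omega)
        have hlt : ∀ q ∈ Q.filter (fun q => (if q < t then 0 else 1) = v), q ∈ Q ∧ t ≤ q := by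
          intro q hq
          rw [Finset.mem_filter] at hq
          refine ⟨hq.1, ?_⟩
          by_contra! hlt
          rw [if_pos hlt] at hq
          omega
        refine ⟨hqG, .inr ⟨hlim, s, ?_, (regular_schreierFamily _).subset h₂
          (Finset.filter_subset _ _)⟩⟩
        have : (t : ℕ) ≤ q := (hlt q hq).2
        omega

theorem exists_mul_blockBound_le_two_pow (M : ℕ) :
    ∃ w, 0 < w ∧ (8 * M * w) * blockBound (8 * M * w) + 1 ≤ 2 ^ w := by
  obtain ⟨s, hs⟩ : ∃ s, s = M + 3000 := ⟨_, rfl⟩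
  refine ⟨8 * s, by omega, ?_⟩
  have h₁ : 8 * M * (8 * s) + 1 ≤ 64 * s ^ 2 := by nlinarith
  have h₂ : s ≤ 2 ^ s := Nat.lt_two_pow_self.le
  have h₃ : 3000 ^ 2 ≤ s ^ 2 := Nat.pow_le_pow_left (by omega) 2
  calc _ ≤ 20 * (8 * M * (8 * s) + 1) ^ 3 + 1 := Nat.add_le_add_right (mul_blockBound_le _) 1
    _ ≤ 20 * (64 * s ^ 2) ^ 3 + 1 := by gcongr
    _ = 5242880 * s ^ 6 + 1 := by ring
    _ ≤ 9000000 * s ^ 6 := by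
      have : 0 < s ^ 6 := by
        have : 0 < s := by omega
        positivity
      omega
    _ ≤ s ^ 2 * s ^ 6 := by
      gcongr
      simpa using h₃
    _ = s ^ 8 := by ring
    _ ≤ (2 ^ s) ^ 8 := Nat.pow_le_pow_left h₂ 8
    _ = 2 ^ (8 * s) := by rw [← pow_mul, mul_comm]

end Schreier

/-! ### Functionals norming the Tsirelson space -/

section Norming

open scoped NNReal

/-- The minima of the pieces into which the support of `w` is cut by `c`. -/
def starts (w : ℕ+ →₀ ℝ≥0) (c : ℕ+ → ℕ) : Finset ℕ+ :=
  w.support.filter fun q => ∀ q' ∈ w.support, q' < q → c q' < c q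

/-- The coefficients of the functionals of depth `k` in the standard norming set of `T[𝓕, t]`. -/
inductive Norming (𝓕 : Set (Finset ℕ+)) (t : ℝ≥0) : ℕ → (ℕ+ →₀ ℝ≥0) → Prop
  | zero (k : ℕ) : Norming 𝓕 t k 0
  | unit (k : ℕ) (j : ℕ+) : Norming 𝓕 t k (Finsupp.single j 1)
  | node {k : ℕ} {w : ℕ+ →₀ ℝ≥0} {c : ℕ+ → ℕ} (hc : Monotone c) (hs : starts w c ∈ 𝓕)
      (h : ∀ i, Norming 𝓕 t k (w.filter (c · = i))) : Norming 𝓕 t (k + 1) (t • w)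

/-- The value of the functional with coefficients `w` at `|x|`. -/
def pairing (w : ℕ+ →₀ ℝ≥0) (x : ℕ+ →₀ ℝ) : ℝ≥0∞ := w.sum fun j a => a * ‖x j‖ₑ

variable {𝓕 : Set (Finset ℕ+)} {t : ℝ≥0} {w : ℕ+ →₀ ℝ≥0} {c : ℕ+ → ℕ}

theorem mem_starts {q : ℕ+} :
    q ∈ starts w c ↔ q ∈ w.support ∧ ∀ q' ∈ w.support, q' < q → c q' < c q := by
  rw [starts, Finset.mem_filter]

theorem exists_mem_starts (hc : Monotone c) {q : ℕ+} (hq : q ∈ w.support) :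
    ∃ s ∈ starts w c, s ≤ q ∧ c s = c q := by
  obtain ⟨s, hs, hmin⟩ := Finset.exists_min_image (w.support.filter fun q' => c q' = c q) id
    ⟨q, Finset.mem_filter.2 ⟨hq, rfl⟩⟩
  rw [Finset.mem_filter] at hs
  refine ⟨s, mem_starts.2 ⟨hs.1, fun q' hq' hlt => ?_⟩,
    hmin q (Finset.mem_filter.2 ⟨hq, rfl⟩), hs.2⟩
  refine lt_of_le_of_ne (hc hlt.le) fun h => ?_
  have : s ≤ q' := hmin q' (Finset.mem_filter.2 ⟨hq', h.trans hs.2⟩)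
  exact absurd this (not_le.2 hlt)

theorem lt_of_mem_starts {q q' : ℕ+} (hq : q ∈ w.support) (hq' : q' ∈ starts w c) (h : q < q') :
    c q < c q' :=
  (mem_starts.1 hq').2 q hq h

theorem starts_injOn : Set.InjOn c (starts w c) := by
  intro q hq q' hq' h
  rcases lt_trichotomy q q' with hlt | rfl | hlt
  · exact absurd (lt_of_mem_starts (mem_starts.1 hq).1 hq' hlt) (by omega)
  · rfl
  · exact absurd (lt_of_mem_starts (mem_starts.1 hq').1 hq hlt) (by omega)

theorem starts_congr {c' : ℕ+ → ℕ} (h : ∀ q ∈ w.support, c' q = c q) :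
    starts w c' = starts w c := by
  ext q
  rw [mem_starts, mem_starts]
  refine and_congr_right fun hq => forall₂_congr fun q' hq' => ?_
  rw [h q hq, h q' hq']

theorem isSpread_starts (hc : Monotone c) {G : Finset ℕ+} (hG : G ⊆ w.support)
    (hinj : Set.InjOn c G) : IsSpread G (starts w c) := by
  choose! π hπ hπle hπc using fun q (hq : q ∈ w.support) => exists_mem_starts hc hq
  refine ⟨π, fun g hg => ⟨hπ g (hG hg), hπle g (hG hg)⟩, fun q hq q' hq' h => ?_⟩
  have h₁ : c q < c q' := lt_of_le_of_ne (hc h.le) fun he => h.ne (hinj hq hq' he)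
  by_contra! hle
  have h₂ := hc hle
  rw [hπc q (hG hq), hπc q' (hG hq')] at h₂
  omega

theorem Norming.node_of_monotoneOn {k : ℕ} (hc : MonotoneOn c (w.support : Set ℕ+))
    (hs : starts w c ∈ 𝓕) (h : ∀ i, Norming 𝓕 t k (w.filter (c · = i))) :
    Norming 𝓕 t (k + 1) (t • w) := by
  obtain ⟨c', hc', heq⟩ := exists_monotone_extension hc
  refine .node hc' (starts_congr heq ▸ hs) fun i => ?_
  convert h i using 1
  ext q
  by_cases hq : q ∈ w.support
  · simp only [Finsupp.filter_apply, heq q hq]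
  · rw [Finsupp.notMem_support_iff] at hq
    simp [Finsupp.filter_apply, hq]

theorem Norming.filter (h𝓕 : Regular 𝓕) {k : ℕ} (h : Norming 𝓕 t k w) (p : ℕ+ → Prop)
    [DecidablePred p] : Norming 𝓕 t k (w.filter p) := by
  induction h with
  | zero k =>
    rw [Finsupp.filter_zero]
    exact .zero k
  | unit k j =>
    by_cases hj : p j
    · rw [Finsupp.filter_single_of_pos _ hj]
      exact .unit k j
    · rw [Finsupp.filter_single_of_neg _ hj]
      exact .zero k
  | @node k w c hc hs h ih =>
    rw [Finsupp.filter_smul]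
    refine .node hc (h𝓕 _ hs _ (isSpread_starts hc (fun q hq => ?_) starts_injOn)) fun i => ?_
    · have := (mem_starts.1 hq).1
      rw [Finsupp.support_filter, Finset.mem_filter] at this
      exact this.1
    · convert ih i using 1
      ext q
      simp only [Finsupp.filter_apply]
      split_ifs <;> rfl

theorem pairing_smul (w : ℕ+ →₀ ℝ≥0) (x : ℕ+ →₀ ℝ) : pairing (t • w) x = t * pairing w x := by
  rw [pairing, pairing, Finsupp.sum_smul_index (fun i => by simp), Finsupp.sum, Finsupp.sum,
    Finset.mul_sum]
  exact Finset.sum_congr rfl fun j _ => by push_cast; ring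

theorem pairing_add (w w' : ℕ+ →₀ ℝ≥0) (x : ℕ+ →₀ ℝ) :
    pairing (w + w') x = pairing w x + pairing w' x :=
  Finsupp.sum_add_index' (fun i => by simp) fun i a b => by push_cast; ring

theorem pairing_sum {ι : Type*} (s : Finset ι) (w : ι → ℕ+ →₀ ℝ≥0) (x : ℕ+ →₀ ℝ) :
    pairing (∑ i ∈ s, w i) x = ∑ i ∈ s, pairing (w i) x := by
  classical
  induction s using Finset.induction_on with
  | empty => simp [pairing]
  | insert i s hi ih => rw [Finset.sum_insert hi, Finset.sum_insert hi, pairing_add, ih]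

theorem pairing_eq_sum (w : ℕ+ →₀ ℝ≥0) (x : ℕ+ →₀ ℝ) :
    pairing w x = ∑ j ∈ w.support, (w j : ℝ≥0∞) * ‖x j‖ₑ := rfl

theorem pairing_single (j : ℕ+) (x : ℕ+ →₀ ℝ) : pairing (Finsupp.single j 1) x = ‖x j‖ₑ := by
  rw [pairing, Finsupp.sum_single_index (by simp)]
  simp

theorem pairing_filter (w : ℕ+ →₀ ℝ≥0) (x : ℕ+ →₀ ℝ) (p : ℕ+ → Prop) [DecidablePred p] :
    pairing (w.filter p) x = ∑ j ∈ w.support.filter p, (w j : ℝ≥0∞) * ‖x j‖ₑ := by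
  rw [pairing_eq_sum, Finsupp.support_filter]
  exact Finset.sum_congr rfl fun j hj => by
    rw [Finsupp.filter_apply_pos _ _ (Finset.mem_filter.1 hj).2]

theorem pairing_eq_sum_filter (w : ℕ+ →₀ ℝ≥0) (x : ℕ+ →₀ ℝ) (c : ℕ+ → ℕ) :
    pairing w x = ∑ i ∈ w.support.image c, pairing (w.filter (c · = i)) x := by
  simp only [pairing_filter]
  rw [Finset.sum_fiberwise_of_maps_to fun j hj => Finset.mem_image_of_mem c hj]
  rfl

theorem pairing_filter_restrictTo (w : ℕ+ →₀ ℝ≥0) (x : ℕ+ →₀ ℝ) (E : Finset ℕ+) :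
    pairing (w.filter (· ∈ E)) x = pairing w (restrictTo E x) := by
  rw [pairing_filter, Finset.sum_filter, pairing_eq_sum]
  refine Finset.sum_congr rfl fun j _ => ?_
  rw [restrictTo_apply]
  split_ifs <;> simp

theorem enorm_le_tsirelsonENorm (𝓕 : Set (Finset ℕ+)) (θ : ℝ) (x : ℕ+ →₀ ℝ) (j : ℕ+) :
    ‖x j‖ₑ ≤ tsirelsonENorm 𝓕 θ x :=
  (le_iSup (fun j => ‖x j‖ₑ) j).trans (le_iSup (fun n => tsirelsonIter 𝓕 θ n x) 0)

theorem mul_sum_le_tsirelsonENorm (𝓕 : Set (Finset ℕ+)) (θ : ℝ) (x : ℕ+ →₀ ℝ) {k : ℕ}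
    {E : Fin k → Finset ℕ+} (hE : IsAdmissible 𝓕 E) :
    ENNReal.ofReal θ * ∑ i, tsirelsonENorm 𝓕 θ (restrictTo (E i) x) ≤ tsirelsonENorm 𝓕 θ x := by
  conv_rhs => rw [tsirelsonENorm_eq]
  refine le_max_of_le_right ?_
  gcongr
  exact le_iSup_of_le k (le_iSup_of_le E (le_iSup_of_le hE le_rfl))

theorem Norming.pairing_le {θ : ℝ} {k : ℕ} (h : Norming 𝓕 θ.toNNReal k w) (x : ℕ+ →₀ ℝ) :
    pairing w x ≤ tsirelsonENorm 𝓕 θ x := by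
  classical
  induction h generalizing x with
  | zero k => simp [pairing]
  | unit k j =>
    rw [pairing_single]
    exact enorm_le_tsirelsonENorm 𝓕 θ x j
  | @node k w c hc hs h ih =>
    set I := w.support.image c with hI
    set e := I.orderIsoOfFin rfl with he
    set E : Fin I.card → Finset ℕ+ := fun l => w.support.filter fun q => c q = e l with hE
    have hne : ∀ l, (E l).Nonempty := fun l => by
      obtain ⟨q, hq, hqc⟩ := Finset.mem_image.1 (e l).2
      exact ⟨q, Finset.mem_filter.2 ⟨hq, hqc⟩⟩
    have hadm : IsAdmissible 𝓕 E := by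
      refine ⟨fun i j hij a ha a' ha' => ?_, fun l => (E l).min' (hne l),
        fun l => Finset.isLeast_min' _ _, ?_⟩
      · rw [Finset.mem_filter] at ha ha'
        have h₁ : (e i : ℕ) < e j := e.strictMono hij
        by_contra! hle
        have := hc hle
        omega
      · convert hs
        ext q
        simp only [Finset.mem_image, Finset.mem_univ, true_and]
        constructor
        · rintro ⟨l, rfl⟩
          have hmem := Finset.mem_filter.1 ((E l).min'_mem (hne l))
          refine mem_starts.2 ⟨hmem.1, fun q' hq' hlt => lt_of_le_of_ne (hc hlt.le) fun heq => ?_⟩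
          exact absurd ((E l).min'_le q' (Finset.mem_filter.2 ⟨hq', heq.trans hmem.2⟩))
            (not_le.2 hlt)
        · intro hq
          have hqs := (mem_starts.1 hq).1
          refine ⟨e.symm ⟨c q, Finset.mem_image_of_mem c hqs⟩, ?_⟩
          have hqE : q ∈ E (e.symm ⟨c q, Finset.mem_image_of_mem c hqs⟩) :=
            Finset.mem_filter.2 ⟨hqs, by simp⟩
          refine le_antisymm (Finset.min'_le _ _ hqE) ?_
          by_contra! hlt
          have hmem := Finset.mem_filter.1
            ((E (e.symm ⟨c q, Finset.mem_image_of_mem c hqs⟩)).min'_mem ⟨q, hqE⟩)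
          have h₁ := lt_of_mem_starts hmem.1 hq hlt
          have h₂ := hmem.2
          simp only [OrderIso.apply_symm_apply] at h₂
          omega
    refine le_trans ?_ (mul_sum_le_tsirelsonENorm 𝓕 θ x hadm)
    rw [pairing_smul, pairing_eq_sum_filter w x c, ← Finset.sum_coe_sort, ← e.toEquiv.sum_comp]
    refine mul_le_mul_right (Finset.sum_le_sum fun l _ => ?_) _
    refine le_of_eq_of_le ?_ (ih (e l) (restrictTo (E l) x))
    rw [← pairing_filter_restrictTo]
    congr 1
    ext q
    simp only [Finsupp.filter_apply, hE, Finset.mem_filter, Finsupp.mem_support_iff]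
    by_cases h₁ : c q = e l <;> by_cases h₂ : w q = 0 <;> simp [h₁, h₂]

theorem sum_le_of_forall_sum_le {ι : Type*} (s : Finset ι) {a : ι → ℝ≥0∞} {W : ι → Set ℝ≥0∞}
    (hW : ∀ i, (W i).Nonempty) (ha : ∀ i, a i ≤ sSup (W i)) {b : ℝ≥0∞}
    (h : ∀ u : ι → ℝ≥0∞, (∀ i, u i ∈ W i) → ∑ i ∈ s, u i ≤ b) : ∑ i ∈ s, a i ≤ b := by
  classical
  have key : ∑ i ∈ s, a i ≤ sSup ((fun u : ι → ℝ≥0∞ => ∑ i ∈ s, u i) '' {u | ∀ i, u i ∈ W i}) := by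
    clear h
    induction s using Finset.induction_on with
    | empty => simp
    | insert i s hi ih =>
      rw [Finset.sum_insert hi]
      refine (add_le_add (ha i) ih).trans ?_
      rw [sSup_eq_iSup, sSup_eq_iSup]
      refine ENNReal.biSup_add_biSup_le' (hW i) ?_ ?_
      · choose u hu using hW
        exact ⟨_, u, hu, rfl⟩
      · rintro v hv _ ⟨u, hu, rfl⟩
        refine le_sSup ⟨Function.update u i v, fun j => ?_, ?_⟩
        · by_cases hj : j = i
          · subst hj
            simpa using hv
          · simpa [hj] using hu j
        · beta_reduce
          rw [Finset.sum_insert hi, Function.update_self]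
          congr 1
          exact Finset.sum_congr rfl fun j hj =>
            Function.update_of_ne (ne_of_mem_of_not_mem hj hi) _ _
  refine key.trans (sSup_le ?_)
  rintro _ ⟨u, hu, rfl⟩
  exact h u hu

theorem tsirelsonIter_le_of_forall_pairing_le (h𝓕 : Regular 𝓕) {θ : ℝ} (n : ℕ) (x : ℕ+ →₀ ℝ)
    {b : ℝ≥0∞} (h : ∀ w, Norming 𝓕 θ.toNNReal n w → pairing w x ≤ b) :
    tsirelsonIter 𝓕 θ n x ≤ b := by
  classical
  have hsup : ∀ n, (∀ w, Norming 𝓕 θ.toNNReal n w → pairing w x ≤ b) → supENorm x ≤ b :=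
    fun n h => iSup_le fun j => pairing_single j x ▸ h _ (.unit n j)
  induction n generalizing x b with
  | zero => exact hsup 0 h
  | succ n ih =>
    refine max_le (hsup _ h) ?_
    simp only [ENNReal.mul_iSup]
    refine iSup_le fun k => iSup_le fun E => iSup_le fun hE => ?_
    obtain ⟨hlt, m, hm, hmF⟩ := hE
    rw [Finset.mul_sum]
    refine sum_le_of_forall_sum_le _
      (W := fun i => {v | ∃ w, Norming 𝓕 θ.toNNReal n w ∧
        v = θ.toNNReal * pairing w (restrictTo (E i) x)})
      (fun i => ⟨_, 0, .zero n, rfl⟩) (fun i => ?_) fun u hu => ?_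
    · have h₁ : tsirelsonIter 𝓕 θ n (restrictTo (E i) x) ≤
          ⨆ w, ⨆ _ : Norming 𝓕 θ.toNNReal n w, pairing w (restrictTo (E i) x) := by
        refine ih _ (fun w hw => le_iSup₂_of_le w hw le_rfl) fun m hm => ?_
        exact iSup_le fun j => pairing_single j (restrictTo (E i) x) ▸ hm _ (.unit m j)
      refine (mul_le_mul_right h₁ _).trans ?_
      simp only [ENNReal.mul_iSup]
      exact iSup₂_le fun w hw => le_sSup ⟨w, hw, rfl⟩
    · choose w hw hu using hu
      set v : Fin k → ℕ+ →₀ ℝ≥0 := fun i => (w i).filter (· ∈ E i) with hv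
      have hdisj : ∀ i, ∀ q ∈ E i, ∀ j, q ∈ E j → i = j := fun i q hi j hj => by
        by_contra hne
        rcases lt_or_gt_of_ne hne with h | h
        · exact lt_irrefl q (hlt i j h q hi q hj)
        · exact lt_irrefl q (hlt j i h q hj q hi)
      set c : ℕ+ → ℕ := fun q => if h : ∃ i, q ∈ E i then (h.choose : ℕ) else 0 with hc
      have hcE : ∀ i, ∀ q ∈ E i, c q = i := fun i q hq => by
        have hex : ∃ i, q ∈ E i := ⟨i, hq⟩
        simp only [hc, hex, dif_pos]
        exact congrArg Fin.val (hdisj _ q hex.choose_spec i hq)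
      have hvE : ∀ i, ∀ q, q ∉ E i → v i q = 0 := fun i q hq => Finsupp.filter_apply_neg _ _ hq
      have hsupp : ∀ q ∈ (∑ i, v i).support, ∃ i, q ∈ E i := by
        intro q hq
        by_contra! hno
        rw [Finsupp.mem_support_iff, Finsupp.finsetSum_apply] at hq
        exact hq (Finset.sum_eq_zero fun i _ => hvE i q (hno i))
      have hnode : Norming 𝓕 θ.toNNReal (n + 1) (θ.toNNReal • ∑ i, v i) := by
        refine Norming.node_of_monotoneOn (c := c) (fun q hq q' hq' hle => ?_)
          (h𝓕 _ hmF _ ⟨fun q => if h : ∃ i, q ∈ E i then m h.choose else q,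
            fun q hq => ?_, fun q hq q' hq' hqq => ?_⟩) fun l => ?_
        · obtain ⟨i, hi⟩ := hsupp q hq
          obtain ⟨j, hj⟩ := hsupp q' hq'
          rw [hcE i q hi, hcE j q' hj]
          by_contra! hlt'
          exact absurd hle (not_le.2 (hlt j i (Fin.lt_def.2 hlt') q' hj q hi))
        · have hex := hsupp q (mem_starts.1 hq).1
          simp only [hex, dif_pos]
          exact ⟨Finset.mem_image_of_mem m (Finset.mem_univ _), (hm _).2 hex.choose_spec⟩
        · have hex := hsupp q (mem_starts.1 hq).1
          have hex' := hsupp q' (mem_starts.1 hq').1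
          have h₁ := lt_of_mem_starts (mem_starts.1 hq).1 hq' hqq
          simp only [hc, hex, hex', dif_pos] at h₁ ⊢
          exact hlt _ _ (Fin.lt_def.2 h₁) _ (hm _).1 _ (hm _).1
        · by_cases hl : l < k
          · convert (hw ⟨l, hl⟩).filter h𝓕 (· ∈ E ⟨l, hl⟩) using 1
            ext q
            by_cases hex : ∃ i, q ∈ E i
            · obtain ⟨i, hi⟩ := hex
              rw [Finsupp.filter_apply, hcE i q hi, Finsupp.finsetSum_apply,
                Finset.sum_eq_single i (fun j _ hj => hvE j q fun h => hj (hdisj j q h i hi))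
                  (by simp)]
              by_cases hil : (i : ℕ) = l
              · obtain rfl : i = ⟨l, hl⟩ := Fin.ext hil
                simp [hv, hi]
              · rw [if_neg hil, Finsupp.filter_apply_neg]
                exact fun h => hil (congrArg Fin.val (hdisj i q hi _ h))
            · push Not at hex
              have h₀ : (∑ i, v i) q = 0 := by
                rw [Finsupp.finsetSum_apply]
                exact Finset.sum_eq_zero fun i _ => hvE i q (hex i)
              rw [Finsupp.filter_apply, h₀, ite_self, Finsupp.filter_apply_neg _ _ (hex _)]
          · convert Norming.zero n using 1
            ext q
            rw [Finsupp.filter_apply]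
            split_ifs with hq
            · by_contra hne
              obtain ⟨i, hi⟩ := hsupp q (Finsupp.mem_support_iff.2 fun h => hne (by rw [h]; rfl))
              rw [hcE i q hi] at hq
              exact hl (hq ▸ i.2)
            · rfl
      refine le_of_eq_of_le ?_ (h _ hnode)
      rw [pairing_smul, pairing_sum, Finset.mul_sum]
      exact Finset.sum_congr rfl fun i _ => by rw [hu i, hv, pairing_filter_restrictTo]

end Norming

section Norming

open scoped NNReal

variable {α : Ordinal.{0} → ℕ+ → Ordinal.{0}} {ξ : Ordinal.{0}} {M : ℕ} {t : ℝ≥0}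
  {w : ℕ+ →₀ ℝ≥0} {c : ℕ+ → ℕ}

/-- A functional supported far to the right is a sum of boundedly many successive functionals
built from small sets. -/
theorem Norming.exists_small_cut (hα : IsApproximating α) (h1 : 1 ≤ ξ)
    (hξ : ξ < Ordinal.omega 1) (hM : 0 < M) (ht : t ≠ 0) {m n : ℕ} (hm : 0 < m)
    (hn : n = 8 * M * m) (hmn : n * blockBound n + 1 ≤ 2 ^ m) {k : ℕ}
    (h : Norming (schreierFamily α ξ) t k w)
    (hL : ∀ q ∈ w.support, blockBound n + M + 2 ≤ (q : ℕ)) :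
    ∃ c : ℕ+ → ℕ, Monotone c ∧ (∀ q, c q < n) ∧
      ∀ i, Norming (smallFamily α ξ M) t k (w.filter (c · = i)) := by
  classical
  have hn0 : 0 < n := by
    rw [hn]
    positivity
  have hreg : Regular (smallFamily α ξ M) := regular_smallFamily
  induction h with
  | zero k => exact ⟨fun _ => 0, monotone_const, fun _ => hn0, fun i => (Norming.zero k).filter hreg _⟩
  | unit k j =>
    exact ⟨fun _ => 0, monotone_const, fun _ => hn0, fun i => (Norming.unit k j).filter hreg _⟩
  | @node k w c hc hs h ih =>
    rw [Finsupp.support_smul_eq ht] at hL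
    choose d hd hdn hdF using fun i => ih i fun q hq => hL q (by
      rw [Finsupp.support_filter, Finset.mem_filter] at hq
      exact hq.1)
    set e : ℕ+ → ℕ := fun q => n * c q + d (c q) q with he
    have hemono : Monotone e := fun q q' hle => by
      rcases (hc hle).eq_or_lt with h | h
      · simp only [he, h]
        exact Nat.add_le_add_left (hd _ hle) _
      · have := hdn (c q) q
        calc n * c q + d (c q) q ≤ n * (c q + 1) := by rw [mul_add_one]; omega
          _ ≤ n * c q' := Nat.mul_le_mul_left _ h
          _ ≤ _ := Nat.le_add_right _ _
    have hediv : ∀ q, e q / n = c q := fun q => by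
      simp only [he]
      rw [Nat.mul_add_div hn0, Nat.div_eq_of_lt (hdn _ _), add_zero]
    have hemod : ∀ q, e q % n = d (c q) q := fun q => by
      simp only [he]
      rw [Nat.mul_add_mod, Nat.mod_eq_of_lt (hdn _ _)]
    set Q := starts w e with hQ
    have hQw : ∀ q ∈ Q, q ∈ w.support := fun q hq => (mem_starts.1 hq).1
    obtain ⟨a, ha, han, haF⟩ := blocks_smallFamily hα h1 hξ hM hn hmn hs hc
      (fun q hq => exists_mem_starts hc (hQw q hq)) (Q := Q) (fun i => by
        rw [← Finset.card_range n]
        refine Finset.card_le_card_of_injOn (d i) (fun q _ => by simpa using hdn i q)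
          fun q hq q' hq' hqq => ?_
        rw [Finset.mem_coe, Finset.mem_filter] at hq hq'
        refine starts_injOn hq.1 hq'.1 ?_
        simp only [he, hq.2, hq'.2, hqq]) fun q hq => hL q (hQw q hq)
    set b : ℕ+ → ℕ := fun q => (Q.filter (· ≤ q)).sup a with hb
    have hbs : ∀ q ∈ w.support, ∀ s ∈ Q, s ≤ q → e s = e q → b q = a s := by
      intro q hq s hs hsq hes
      refine le_antisymm (Finset.sup_le fun s' hs' => ha ?_)
        (Finset.le_sup (f := a) (Finset.mem_filter.2 ⟨hs, hsq⟩))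
      rw [Finset.mem_filter] at hs'
      by_contra! hlt
      have h₁ := lt_of_mem_starts (hQw s hs) hs'.1 hlt
      have h₂ := hemono hs'.2
      omega
    refine ⟨b, fun q q' h => Finset.sup_mono fun s hs => ?_, fun q => ?_, fun v => ?_⟩
    · rw [Finset.mem_filter] at hs ⊢
      exact ⟨hs.1, hs.2.trans h⟩
    · refine (Finset.sup_lt_iff hn0).2 fun s hs => han s (Finset.mem_filter.1 hs).1
    · rw [Finsupp.filter_smul]
      refine .node hemono (hreg.subset (haF v) fun q hq => ?_) fun l => ?_
      · have hq₁ := (mem_starts.1 hq).1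
        rw [Finsupp.support_filter, Finset.mem_filter] at hq₁
        obtain ⟨s, hs, hsq, hes⟩ := exists_mem_starts hemono hq₁.1
        have h₁ := hbs q hq₁.1 s hs hsq hes
        have h₂ := hbs s (hQw s hs) s hs le_rfl rfl
        have hsq' : s = q := by
          by_contra hne
          have h₃ := lt_of_mem_starts (w := w.filter (b · = v)) (q := s) (by
            rw [Finsupp.support_filter, Finset.mem_filter]
            exact ⟨hQw s hs, h₂.trans (h₁.symm.trans hq₁.2)⟩) hq (lt_of_le_of_ne hsq hne)
          omega
        subst hsq'
        exact Finset.mem_filter.2 ⟨hs, h₁.symm.trans hq₁.2⟩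
      · convert (hdF (l / n) (l % n)).filter hreg (b · = v) using 1
        ext q
        simp only [Finsupp.filter_apply]
        by_cases hel : e q = l
        · subst hel
          simp [hediv, hemod]
        · have : ¬ (d (l / n) q = l % n ∧ c q = l / n) := by
            rintro ⟨h₁, h₂⟩
            refine hel ?_
            simp only [he]
            rw [h₂, h₁]
            exact Nat.div_add_mod l n
          rw [if_neg hel]
          split_ifs <;> tauto

theorem Norming.cases_node {𝓕 : Set (Finset ℕ+)} {k : ℕ} (h : Norming 𝓕 t k w) :
    w = 0 ∨ (∃ j, w = Finsupp.single j 1) ∨ ∃ k' u d, k = k' + 1 ∧ w = t • u ∧ Monotone d ∧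
      starts u d ∈ 𝓕 ∧ ∀ i, Norming 𝓕 t k' (u.filter (d · = i)) := by
  cases h with
  | zero => exact .inl rfl
  | unit _ j => exact .inr (.inl ⟨j, rfl⟩)
  | @node k u d hd hs h => exact .inr (.inr ⟨k, u, d, rfl, rfl, hd, hs, h⟩)

theorem isSpread_of_card_filter_le {J G : Finset ℕ+} (hJ : ∀ g ∈ G, ∃ p ∈ J, p ≤ g)
    (hinj : Set.InjOn (fun q => (J.filter (· ≤ q)).card) (G : Set ℕ+)) : IsSpread G J := by
  have hmax : ∀ g ∈ G, ∃ p ∈ J, p ≤ g ∧ ∀ p' ∈ J, p' ≤ g → p' ≤ p := by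
    intro g hg
    obtain ⟨p, hp, hpg⟩ := hJ g hg
    obtain ⟨s, hs, hmax⟩ := Finset.exists_max_image (J.filter (· ≤ g)) id
      ⟨p, Finset.mem_filter.2 ⟨hp, hpg⟩⟩
    rw [Finset.mem_filter] at hs
    exact ⟨s, hs.1, hs.2, fun p' hp' hle => hmax p' (Finset.mem_filter.2 ⟨hp', hle⟩)⟩
  choose! π hπJ hπle hπmax using hmax
  refine ⟨π, fun g hg => ⟨hπJ g hg, hπle g hg⟩, fun g hg g' hg' h => ?_⟩
  obtain ⟨p, hp, hpg⟩ : ∃ p ∈ J.filter (· ≤ g'), p ∉ J.filter (· ≤ g) := by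
    by_contra! hsub
    refine h.ne (hinj hg hg' (congrArg Finset.card (Finset.Subset.antisymm (fun p hp => ?_) hsub)))
    rw [Finset.mem_filter] at hp ⊢
    exact ⟨hp.1, hp.2.trans h.le⟩
  rw [Finset.mem_filter] at hp hpg
  have h₁ : g < p := by
    by_contra! hle
    exact hpg ⟨hp.1, hle⟩
  exact ((hπle g hg).trans_lt h₁).trans_le (hπmax g' hg' p hp.1 hp.2)

/-- The minima of the pieces, and the successors of the pieces which are singletons. -/
def jumps (w : ℕ+ →₀ ℝ≥0) (c : ℕ+ → ℕ) : Finset ℕ+ :=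
  starts w c ∪ ((starts w c).filter fun j =>
    w.filter (c · = c j) = Finsupp.single j 1).image (· + 1)

theorem biUnion_jumps_mem_schreierFamily (hα : IsApproximating α) (h1 : 1 ≤ ξ)
    (hξ : ξ < Ordinal.omega 1) {n : ℕ} (hM : M = blockBound (4 * n) * (4 * n + 1)) {q : ℕ+}
    (hq : blockBound (4 * n) + 2 ≤ (q : ℕ)) (hMq : 1 + M ≤ (q : ℕ)) (w : Fin n → ℕ+ →₀ ℝ≥0)
    (c : Fin n → ℕ+ → ℕ) (x : Fin n → ℕ+) (hwq : ∀ i, ∀ p ∈ (w i).support, q ≤ p)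
    (hS : ∀ i, IsSmall α ξ M q ((starts (w i) (c i)).erase (x i))) :
    (Finset.univ.biUnion fun i => jumps (w i) (c i)) ∈ schreierFamily α ξ := by
  classical
  have hone : ∀ F : Finset ℕ+, F.card ≤ 1 → (∀ k ∈ F, q ≤ k) → IsSmall α ξ M q F :=
    fun F hF hFq => isSmall_of_card_le hα h1 hξ hFq hMq
      ((Nat.mul_le_mul_left M hF).trans (by omega)) (hF.trans q.pos)
  have hSq : ∀ i, ∀ k ∈ starts (w i) (c i), q ≤ k := fun i k hk => hwq i k (mem_starts.1 hk).1
  have hsucc : ∀ F : Finset ℕ+, IsSpread (F.image (· + 1)) F := by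
    intro F
    refine ⟨fun k => k - 1, fun g hg => ?_, fun g hg g' hg' h => ?_⟩
    · obtain ⟨k, hk, rfl⟩ := Finset.mem_image.1 hg
      have h₁ : k + 1 - 1 = k := PNat.add_sub
      beta_reduce
      rw [h₁]
      exact ⟨hk, (PNat.lt_add_right k 1).le⟩
    · obtain ⟨k, hk, rfl⟩ := Finset.mem_image.1 hg
      obtain ⟨k', hk', rfl⟩ := Finset.mem_image.1 hg'
      have h₁ : k + 1 - 1 = k := PNat.add_sub
      have h₂ : k' + 1 - 1 = k' := PNat.add_sub
      beta_reduce at h ⊢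
      rw [h₁, h₂]
      exact lt_of_add_lt_add_right h
  have hsmall : ∀ F : Finset ℕ+, IsSmall α ξ M q F → IsSmall α ξ M q (F.image (· + 1)) :=
    fun F hF => hF.spread (hsucc F) le_rfl fun k hk => by
      obtain ⟨k', hk', rfl⟩ := Finset.mem_image.1 hk
      exact (hF.1 k' hk').trans (PNat.lt_add_right k' 1).le
  set U : Fin n → Finset ℕ+ := fun i => (starts (w i) (c i)).filter fun j =>
    (w i).filter (c i · = c i j) = Finsupp.single j 1 with hU
  have hUS : ∀ i, U i ⊆ starts (w i) (c i) := fun i => Finset.filter_subset _ _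
  set G : Fin 4 → Fin n → Finset ℕ+ := ![fun i => (starts (w i) (c i)).erase (x i),
    fun i => starts (w i) (c i) ∩ {x i}, fun i => ((U i).erase (x i)).image (· + 1),
    fun i => (U i ∩ {x i}).image (· + 1)] with hG
  have hcard : ∀ (F : Finset ℕ+) (y : ℕ+), (F ∩ {y}).card ≤ 1 := fun F y =>
    (Finset.card_le_card Finset.inter_subset_right).trans (by simp)
  have hGsmall : ∀ a i, IsSmall α ξ M q (G a i) := by
    intro a i
    fin_cases a
    · exact hS i
    · exact hone _ (hcard _ _) fun k hk => hSq i k (Finset.mem_inter.1 hk).1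
    · exact hsmall _ ((hS i).subset (Finset.erase_subset_erase _ (hUS i)))
    · exact hsmall _ (hone _ (hcard _ _) fun k hk => hSq i k (hUS i (Finset.mem_inter.1 hk).1))
  have key := biUnion_mem_schreierFamily hα hξ hM hq (by omega)
    (fun l => G (finProdFinEquiv.symm l).1 (finProdFinEquiv.symm l).2) fun l => hGsmall _ _
  refine (regular_schreierFamily ξ).subset key fun k hk => ?_
  obtain ⟨i, -, hi⟩ := Finset.mem_biUnion.1 hk
  have hmem : ∀ a, k ∈ G a i → k ∈ Finset.univ.biUnion
      fun l => G (finProdFinEquiv.symm l).1 (finProdFinEquiv.symm l).2 := fun a h =>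
    Finset.mem_biUnion.2 ⟨finProdFinEquiv (a, i), Finset.mem_univ _, by
      rw [Equiv.symm_apply_apply]
      exact h⟩
  rcases Finset.mem_union.1 hi with h | h
  · by_cases hx : k = x i
    · exact hmem 1 (Finset.mem_inter.2 ⟨h, Finset.mem_singleton.2 hx⟩)
    · exact hmem 0 (Finset.mem_erase.2 ⟨hx, h⟩)
  · obtain ⟨j, hj, rfl⟩ := Finset.mem_image.1 h
    by_cases hx : j = x i
    · exact hmem 3 (Finset.mem_image_of_mem _ (Finset.mem_inter.2 ⟨hj, Finset.mem_singleton.2 hx⟩))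
    · exact hmem 2 (Finset.mem_image_of_mem _ (Finset.mem_erase.2 ⟨hx, hj⟩))

end Norming

section Norming

open scoped NNReal

variable {α : Ordinal.{0} → ℕ+ → Ordinal.{0}} {ξ : Ordinal.{0}} {M : ℕ} {t : ℝ≥0}

/-- The piece of a layer between two consecutive jumps `p` is empty, or is a node with few pieces. -/
theorem exists_next_layer (ht : t ≠ 0) {k : ℕ} {p : ℕ+} {w : ℕ+ →₀ ℝ≥0}
    {c C : ℕ+ → ℕ} (hc : Monotone c) (hC : Monotone C) {v : ℕ}
    (hF : ∀ l, Norming (smallFamily α ξ M) t k (w.filter (c · = l)))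
    (hp : ∀ r, C r = v → p ≤ r)
    (hstart : ∀ r ∈ w.support, C r = v → ∀ s ∈ starts w c, s ≤ r → s ≤ p)
    (hunit : ∀ r ∈ w.support, C r = v → ∀ j, w.filter (c · = c r) ≠ Finsupp.single j 1) :
    w.filter (C · = v) = 0 ∨ ∃ k' w' d x', k = k' + 1 ∧ w.filter (C · = v) = t • w' ∧ Monotone d ∧
      (∀ l, Norming (smallFamily α ξ M) t k' (w'.filter (d · = l))) ∧
      IsSmall α ξ M p ((starts w' d).erase x') := by
  classical
  have hreg : Regular (smallFamily α ξ M) := regular_smallFamily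
  by_cases hne : ∃ r ∈ w.support, C r = v
  swap
  · left
    push Not at hne
    ext r
    rw [Finsupp.filter_apply]
    split_ifs with h
    · by_contra h0
      exact hne r (Finsupp.mem_support_iff.2 fun h => h0 (by rw [h]; rfl)) h
    · rfl
  right
  obtain ⟨r, hr, hrv⟩ := hne
  obtain ⟨s, hs, hsr, hcs⟩ := exists_mem_starts hc hr
  have hsp := hstart r hr hrv s hs hsr
  have hconst : ∀ r' ∈ w.support, C r' = v → c r' = c r := by
    have : ∀ r₁ ∈ w.support, ∀ r₂ ∈ w.support, C r₁ = v → C r₂ = v → c r₁ ≤ c r₂ := by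
      intro r₁ h₁ r₂ h₂ hv₁ hv₂
      obtain ⟨s₁, hs₁, hsr₁, hcs₁⟩ := exists_mem_starts hc h₁
      rw [← hcs₁]
      exact hc ((hstart r₁ h₁ hv₁ s₁ hs₁ hsr₁).trans (hp r₂ hv₂))
    exact fun r' hr' hv => le_antisymm (this r' hr' r hr hv hrv) (this r hr r' hr' hrv hv)
  have hfilter : w.filter (C · = v) = (w.filter (c · = c r)).filter (C · = v) := by
    ext r'
    simp only [Finsupp.filter_apply]
    by_cases hr' : r' ∈ w.support
    · by_cases hv : C r' = v
      · rw [if_pos hv, if_pos hv, if_pos (hconst r' hr' hv)]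
      · rw [if_neg hv, if_neg hv]
    · rw [Finsupp.notMem_support_iff.1 hr']
      simp
  have hrmem : r ∈ (w.filter (c · = c r)).support := by
    rw [Finsupp.support_filter, Finset.mem_filter]
    exact ⟨hr, rfl⟩
  have hsmem : s ∈ (w.filter (c · = c r)).support := by
    rw [Finsupp.support_filter, Finset.mem_filter]
    exact ⟨(mem_starts.1 hs).1, hcs⟩
  rcases (hF (c r)).cases_node with h0 | ⟨j, hj⟩ | ⟨k', u, d, rfl, hu, hd, hdS, hdF⟩
  · rw [h0] at hrmem
    simp at hrmem
  · exact absurd hj (hunit r hr hrv j)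
  rw [hu, Finsupp.support_smul_eq ht] at hrmem hsmem
  have hne' : (u.filter (C · = v)).support.Nonempty := by
    refine ⟨r, ?_⟩
    rw [Finsupp.support_filter, Finset.mem_filter]
    exact ⟨hrmem, hrv⟩
  obtain ⟨x', hx', hxmin⟩ := Finset.exists_min_image _ id hne'
  have hx'' := hx'
  rw [Finsupp.support_filter, Finset.mem_filter] at hx''
  refine ⟨k', u.filter (C · = v), d, x', rfl, by rw [hfilter, hu, Finsupp.filter_smul], hd,
    fun l => ?_, ?_⟩
  · convert (hdF l).filter hreg (C · = v) using 1
    ext r'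
    simp only [Finsupp.filter_apply]
    split_ifs <;> rfl
  · obtain ⟨s', hs', hs's, -⟩ := exists_mem_starts hd hsmem
    obtain ⟨q', hq'u, hq'min⟩ := Finset.exists_min_image (starts u d) id ⟨s', hs'⟩
    refine (hdS q' hq'u hq'min).spread (.of_subset fun g hg => ?_)
      ((hq'min s' hs').trans (hs's.trans hsp)) fun g hg => ?_
    · rw [Finset.mem_erase] at hg
      have hgu := (mem_starts.1 hg.2).1
      have hxg : x' < g := lt_of_le_of_ne (hxmin g hgu) (Ne.symm hg.1)
      have hdx := lt_of_mem_starts hx' hg.2 hxg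
      have hgu' := hgu
      rw [Finsupp.support_filter, Finset.mem_filter] at hgu
      refine mem_starts.2 ⟨hgu.1, fun r' hr' hlt => ?_⟩
      rcases le_or_gt r' x' with h | h
      · exact (hd h).trans_lt hdx
      · refine lt_of_mem_starts ?_ hg.2 hlt
        rw [Finsupp.support_filter, Finset.mem_filter]
        refine ⟨hr', le_antisymm (hgu.2 ▸ hC hlt.le) (hx''.2 ▸ hC h.le)⟩
    · have hgu := (mem_starts.1 (Finset.mem_erase.1 hg).2).1
      rw [Finsupp.support_filter, Finset.mem_filter] at hgu
      exact hp g hgu.2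

/-- Sums of disjoint functionals built from few small pieces belong to the norming set. -/
theorem norming_sum_of_layers (hα : IsApproximating α) (h1 : 1 ≤ ξ) (hξ : ξ < Ordinal.omega 1)
    {n : ℕ} (hM : M = blockBound (4 * n) * (4 * n + 1)) (ht : t ≠ 0) {k : ℕ} {q : ℕ+}
    (hq : blockBound (4 * n) + 2 ≤ (q : ℕ)) (hMq : 1 + M ≤ (q : ℕ)) (w : Fin n → ℕ+ →₀ ℝ≥0)
    (c : Fin n → ℕ+ → ℕ) (x : Fin n → ℕ+) (hdisj : ∀ i j, i ≠ j → ∀ r, w i r ≠ 0 → w j r = 0)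
    (hwq : ∀ i, ∀ p ∈ (w i).support, q ≤ p) (hc : ∀ i, Monotone (c i))
    (hF : ∀ i l, Norming (smallFamily α ξ M) t k ((w i).filter (c i · = l)))
    (hS : ∀ i, IsSmall α ξ M q ((starts (w i) (c i)).erase (x i))) :
    Norming (schreierFamily α ξ) t (k + 1) (t • ∑ i, w i) := by
  classical
  induction k using Nat.strong_induction_on generalizing q w c x with
  | _ k ih =>
  set J := Finset.univ.biUnion fun i => jumps (w i) (c i) with hJ
  have hJS : J ∈ schreierFamily α ξ :=
    biUnion_jumps_mem_schreierFamily hα h1 hξ hM hq hMq w c x hwq hS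
  have hstartJ : ∀ i, ∀ s ∈ starts (w i) (c i), s ∈ J := fun i s hs =>
    Finset.mem_biUnion.2 ⟨i, Finset.mem_univ i, Finset.mem_union_left _ hs⟩
  have hJq : ∀ p ∈ J, q ≤ p := by
    intro p hp
    obtain ⟨i, -, hi⟩ := Finset.mem_biUnion.1 hp
    rcases Finset.mem_union.1 hi with h | h
    · exact hwq i p (mem_starts.1 h).1
    · obtain ⟨j, hj, rfl⟩ := Finset.mem_image.1 h
      exact (hwq i j (mem_starts.1 (Finset.mem_filter.1 hj).1).1).trans (PNat.lt_add_right j 1).le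
  set C : ℕ+ → ℕ := fun r => (J.filter (· ≤ r)).card with hC
  have hCmono : Monotone C := fun r r' h => Finset.card_le_card fun p hp => by
    rw [Finset.mem_filter] at hp ⊢
    exact ⟨hp.1, hp.2.trans h⟩
  have hK : ∀ r r', C r = C r' → ∀ j ∈ J, j ≤ r → j ≤ r' := by
    intro r r' h j hj hjr
    rcases le_total r r' with hle | hle
    · exact hjr.trans hle
    · have hsub : J.filter (· ≤ r') ⊆ J.filter (· ≤ r) := fun p hp => by
        rw [Finset.mem_filter] at hp ⊢
        exact ⟨hp.1, hp.2.trans hle⟩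
      have heq := Finset.eq_of_subset_of_card_le hsub h.le
      have : j ∈ J.filter (· ≤ r') := heq ▸ Finset.mem_filter.2 ⟨hj, hjr⟩
      exact (Finset.mem_filter.1 this).2
  have hsupp : ∀ r ∈ (∑ i, w i).support, ∃ i, r ∈ (w i).support := by
    intro r hr
    by_contra! hno
    rw [Finsupp.mem_support_iff, Finsupp.finsetSum_apply] at hr
    exact hr (Finset.sum_eq_zero fun i _ => Finsupp.notMem_support_iff.1 (hno i))
  refine .node hCmono (regular_schreierFamily ξ _ hJS _ (isSpread_of_card_filter_le
    (fun r hr => ?_) starts_injOn)) fun v => ?_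
  · obtain ⟨i, hi⟩ := hsupp r (mem_starts.1 hr).1
    obtain ⟨s, hs, hsr, -⟩ := exists_mem_starts (hc i) hi
    exact ⟨s, hstartJ i s hs, hsr⟩
  · have hsum : (∑ i, w i).filter (C · = v) = ∑ i, (w i).filter (C · = v) := by
      ext r
      simp only [Finsupp.filter_apply, Finsupp.finsetSum_apply]
      split_ifs <;> simp
    by_cases hunit : ∃ i, ∃ r ∈ (w i).support, C r = v ∧
        ∃ j, (w i).filter (c i · = c i r) = Finsupp.single j 1
    · obtain ⟨i, r, hr, hrv, j, hj⟩ := hunit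
      have hrj : r = j := by
        have : r ∈ ((w i).filter (c i · = c i r)).support := by
          rw [Finsupp.support_filter, Finset.mem_filter]
          exact ⟨hr, rfl⟩
        rw [hj] at this
        simpa using Finsupp.support_single_subset this
      subst hrj
      have hwr : w i r = 1 := by
        have := DFunLike.congr_fun hj r
        rwa [Finsupp.filter_apply, if_pos rfl, Finsupp.single_eq_same] at this
      have hrs : r ∈ starts (w i) (c i) := by
        obtain ⟨s, hs, hsr, hcs⟩ := exists_mem_starts (hc i) hr
        have : s ∈ ((w i).filter (c i · = c i r)).support := by
          rw [Finsupp.support_filter, Finset.mem_filter]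
          exact ⟨(mem_starts.1 hs).1, hcs⟩
        rw [hj] at this
        have hsr' : s = r := by simpa using Finsupp.support_single_subset this
        exact hsr' ▸ hs
      have hr1 : r + 1 ∈ J := Finset.mem_biUnion.2 ⟨i, Finset.mem_univ i,
        Finset.mem_union_right _ (Finset.mem_image_of_mem _ (Finset.mem_filter.2 ⟨hrs, hj⟩))⟩
      have honly : ∀ r', C r' = v → r' = r := by
        intro r' hr'
        refine le_antisymm ?_ (hK r r' (hrv.trans hr'.symm) r (hstartJ i r hrs) le_rfl)
        by_contra! hlt
        have := hK r' r (hr'.trans hrv.symm) _ hr1 (PNat.add_one_le_iff.2 hlt)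
        exact absurd this (not_le.2 (PNat.lt_add_right r 1))
      convert Norming.unit k r using 1
      ext r'
      rw [Finsupp.filter_apply]
      by_cases hr' : r' = r
      · subst hr'
        rw [if_pos hrv, Finsupp.finsetSum_apply, Finsupp.single_eq_same,
          Finset.sum_eq_single i (fun l _ hl => hdisj i l hl.symm r' (by rw [hwr]; exact one_ne_zero))
            (by simp), hwr]
      · rw [if_neg fun h => hr' (honly r' h), Finsupp.single_eq_of_ne hr']
    push Not at hunit
    by_cases hne : ∃ r, C r = v ∧ r ∈ (∑ i, w i).support
    swap
    · push Not at hne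
      convert Norming.zero k using 1
      ext r
      rw [Finsupp.filter_apply]
      split_ifs with h
      · rw [Finsupp.notMem_support_iff.1 (hne r h)]
        rfl
      · rfl
    obtain ⟨r, hrv, hr⟩ := hne
    obtain ⟨p, hpJ, hpr, hpmax⟩ : ∃ p ∈ J, p ≤ r ∧ ∀ p' ∈ J, p' ≤ r → p' ≤ p := by
      obtain ⟨i, hi⟩ := hsupp r hr
      obtain ⟨s, hs, hsr, -⟩ := exists_mem_starts (hc i) hi
      obtain ⟨p, hp, hmax⟩ := Finset.exists_max_image (J.filter (· ≤ r)) id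
        ⟨s, Finset.mem_filter.2 ⟨hstartJ i s hs, hsr⟩⟩
      rw [Finset.mem_filter] at hp
      exact ⟨p, hp.1, hp.2, fun p' hp' hle => hmax p' (Finset.mem_filter.2 ⟨hp', hle⟩)⟩
    have hlayer := fun i => exists_next_layer ht (hc i) hCmono (hF i)
      (fun r' hr' => hK r r' (hrv.trans hr'.symm) p hpJ hpr)
      (fun r' hr' hv s hs hsr => hpmax s (hstartJ i s hs)
        (hK r' r (hv.trans hrv.symm) s (hstartJ i s hs) hsr)) (hunit i)
    obtain ⟨i₀, hi₀⟩ := hsupp r hr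
    obtain ⟨k', rfl⟩ : ∃ k', k = k' + 1 := by
      rcases hlayer i₀ with h | ⟨k', _, _, _, rfl, -⟩
      · have := DFunLike.congr_fun h r
        rw [Finsupp.filter_apply, if_pos hrv] at this
        exact absurd this (Finsupp.mem_support_iff.1 hi₀)
      · exact ⟨k', rfl⟩
    have hlayer' : ∀ i, ∃ w' d x', (w i).filter (C · = v) = t • w' ∧ Monotone d ∧
        (∀ l, Norming (smallFamily α ξ M) t k' (w'.filter (d · = l))) ∧
        IsSmall α ξ M p ((starts w' d).erase x') := by
      intro i
      rcases hlayer i with h | ⟨_, w', d, x', hk, h⟩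
      · refine ⟨0, fun _ => 0, 1, by rw [h, smul_zero], monotone_const, fun l => ?_, ?_⟩
        · rw [Finsupp.filter_zero]
          exact .zero k'
        · refine (hS i).spread (.of_subset ?_) (hJq p hpJ) ?_ <;> simp [starts]
      · obtain rfl := Nat.succ_injective hk
        exact ⟨w', d, x', h⟩
    choose w' d x' hw' hd hdF hdS using hlayer'
    have hsub : ∀ i r', w' i r' ≠ 0 → w i r' ≠ 0 ∧ C r' = v := by
      intro i r' h
      have h₁ : (t • w' i) r' ≠ 0 := by
        rw [Finsupp.smul_apply, smul_eq_mul]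
        exact mul_ne_zero ht h
      rw [← hw' i, Finsupp.filter_apply] at h₁
      split_ifs at h₁ with h₂
      · exact ⟨h₁, h₂⟩
      · exact absurd rfl h₁
    rw [hsum, Finset.sum_congr rfl fun i _ => hw' i, ← Finset.smul_sum]
    have hqp : (q : ℕ) ≤ p := hJq p hpJ
    refine ih k' (Nat.lt_succ_self k') (hq.trans hqp) (hMq.trans hqp) w' d x'
      (fun i j hij r' h => ?_) (fun i r' hr' => ?_) hd hdF hdS
    · by_contra h'
      exact (hsub j r' h').1 (hdisj i j hij r' (hsub i r' h).1)
    · exact hK r r' (hrv.trans (hsub i r' (Finsupp.mem_support_iff.1 hr')).2.symm) p hpJ hpr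

/-- In `T[𝓢_ξ, θ]`, boundedly many disjointly supported vectors which are supported far to the
right dominate the unit vector basis of `ℓ₁` with constant `θ`. -/
theorem exists_lower_estimate (n : ℕ) : ∃ L : ℕ, ∀ α, IsApproximating α → ∀ ξ, 1 ≤ ξ →
    ξ < Ordinal.omega 1 → ∀ θ : ℝ, 0 < θ → ∀ x : Fin n → ℕ+ →₀ ℝ,
    (∀ i j, i ≠ j → ∀ r, x i r ≠ 0 → x j r = 0) → (∀ i, ∀ r ∈ (x i).support, L ≤ (r : ℕ)) →
    ENNReal.ofReal θ * ∑ i, tsirelsonENorm (schreierFamily α ξ) θ (x i) ≤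
      tsirelsonENorm (schreierFamily α ξ) θ (∑ i, x i) := by
  classical
  obtain ⟨M, hM⟩ : ∃ M, M = blockBound (4 * n) * (4 * n + 1) := ⟨_, rfl⟩
  have hM0 : 0 < M := by
    rw [hM, blockBound]
    positivity
  obtain ⟨m, hm, hmn⟩ := exists_mul_blockBound_le_two_pow M
  obtain ⟨N, hN⟩ : ∃ N, N = 8 * M * m := ⟨_, rfl⟩
  rw [← hN] at hmn
  obtain ⟨L, hL⟩ : ∃ L, L = blockBound (4 * n) + blockBound N + M + 2 + M * N + N := ⟨_, rfl⟩
  refine ⟨L, fun α hα ξ h1 hξ θ hθ x hdisj hxL => ?_⟩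
  have hreg := regular_schreierFamily (α := α) ξ
  have ht : θ.toNNReal ≠ 0 := (Real.toNNReal_pos.2 hθ).ne'
  simp only [tsirelsonENorm]
  rw [ENNReal.finsetSum_iSup_of_monotone (fun i => tsirelsonIter_mono _ θ _), ENNReal.mul_iSup]
  refine iSup_le fun k => ?_
  rw [Finset.mul_sum]
  refine sum_le_of_forall_sum_le _
    (W := fun i => {v | ∃ w, Norming (schreierFamily α ξ) θ.toNNReal k w ∧
      v = θ.toNNReal * pairing w (x i)}) (fun i => ⟨_, 0, .zero k, rfl⟩) (fun i => ?_) fun u hu => ?_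
  · have h₁ : tsirelsonIter (schreierFamily α ξ) θ k (x i) ≤
        ⨆ w, ⨆ _ : Norming (schreierFamily α ξ) θ.toNNReal k w, pairing w (x i) :=
      tsirelsonIter_le_of_forall_pairing_le hreg k (x i) fun w hw => le_iSup₂_of_le w hw le_rfl
    refine (mul_le_mul_right h₁ _).trans ?_
    simp only [ENNReal.mul_iSup]
    exact iSup₂_le fun w hw => le_sSup ⟨w, hw, rfl⟩
  choose w hw hu using hu
  set v : Fin n → ℕ+ →₀ ℝ≥0 := fun i => (w i).filter (· ∈ (x i).support) with hv
  have hvx : ∀ i, ∀ r ∈ (v i).support, r ∈ (x i).support := fun i r hr => by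
    rw [hv, Finsupp.support_filter, Finset.mem_filter] at hr
    exact hr.2
  have hvN : ∀ i, Norming (schreierFamily α ξ) θ.toNNReal k (v i) := fun i => (hw i).filter hreg _
  set q : ℕ+ := ⟨L, by omega⟩ with hq
  have hqL : (q : ℕ) = L := rfl
  choose c hc hcN hcF using fun i => (hvN i).exists_small_cut hα h1 hξ hM0 ht hm hN hmn
    fun r hr => by
      have := hxL i r (hvx i r hr)
      omega
  have hvq : ∀ i, ∀ r ∈ (v i).support, q ≤ r := fun i r hr => hxL i r (hvx i r hr)
  have hcard : ∀ i, ((starts (v i) (c i)).erase 1).card ≤ N := by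
    intro i
    rw [← Finset.card_range N]
    exact Finset.card_le_card_of_injOn (c i) (fun r _ => by simpa using hcN i r)
      (starts_injOn.mono fun r hr => Finset.mem_of_mem_erase hr)
  have key := norming_sum_of_layers hα h1 hξ hM ht (q := q) (by omega) (by omega) v c
    (fun _ => 1) (fun i j hij r hr => ?_) hvq hc hcF fun i => ?_
  · refine le_of_eq_of_le ?_ (key.pairing_le (∑ i, x i))
    rw [pairing_smul, pairing_sum, Finset.mul_sum]
    refine Finset.sum_congr rfl fun i _ => ?_
    rw [hu i, hv, pairing_filter]
    congr 1
    rw [pairing_eq_sum, Finset.sum_filter]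
    refine Finset.sum_congr rfl fun r _ => ?_
    split_ifs with hr
    · rw [Finsupp.finsetSum_apply, Finset.sum_eq_single i
        (fun j _ hj => hdisj i j hj.symm r (Finsupp.mem_support_iff.1 hr)) (by simp)]
    · rw [Finsupp.notMem_support_iff.1 hr]
      simp
  · by_contra h
    exact Finsupp.mem_support_iff.1 (hvx j r (Finsupp.mem_support_iff.2 h))
      (hdisj i j hij r (Finsupp.mem_support_iff.1 (hvx i r (Finsupp.mem_support_iff.2 hr))))
  · refine isSmall_of_card_le hα h1 hξ
      (fun r hr => hvq i r (mem_starts.1 (Finset.mem_of_mem_erase hr)).1) (by omega) ?_ ?_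
    · have := Nat.mul_le_mul_left M (hcard i)
      omega
    · have := hcard i
      omega

end Norming

/-! ### The unit vector basis of the Tsirelson space -/

section TsirelsonNorm

theorem supENorm_mono {x y : ℕ+ →₀ ℝ} (h : ∀ j, |x j| ≤ |y j|) : supENorm x ≤ supENorm y :=
  iSup_mono fun j => by
    rw [← ofReal_norm, ← ofReal_norm]
    exact ENNReal.ofReal_le_ofReal (h j)

theorem tsirelsonIter_mono_abs (𝓕 : Set (Finset ℕ+)) (θ : ℝ) (n : ℕ) {x y : ℕ+ →₀ ℝ}
    (h : ∀ j, |x j| ≤ |y j|) : tsirelsonIter 𝓕 θ n x ≤ tsirelsonIter 𝓕 θ n y := by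
  induction n generalizing x y with
  | zero => exact supENorm_mono h
  | succ n ih =>
    refine max_le_max (supENorm_mono h) ?_
    gcongr with k E hE i
    refine ih fun j => ?_
    rw [restrictTo_apply, restrictTo_apply]
    split_ifs
    · exact h j
    · exact le_rfl

variable (𝓕 : Set (Finset ℕ+)) (θ : Set.Ioo (0 : ℝ) 1)

/-- The norm of `T[𝓕, θ]` on `c₀₀`, as a real number. -/
def tsirelsonNorm (x : ℕ+ →₀ ℝ) : ℝ := (tsirelsonENorm 𝓕 θ x).toReal

theorem ofReal_tsirelsonNorm (x : ℕ+ →₀ ℝ) :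
    ENNReal.ofReal (tsirelsonNorm 𝓕 θ x) = tsirelsonENorm 𝓕 θ x :=
  ENNReal.ofReal_toReal (tsirelsonENorm_ne_top 𝓕 θ.2.2.le x)

theorem tsirelsonNorm_nonneg (x : ℕ+ →₀ ℝ) : 0 ≤ tsirelsonNorm 𝓕 θ x := ENNReal.toReal_nonneg

theorem tsirelsonNorm_mono {x y : ℕ+ →₀ ℝ} (h : ∀ j, |x j| ≤ |y j|) :
    tsirelsonNorm 𝓕 θ x ≤ tsirelsonNorm 𝓕 θ y :=
  ENNReal.toReal_mono (tsirelsonENorm_ne_top 𝓕 θ.2.2.le y)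
    (iSup_mono fun n => tsirelsonIter_mono_abs 𝓕 θ n h)

theorem abs_le_tsirelsonNorm (x : ℕ+ →₀ ℝ) (j : ℕ+) : |x j| ≤ tsirelsonNorm 𝓕 θ x := by
  have h := ENNReal.toReal_mono (tsirelsonENorm_ne_top 𝓕 θ.2.2.le x)
    (enorm_le_tsirelsonENorm 𝓕 θ x j)
  rwa [toReal_enorm] at h

theorem tsirelsonNorm_smul (c : ℝ) (x : ℕ+ →₀ ℝ) :
    tsirelsonNorm 𝓕 θ (c • x) = |c| * tsirelsonNorm 𝓕 θ x := by
  rw [tsirelsonNorm, tsirelsonENorm_smul, ENNReal.toReal_mul, toReal_enorm]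
  rfl

theorem tsirelsonNorm_sum_le {ι : Type*} (s : Finset ι) (x : ι → ℕ+ →₀ ℝ) :
    tsirelsonNorm 𝓕 θ (∑ i ∈ s, x i) ≤ ∑ i ∈ s, tsirelsonNorm 𝓕 θ (x i) :=
  norm_sum_le (E := PreTsirelson 𝓕 θ) s x

theorem mul_sum_le_tsirelsonNorm {k : ℕ} {E : Fin k → Finset ℕ+} (hE : IsAdmissible 𝓕 E)
    (x : ℕ+ →₀ ℝ) :
    (θ : ℝ) * ∑ i, tsirelsonNorm 𝓕 θ (restrictTo (E i) x) ≤ tsirelsonNorm 𝓕 θ x := by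
  rw [← ENNReal.ofReal_le_ofReal_iff (tsirelsonNorm_nonneg 𝓕 θ x), ENNReal.ofReal_mul θ.2.1.le,
    ENNReal.ofReal_sum_of_nonneg fun i _ => tsirelsonNorm_nonneg 𝓕 θ _]
  simp only [ofReal_tsirelsonNorm]
  exact mul_sum_le_tsirelsonENorm 𝓕 θ x hE

theorem tsirelsonNorm_le {x : ℕ+ →₀ ℝ} {C : ℝ} (hC : 0 ≤ C) (h₁ : ∀ j, |x j| ≤ C)
    (h₂ : ∀ (k : ℕ) (E : Fin k → Finset ℕ+), IsAdmissible 𝓕 E →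
      (θ : ℝ) * ∑ i, tsirelsonNorm 𝓕 θ (restrictTo (E i) x) ≤ C) : tsirelsonNorm 𝓕 θ x ≤ C := by
  refine ENNReal.toReal_le_of_le_ofReal hC ?_
  rw [tsirelsonENorm_eq]
  refine max_le (iSup_le fun j => ?_) ?_
  · rw [← ofReal_norm]
    exact ENNReal.ofReal_le_ofReal (h₁ j)
  · simp only [ENNReal.mul_iSup]
    refine iSup_le fun k => iSup_le fun E => iSup_le fun hE => ?_
    have h := ENNReal.ofReal_le_ofReal (h₂ k E hE)
    rw [ENNReal.ofReal_mul θ.2.1.le,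
      ENNReal.ofReal_sum_of_nonneg fun i _ => tsirelsonNorm_nonneg 𝓕 θ _] at h
    simpa only [ofReal_tsirelsonNorm] using h

theorem tsirelsonNorm_single (j : ℕ+) : tsirelsonNorm 𝓕 θ (Finsupp.single j 1) = 1 := by
  refine le_antisymm (ENNReal.toReal_le_of_le_ofReal zero_le_one ?_) ?_
  · refine iSup_le fun n => (tsirelsonIter_le_tsum 𝓕 θ.2.2.le n _).trans ?_
    rw [tsum_eq_single j fun i hi => by rw [Finsupp.single_eq_of_ne hi]; simp]
    simp
  · have := abs_le_tsirelsonNorm 𝓕 θ (Finsupp.single j 1) j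
    simpa using this

end TsirelsonNorm

section TsirelsonBasis

variable (𝓕 : Set (Finset ℕ+)) (θ : Set.Ioo (0 : ℝ) 1)

/-- The embedding of `c₀₀` into `T[𝓕, θ]`. -/
def ofFinsupp : (ℕ+ →₀ ℝ) →ₗ[ℝ] TsirelsonSpace 𝓕 θ where
  toFun x := UniformSpace.Completion.coe' (α := PreTsirelson 𝓕 θ) x
  map_add' x y := UniformSpace.Completion.coe_add (α := PreTsirelson 𝓕 θ) x y
  map_smul' c x := UniformSpace.Completion.coe_smul (X := PreTsirelson 𝓕 θ) c x

theorem norm_ofFinsupp (x : ℕ+ →₀ ℝ) : ‖ofFinsupp 𝓕 θ x‖ = tsirelsonNorm 𝓕 θ x :=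
  UniformSpace.Completion.norm_coe (E := PreTsirelson 𝓕 θ) x

theorem denseRange_ofFinsupp : DenseRange (ofFinsupp 𝓕 θ) :=
  UniformSpace.Completion.denseRange_coe (α := PreTsirelson 𝓕 θ)

theorem ofFinsupp_single (j : ℕ+) (c : ℝ) :
    ofFinsupp 𝓕 θ (Finsupp.single j c) = c • tsirelsonUnit 𝓕 θ j := by
  have : (Finsupp.single j c : ℕ+ →₀ ℝ) = c • Finsupp.single j 1 := by simp
  rw [this, map_smul]
  rfl

theorem ofFinsupp_eq_sum (x : ℕ+ →₀ ℝ) {s : Finset ℕ+} (hs : x.support ⊆ s) :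
    ofFinsupp 𝓕 θ x = ∑ j ∈ s, x j • tsirelsonUnit 𝓕 θ j := by
  have hx : x = ∑ j ∈ s, Finsupp.single j (x j) := by
    refine x.sum_single.symm.trans (Finsupp.sum_of_support_subset x hs _ (by simp))
  conv_lhs => rw [hx]
  simp only [map_sum, ofFinsupp_single]

theorem exists_coord (j : ℕ+) : ∃ f : TsirelsonSpace 𝓕 θ →L[ℝ] ℝ,
    ∀ x, f (ofFinsupp 𝓕 θ x) = x j := by
  set g : PreTsirelson 𝓕 θ →L[ℝ] ℝ := LinearMap.mkContinuous
    { toFun := fun x : ℕ+ →₀ ℝ => x j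
      map_add' := fun _ _ => rfl
      map_smul' := fun _ _ => rfl } 1 (fun x => by
        rw [one_mul]
        exact abs_le_tsirelsonNorm 𝓕 θ x j)
  refine ⟨g.extend UniformSpace.Completion.toComplL, fun x => ?_⟩
  exact g.extend_eq (e := UniformSpace.Completion.toComplL (𝕜 := ℝ) (E := PreTsirelson 𝓕 θ))
    UniformSpace.Completion.denseRange_coe
    (UniformSpace.Completion.isUniformInducing_coe _) x

/-- The coordinate functionals of `T[𝓕, θ]`. -/
def tsirelsonCoord (j : ℕ+) : TsirelsonSpace 𝓕 θ →L[ℝ] ℝ := (exists_coord 𝓕 θ j).choose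

theorem tsirelsonCoord_ofFinsupp (j : ℕ+) (x : ℕ+ →₀ ℝ) :
    tsirelsonCoord 𝓕 θ j (ofFinsupp 𝓕 θ x) = x j :=
  (exists_coord 𝓕 θ j).choose_spec x

theorem norm_sum_tsirelsonCoord_le (s : Finset ℕ+) (x : TsirelsonSpace 𝓕 θ) :
    ‖∑ j ∈ s, tsirelsonCoord 𝓕 θ j x • tsirelsonUnit 𝓕 θ j‖ ≤ ‖x‖ := by
  refine (denseRange_ofFinsupp 𝓕 θ).induction_on x (isClosed_le ?_ continuous_norm) fun y => ?_
  · fun_prop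
  · have h : (∑ j ∈ s, tsirelsonCoord 𝓕 θ j (ofFinsupp 𝓕 θ y) • tsirelsonUnit 𝓕 θ j) =
        ofFinsupp 𝓕 θ (restrictTo s y) := by
      rw [ofFinsupp_eq_sum 𝓕 θ (restrictTo s y) (s := s)]
      · refine Finset.sum_congr rfl fun j hj => ?_
        rw [tsirelsonCoord_ofFinsupp, restrictTo_apply, if_pos hj]
      · intro j hj
        by_contra hjs
        rw [Finsupp.mem_support_iff, restrictTo_apply, if_neg hjs] at hj
        exact hj rfl
    rw [h, norm_ofFinsupp, norm_ofFinsupp]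
    refine tsirelsonNorm_mono 𝓕 θ fun j => ?_
    rw [restrictTo_apply]
    split_ifs
    · exact le_rfl
    · simp

theorem hasSum_tsirelsonCoord (x : TsirelsonSpace 𝓕 θ) :
    HasSum (fun j => tsirelsonCoord 𝓕 θ j x • tsirelsonUnit 𝓕 θ j) x := by
  rw [HasSum, SummationFilter.unconditional_filter, Metric.tendsto_atTop]
  intro ε hε
  obtain ⟨y, hy⟩ := (denseRange_ofFinsupp 𝓕 θ).exists_dist_lt x (half_pos hε)
  refine ⟨y.support, fun s hs => ?_⟩
  have h₁ : ∑ j ∈ s, tsirelsonCoord 𝓕 θ j (ofFinsupp 𝓕 θ y) • tsirelsonUnit 𝓕 θ j =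
      ofFinsupp 𝓕 θ y := by
    simp only [tsirelsonCoord_ofFinsupp]
    exact (ofFinsupp_eq_sum 𝓕 θ y hs).symm
  have h₂ := norm_sum_tsirelsonCoord_le 𝓕 θ s (x - ofFinsupp 𝓕 θ y)
  simp only [map_sub, sub_smul, Finset.sum_sub_distrib] at h₂
  rw [h₁] at h₂
  rw [dist_eq_norm] at hy ⊢
  calc _ = ‖(∑ j ∈ s, tsirelsonCoord 𝓕 θ j x • tsirelsonUnit 𝓕 θ j - ofFinsupp 𝓕 θ y) -
        (x - ofFinsupp 𝓕 θ y)‖ := by rw [sub_sub_sub_cancel_right]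
    _ ≤ _ := norm_sub_le _ _
    _ < ε := by linarith

/-- The unit vector basis of `T[𝓕, θ]`. -/
def tsirelsonBasis : UnconditionalSchauderBasis ℕ+ ℝ (TsirelsonSpace 𝓕 θ) where
  basis := tsirelsonUnit 𝓕 θ
  coord := tsirelsonCoord 𝓕 θ
  ortho i j := by
    have h := ofFinsupp_single 𝓕 θ j 1
    rw [one_smul] at h
    rw [← h, tsirelsonCoord_ofFinsupp]
    by_cases hij : i = j
    · subst hij
      simp
    · simp [hij]
  expansion := hasSum_tsirelsonCoord 𝓕 θ

theorem isNormalizedBasis_tsirelsonBasis : IsNormalizedBasis (tsirelsonBasis 𝓕 θ) := by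
  intro j
  have h := ofFinsupp_single 𝓕 θ j 1
  rw [one_smul] at h
  change ‖tsirelsonUnit 𝓕 θ j‖ = 1
  rw [← h, norm_ofFinsupp, tsirelsonNorm_single]

theorem sum_smul_tsirelsonUnit (s : Finset ℕ+) (a : ℕ+ → ℝ) :
    ∑ j ∈ s, a j • tsirelsonUnit 𝓕 θ j = ofFinsupp 𝓕 θ (∑ j ∈ s, Finsupp.single j (a j)) := by
  simp only [map_sum, ofFinsupp_single]

theorem isOneUnconditional_tsirelsonBasis : IsOneUnconditional (tsirelsonBasis 𝓕 θ) := by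
  intro s a ε hε
  change ‖∑ j ∈ s, (ε j * a j) • tsirelsonUnit 𝓕 θ j‖ ≤ ‖∑ j ∈ s, a j • tsirelsonUnit 𝓕 θ j‖
  rw [sum_smul_tsirelsonUnit, sum_smul_tsirelsonUnit, norm_ofFinsupp, norm_ofFinsupp]
  refine tsirelsonNorm_mono 𝓕 θ fun i => le_of_eq ?_
  simp only [Finsupp.finsetSum_apply, Finsupp.single_apply, Finset.sum_ite_eq']
  split_ifs
  · rcases hε i with h | h <;> simp [h]
  · rfl

end TsirelsonBasis

/-! ### Convex averages of the unit vectors of small norm -/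

section Averages

/-- The sum of the coefficients. -/
def total : (ℕ+ →₀ ℝ) →ₗ[ℝ] ℝ := Finsupp.linearCombination ℝ fun _ => (1 : ℝ)

theorem total_eq_sum (a : ℕ+ →₀ ℝ) {s : Finset ℕ+} (hs : a.support ⊆ s) :
    total a = ∑ j ∈ s, a j := by
  rw [total, Finsupp.linearCombination_apply, Finsupp.sum_of_support_subset _ hs _ (by simp)]
  simp

/-- `a` is a finite convex combination of the unit vectors `e_j`, `j ∈ I`. -/
structure IsAverage (I : Set ℕ+) (a : ℕ+ →₀ ℝ) : Prop where
  nonneg : ∀ j, 0 ≤ a j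
  mem : ∀ j ∈ a.support, j ∈ I
  total_eq : total a = 1

theorem isAverage_single {I : Set ℕ+} {j : ℕ+} (hj : j ∈ I) :
    IsAverage I (Finsupp.single j 1) := by
  refine ⟨fun i => ?_, fun i hi => ?_, by simp [total]⟩
  · rw [Finsupp.single_apply]
    split_ifs <;> norm_num
  · have := Finset.mem_singleton.1 (Finsupp.support_single_subset hi)
    exact this ▸ hj

theorem IsAverage.mono {I I' : Set ℕ+} {a : ℕ+ →₀ ℝ} (h : IsAverage I a) (hI : I ⊆ I') :
    IsAverage I' a :=
  ⟨h.nonneg, fun j hj => hI (h.mem j hj), h.total_eq⟩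

theorem IsAverage.sum_le_one {I : Set ℕ+} {a : ℕ+ →₀ ℝ} (h : IsAverage I a) (F : Finset ℕ+) :
    ∑ j ∈ F, a j ≤ 1 := by
  rw [← h.total_eq, total_eq_sum a Finset.subset_union_right]
  exact Finset.sum_le_sum_of_subset_of_nonneg Finset.subset_union_left fun j _ _ => h.nonneg j

theorem IsAverage.sum_smul {ι : Type*} {I : Set ℕ+} {s : Finset ι} {c : ι → ℝ}
    {y : ι → ℕ+ →₀ ℝ} (hc : ∀ l ∈ s, 0 ≤ c l) (hs : ∑ l ∈ s, c l = 1)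
    (hy : ∀ l ∈ s, IsAverage I (y l)) : IsAverage I (∑ l ∈ s, c l • y l) := by
  refine ⟨fun j => ?_, fun j hj => ?_, ?_⟩
  · rw [Finsupp.finsetSum_apply]
    exact Finset.sum_nonneg fun l hl => mul_nonneg (hc l hl) ((hy l hl).nonneg j)
  · by_contra hjI
    refine Finsupp.mem_support_iff.1 hj ?_
    rw [Finsupp.finsetSum_apply]
    refine Finset.sum_eq_zero fun l hl => ?_
    have : y l j = 0 := Finsupp.notMem_support_iff.1 fun h => hjI ((hy l hl).mem j h)
    simp [this]
  · rw [map_sum, ← hs]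
    exact Finset.sum_congr rfl fun l hl => by rw [map_smul, (hy l hl).total_eq, smul_eq_mul, mul_one]

theorem exists_successive {P : ℕ+ → ℕ+ → (ℕ+ →₀ ℝ) → Prop} (h : ∀ m, ∃ M y, m < M ∧ P m M y) :
    ∃ (N : ℕ → ℕ+) (y : ℕ → ℕ+ →₀ ℝ), StrictMono N ∧ ∀ l, P (N l) (N (l + 1)) (y l) := by
  choose f g hf hP using h
  have hN : ∀ l, f^[l + 1] 1 = f (f^[l] 1) := fun l => Function.iterate_succ_apply' f l 1
  refine ⟨fun l => f^[l] 1, fun l => g (f^[l] 1), strictMono_nat_of_lt_succ fun l => ?_, fun l => ?_⟩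
  · rw [hN]
    exact hf _
  · beta_reduce
    rw [hN]
    exact hP _

theorem IsAverage.exists_Ioc {I : Set ℕ+} {m : ℕ+} {a : ℕ+ →₀ ℝ}
    (h : IsAverage (I ∩ Set.Ioi m) a) : ∃ M, m < M ∧ IsAverage (I ∩ Set.Ioc m M) a := by
  obtain ⟨M, hM⟩ := (insert m a.support).exists_le
  refine ⟨M + 1, PNat.lt_add_one_iff.2 (hM m (Finset.mem_insert_self _ _)),
    h.nonneg, fun j hj => ⟨(h.mem j hj).1, (h.mem j hj).2, ?_⟩, h.total_eq⟩
  exact (hM j (Finset.mem_insert_of_mem hj)).trans (PNat.lt_add_right M 1).le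

/-- To find averages which are small on the members of a family, it suffices to control them on
the members that start before the support of the average. -/
theorem exists_average_of_start_le {𝓕 : Set (Finset ℕ+)} {I : Set ℕ+}
    (h : ∀ ε : ℝ, 0 < ε → ∀ m, ∃ a, IsAverage (I ∩ Set.Ioi m) a ∧
      ∀ F ∈ 𝓕, (∃ k ∈ F, k ≤ m) → ∑ j ∈ F, a j ≤ ε) {ε : ℝ} (hε : 0 < ε) :
    ∃ a, IsAverage I a ∧ ∀ F ∈ 𝓕, ∑ j ∈ F, a j ≤ ε := by
  classical
  obtain ⟨N, y, hN, hy⟩ := exists_successive (P := fun m M y => IsAverage (I ∩ Set.Ioc m M) y ∧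
      ∀ F ∈ 𝓕, (∃ k ∈ F, k ≤ m) → ∑ j ∈ F, y j ≤ ε / 2) fun m => by
    obtain ⟨a, ha, haF⟩ := h (ε / 2) (half_pos hε) m
    obtain ⟨M, hM, ha'⟩ := ha.exists_Ioc
    exact ⟨M, a, hM, ha', haF⟩
  obtain ⟨k, hk⟩ := exists_nat_gt (2 / ε)
  have hk0 : (0 : ℝ) < k := (by positivity : 0 < 2 / ε).trans hk
  refine ⟨∑ l ∈ Finset.range k, (1 / (k : ℝ)) • y l, .sum_smul (fun _ _ => by positivity) ?_
    fun l _ => (hy l).1.mono Set.inter_subset_left, fun F hF => ?_⟩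
  · simp only [Finset.sum_const, Finset.card_range, nsmul_eq_mul]
    field_simp
  have hswap : ∑ j ∈ F, (∑ l ∈ Finset.range k, (1 / (k : ℝ)) • y l) j =
      (1 / k) * ∑ l ∈ Finset.range k, ∑ j ∈ F, y l j := by
    simp only [Finsupp.finsetSum_apply, Finsupp.smul_apply, smul_eq_mul, ← Finset.mul_sum]
    rw [Finset.sum_comm]
  set B := (Finset.range k).filter fun l => ε / 2 < ∑ j ∈ F, y l j with hB
  have hB1 : B.card ≤ 1 := by
    have hlt : ∀ l ∈ B, ∀ l' ∈ B, ¬ l < l' := by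
      intro l hl l' hl' hll
      rw [hB, Finset.mem_filter] at hl hl'
      obtain ⟨j, hj, hjne⟩ := Finset.exists_ne_zero_of_sum_ne_zero
        ((half_pos hε).trans hl.2).ne'
      have h₁ := ((hy l).1.mem j (Finsupp.mem_support_iff.2 hjne)).2.2
      have h₂ : N (l + 1) ≤ N l' := hN.monotone hll
      exact absurd ((hy l').2 F hF ⟨j, hj, h₁.trans h₂⟩) (not_le.2 hl'.2)
    refine Finset.card_le_one.2 fun l hl l' hl' => ?_
    rcases lt_trichotomy l l' with h | h | h
    · exact absurd h (hlt l hl l' hl')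
    · exact h
    · exact absurd h (hlt l' hl' l hl)
  have hsum : ∑ l ∈ Finset.range k, ∑ j ∈ F, y l j ≤ k * (ε / 2) + 1 := by
    calc _ ≤ ∑ l ∈ Finset.range k, (ε / 2 + if ε / 2 < ∑ j ∈ F, y l j then 1 else 0) := by
          refine Finset.sum_le_sum fun l _ => ?_
          split_ifs with h
          · exact ((hy l).1.sum_le_one F).trans (by linarith)
          · rw [add_zero]
            exact not_lt.1 h
      _ = k * (ε / 2) + (B.card : ℝ) := by
        rw [Finset.sum_add_distrib, Finset.sum_const, Finset.card_range, nsmul_eq_mul,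
          Finset.sum_boole]
      _ ≤ _ := by
        gcongr
        exact_mod_cast hB1
  rw [hswap]
  calc (1 / (k : ℝ)) * _ ≤ (1 / k) * (k * (ε / 2) + 1) := by gcongr
    _ = ε / 2 + 1 / k := by field_simp
    _ ≤ ε / 2 + ε / 2 := by
      refine add_le_add le_rfl ?_
      rw [div_le_div_iff₀ hk0 two_pos]
      rw [div_lt_iff₀ hε] at hk
      linarith
    _ = ε := add_halves ε

theorem infinite_inter_Ioi {I : Set ℕ+} (hI : I.Infinite) (m : ℕ+) : (I ∩ Set.Ioi m).Infinite := by
  intro hfin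
  refine hI ((hfin.union (Set.finite_Iic m)).subset fun j hj => ?_)
  rcases le_or_gt j m with h | h
  · exact .inr h
  · exact .inl ⟨hj, h⟩

theorem exists_small_average {α : Ordinal.{0} → ℕ+ → Ordinal.{0}} (hα : IsApproximating α)
    {γ : Ordinal.{0}} (hγ : γ < Ordinal.omega 1) {I : Set ℕ+} (hI : I.Infinite) {ε : ℝ}
    (hε : 0 < ε) : ∃ a, IsAverage I a ∧ ∀ F ∈ schreierFamily α γ, ∑ j ∈ F, a j ≤ ε := by
  classical
  induction γ using WellFoundedLT.induction generalizing I ε with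
  | _ γ ih =>
  refine exists_average_of_start_le (fun ε hε m => ?_) hε
  have hIm := infinite_inter_Ioi hI m
  rcases Ordinal.zero_or_succ_or_isSuccLimit γ with rfl | ⟨β, rfl⟩ | hlim
  · obtain ⟨i, hi⟩ := hIm.nonempty
    refine ⟨_, isAverage_single hi, fun F hF ⟨k, hk, hkm⟩ => ?_⟩
    have hFk : F = {k} := Finset.eq_singleton_iff_unique_mem.2 ⟨hk, fun j hj =>
      Finset.card_le_one.1 (mem_schreierFamily_zero_iff.1 hF) j hj k hk⟩
    rw [hFk, Finset.sum_singleton, Finsupp.single_eq_of_ne (hkm.trans_lt hi.2).ne]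
    exact hε.le
  · have hβ := lt_omega_one_of_succ hγ
    have hm : (0 : ℝ) < m := by exact_mod_cast m.pos
    obtain ⟨a, ha, haF⟩ := ih β (Order.lt_succ β) hβ hIm (div_pos hε hm)
    refine ⟨a, ha, fun F hF ⟨k, hk, hkm⟩ => ?_⟩
    obtain ⟨p, hp, c, hc, hcp, hcF⟩ := exists_blocks_of_mem_schreierFamily_succ hα hβ hF
    have hpm : p ≤ (m : ℕ) := (hp k hk).trans hkm
    rw [← Finset.sum_fiberwise_of_maps_to (t := Finset.range p) (g := c)
      fun j hj => Finset.mem_range.2 (hcp j hj)]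
    calc _ ≤ ∑ _i ∈ Finset.range p, ε / (m : ℝ) := Finset.sum_le_sum fun i _ => haF _ (hcF i)
      _ = p * (ε / m) := by simp
      _ ≤ m * (ε / m) := by
        gcongr
      _ = ε := mul_div_cancel₀ ε hm.ne'
  · obtain ⟨a, ha, haF⟩ := ih _ (hα.lt γ hγ hlim m) ((hα.lt γ hγ hlim m).trans hγ) hIm hε
    refine ⟨a, ha, fun F hF ⟨k, hk, hkm⟩ => ?_⟩
    obtain ⟨n, hn, hFn⟩ := exists_mem_of_mem_schreierFamily_limit hlim hF
    have h₁ := schreierFamily_limit_mono hα hγ hlim ((hn k hk).trans hkm)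
      ((regular_schreierFamily _).subset hFn (Finset.filter_subset (1 < ·) F))
      fun j hj => (Finset.mem_filter.1 hj).2
    refine le_of_eq_of_le ?_ (haF _ h₁)
    refine (Finset.sum_filter_of_ne fun j _ hj => ?_).symm
    exact one_le.trans_lt (ha.mem j (Finsupp.mem_support_iff.2 hj)).2

end Averages

section NotL1

variable {α : Ordinal.{0} → ℕ+ → Ordinal.{0}} (hα : IsApproximating α) {ξ : Ordinal.{0}}
  (hξ : ξ < Ordinal.omega 1) (θ : Set.Ioo (0 : ℝ) 1)

theorem restrictTo_sum_smul {ι : Type*} (s : Finset ι) (c : ι → ℝ) (y : ι → ℕ+ →₀ ℝ)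
    (E : Finset ℕ+) :
    restrictTo E (∑ l ∈ s, c l • y l) = ∑ l ∈ s, c l • restrictTo E (y l) := by
  ext j
  simp only [restrictTo_apply, Finsupp.finsetSum_apply, Finsupp.smul_apply]
  split_ifs <;> simp

include hα hξ in
theorem exists_average_tsirelsonNorm_le (r : ℕ) {I : Set ℕ+} (hI : I.Infinite) :
    ∃ a, IsAverage I a ∧ tsirelsonNorm (schreierFamily α ξ) θ a ≤ ((1 + θ) / 2 : ℝ) ^ r := by
  classical
  induction r generalizing I with
  | zero =>
    obtain ⟨i, hi⟩ := hI.nonempty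
    exact ⟨_, isAverage_single hi, by rw [tsirelsonNorm_single, pow_zero]⟩
  | succ r ih =>
    set 𝓕 := schreierFamily α ξ with h𝓕
    have hθ0 : (0 : ℝ) < θ := θ.2.1
    have hθ1 : (θ : ℝ) < 1 := θ.2.2
    set ρ : ℝ := (1 + θ) / 2 with hρ
    set ε : ℝ := (1 - θ) / 2 with hε
    have hε0 : 0 < ε := by linarith
    have hρ0 : 0 < ρ := by linarith
    obtain ⟨N, y, hN, hy⟩ := exists_successive (P := fun m M y =>
        IsAverage (I ∩ Set.Ioc m M) y ∧ tsirelsonNorm 𝓕 θ y ≤ ρ ^ r) fun m => by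
      obtain ⟨a, ha, han⟩ := ih (infinite_inter_Ioi hI m)
      obtain ⟨M, hM, ha'⟩ := ha.exists_Ioc
      exact ⟨M, a, hM, ha', han⟩
    set f : ℕ → ℕ+ := fun l => N (l + 1) with hf
    have hfmono : StrictMono f := fun l l' h => hN (Nat.add_lt_add_right h 1)
    obtain ⟨a, ha, haF⟩ := exists_small_average hα hξ
      (Set.infinite_range_of_injective hfmono.injective) hε0
    set s := a.support.preimage f hfmono.injective.injOn with hs
    have hs1 : ∑ l ∈ s, a (f l) = 1 := by
      rw [← ha.total_eq, total_eq_sum a subset_rfl]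
      exact Finset.sum_preimage f _ _ _ fun j hj hjr => absurd (ha.mem j hj) hjr
    have hyI : ∀ l j, y l j ≠ 0 → N l < j ∧ j ≤ N (l + 1) := fun l j h =>
      ((hy l).1.mem j (Finsupp.mem_support_iff.2 h)).2
    have hpow : 0 ≤ ρ ^ r := by positivity
    refine ⟨∑ l ∈ s, a (f l) • y l, .sum_smul (fun l _ => ha.nonneg _) hs1
      fun l _ => (hy l).1.mono Set.inter_subset_left,
      tsirelsonNorm_le 𝓕 θ (by positivity) (fun j => ?_) fun k E hE => ?_⟩
    · rw [Finsupp.finsetSum_apply]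
      by_cases hex : ∃ l ∈ s, y l j ≠ 0
      · obtain ⟨l, hl, hlj⟩ := hex
        rw [Finset.sum_eq_single_of_mem l hl fun l' _ hne => ?_]
        · have h₁ := abs_le_tsirelsonNorm 𝓕 θ (y l) j
          have h₂ := haF {f l} (singleton_mem_schreierFamily hα hξ _)
          rw [Finset.sum_singleton] at h₂
          rw [Finsupp.smul_apply, smul_eq_mul, abs_mul, abs_of_nonneg (ha.nonneg _), pow_succ,
            mul_comm (ρ ^ r)]
          exact mul_le_mul (h₂.trans (by linarith)) (h₁.trans (hy l).2) (abs_nonneg _) hρ0.le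
        · have h₁ := hyI l j hlj
          by_contra hne'
          have hl'j : y l' j ≠ 0 := fun h0 => hne' (by simp [h0])
          have h₂ := hyI l' j hl'j
          rcases lt_or_gt_of_ne hne with h | h
          · have : N (l' + 1) ≤ N l := hN.monotone h
            exact absurd (h₂.2.trans this) (not_le.2 h₁.1)
          · have : N (l + 1) ≤ N l' := hN.monotone h
            exact absurd (h₁.2.trans this) (not_le.2 h₂.1)
      · push Not at hex
        rw [Finset.sum_eq_zero fun l hl => by simp [hex l hl], abs_zero]
        positivity
    · obtain ⟨hlt, m, hm, hmF⟩ := id hE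
      set B := s.filter fun l => ∃ i, N l < m i ∧ m i ≤ N (l + 1) with hB
      have hBsum : ∑ l ∈ B, a (f l) ≤ ε := by
        rw [← Finset.sum_image (f := fun j => a j) (g := f) hfmono.injective.injOn]
        refine haF _ (regular_schreierFamily ξ _ hmF _ ?_)
        have hex : ∀ q ∈ B.image f, ∃ i l, q = N (l + 1) ∧ N l < m i ∧ m i ≤ q := by
          intro q hq
          obtain ⟨l, hl, rfl⟩ := Finset.mem_image.1 hq
          obtain ⟨i, hi, hi'⟩ := (Finset.mem_filter.1 hl).2
          exact ⟨i, l, rfl, hi, hi'⟩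
        refine ⟨fun q => if h : ∃ i l, q = N (l + 1) ∧ N l < m i ∧ m i ≤ q then m h.choose else q,
          fun q hq => ?_, fun q hq q' hq' hqq => ?_⟩
        · simp only [hex q hq, dif_pos]
          exact ⟨Finset.mem_image_of_mem m (Finset.mem_univ _), (hex q hq).choose_spec.choose_spec.2.2⟩
        · have h₁ := hex q hq
          have h₂ := hex q' hq'
          simp only [h₁, h₂, dif_pos]
          obtain ⟨l, hl, -, hle⟩ := h₁.choose_spec
          obtain ⟨l', hl', hlt', -⟩ := h₂.choose_spec
          have hll : l + 1 < l' + 1 := hN.lt_iff_lt.1 (hl ▸ hl' ▸ hqq)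
          have h₃ : N (l + 1) ≤ N l' := hN.monotone (by omega)
          exact hle.trans_lt ((hl.trans_le h₃).trans_lt hlt')
      have hgood : ∀ l ∈ s, l ∉ B →
          (θ : ℝ) * ∑ i, tsirelsonNorm 𝓕 θ (restrictTo (E i) (y l)) ≤ θ * ρ ^ r := by
        intro l hl hlB
        refine mul_le_mul_of_nonneg_left ?_ hθ0.le
        have hzero : tsirelsonNorm 𝓕 θ 0 = 0 := by
          have := tsirelsonNorm_smul 𝓕 θ 0 0
          rwa [zero_smul, abs_zero, zero_mul] at this
        have honly : ∀ i i' j j', i < i' → j ∈ E i → y l j ≠ 0 → j' ∈ E i' → y l j' ≠ 0 → False := by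
          intro i i' j j' hii hj hyj hj' hyj'
          refine hlB (Finset.mem_filter.2 ⟨hl, i', ?_, ?_⟩)
          · exact (hyI l j hyj).1.trans (hlt i i' hii j hj _ (hm i').1)
          · exact ((hm i').2 hj').trans (hyI l j' hyj').2
        by_cases hex : ∃ i, ∃ j ∈ E i, y l j ≠ 0
        · obtain ⟨i, j, hj, hyj⟩ := hex
          rw [Finset.sum_eq_single_of_mem i (Finset.mem_univ i) fun i' _ hne => ?_]
          · refine (tsirelsonNorm_mono 𝓕 θ fun j => ?_).trans (hy l).2
            rw [restrictTo_apply]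
            split_ifs <;> simp
          · convert hzero
            ext j'
            rw [restrictTo_apply]
            split_ifs with hj'
            · by_contra hyj'
              rcases lt_or_gt_of_ne hne with h | h
              · exact honly i' i j' j h hj' hyj' hj hyj
              · exact honly i i' j j' h hj hyj hj' hyj'
            · rfl
        · push Not at hex
          refine le_of_eq_of_le (Finset.sum_eq_zero fun i _ => ?_) hpow
          convert hzero
          ext j
          rw [restrictTo_apply]
          split_ifs with hj
          · exact hex i j hj
          · rfl
      have hall : ∀ l ∈ s, (θ : ℝ) * ∑ i, tsirelsonNorm 𝓕 θ (restrictTo (E i) (y l)) ≤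
          θ * ρ ^ r + if ∃ i, N l < m i ∧ m i ≤ N (l + 1) then ρ ^ r else 0 := by
        intro l hl
        split_ifs with h
        · have h₁ := (mul_sum_le_tsirelsonNorm 𝓕 θ hE (y l)).trans (hy l).2
          have h₂ : 0 ≤ (θ : ℝ) * ρ ^ r := by positivity
          linarith
        · rw [add_zero]
          exact hgood l hl fun hB => h (Finset.mem_filter.1 hB).2
      calc (θ : ℝ) * ∑ i, tsirelsonNorm 𝓕 θ (restrictTo (E i) (∑ l ∈ s, a (f l) • y l))
          ≤ θ * ∑ i, ∑ l ∈ s, a (f l) * tsirelsonNorm 𝓕 θ (restrictTo (E i) (y l)) := by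
            refine mul_le_mul_of_nonneg_left (Finset.sum_le_sum fun i _ => ?_) hθ0.le
            rw [restrictTo_sum_smul]
            refine (tsirelsonNorm_sum_le 𝓕 θ _ _).trans (Finset.sum_le_sum fun l _ => ?_)
            rw [tsirelsonNorm_smul, abs_of_nonneg (ha.nonneg _)]
        _ = ∑ l ∈ s, a (f l) * (θ * ∑ i, tsirelsonNorm 𝓕 θ (restrictTo (E i) (y l))) := by
            rw [Finset.sum_comm, Finset.mul_sum]
            refine Finset.sum_congr rfl fun l _ => ?_
            rw [← Finset.mul_sum]
            ring
        _ ≤ ∑ l ∈ s, a (f l) *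
            (θ * ρ ^ r + if ∃ i, N l < m i ∧ m i ≤ N (l + 1) then ρ ^ r else 0) :=
          Finset.sum_le_sum fun l hl => mul_le_mul_of_nonneg_left (hall l hl) (ha.nonneg _)
        _ = θ * ρ ^ r + (∑ l ∈ B, a (f l)) * ρ ^ r := by
            simp only [mul_add, Finset.sum_add_distrib, mul_ite, mul_zero]
            rw [← Finset.sum_mul, hs1, one_mul, ← Finset.sum_filter, Finset.sum_mul]
        _ ≤ θ * ρ ^ r + ε * ρ ^ r := by gcongr
        _ = ρ ^ (r + 1) := by
            rw [pow_succ, ← add_mul, mul_comm]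
            congr 1
            rw [hε, hρ]
            ring

include hα hξ in
theorem not_isEquivalentToL1Basis_tsirelsonUnit :
    ¬ IsEquivalentToL1Basis (tsirelsonUnit (schreierFamily α ξ) θ) := by
  rintro ⟨c, -, A, B, hA, -, -, h⟩
  obtain ⟨r, hr⟩ := exists_pow_lt_of_lt_one hA (show (1 + θ) / 2 < (1 : ℝ) by
    have := θ.2.2
    linarith)
  obtain ⟨a, ha, har⟩ := exists_average_tsirelsonNorm_le hα hξ θ r Set.infinite_univ
  have h₁ := (h a.support a).1
  rw [← ofFinsupp_eq_sum _ _ a subset_rfl, norm_ofFinsupp,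
    Finset.sum_congr rfl fun j _ => abs_of_nonneg (ha.nonneg j), ← total_eq_sum a subset_rfl,
    ha.total_eq] at h₁
  linarith

end NotL1

/-! ### Disjoint vectors in tails of the Tsirelson space -/

section TsirelsonTails

variable {θ : Set.Ioo (0 : ℝ) 1}

theorem mul_sum_abs_le_tsirelsonNorm {𝓕 : Set (Finset ℕ+)} {F : Finset ℕ+} (hF : F ∈ 𝓕)
    (x : ℕ+ →₀ ℝ) : (θ : ℝ) * ∑ j ∈ F, |x j| ≤ tsirelsonNorm 𝓕 θ x := by
  have hadm : IsAdmissible 𝓕 fun i : Fin F.card => ({F.orderEmbOfFin rfl i} : Finset ℕ+) := by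
    refine ⟨fun i j hij a ha a' ha' => ?_, F.orderEmbOfFin rfl, fun i => ?_, ?_⟩
    · rw [Finset.mem_singleton] at ha ha'
      rw [ha, ha']
      exact (F.orderEmbOfFin rfl).strictMono hij
    · simp
    · rwa [Finset.image_orderEmbOfFin_univ]
  refine le_trans ?_ (mul_sum_le_tsirelsonNorm 𝓕 θ hadm x)
  refine mul_le_mul_of_nonneg_left ?_ θ.2.1.le
  rw [← Finset.sum_coe_sort, ← (F.orderIsoOfFin rfl).toEquiv.sum_comp]
  refine Finset.sum_le_sum fun i _ => ?_
  refine le_of_eq_of_le ?_ (abs_le_tsirelsonNorm 𝓕 θ _ (F.orderEmbOfFin rfl i))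
  rw [restrictTo_apply, if_pos (Finset.mem_singleton_self _)]
  rfl

theorem mul_sum_abs_coord_le_norm {𝓕 : Set (Finset ℕ+)} {F : Finset ℕ+} (hF : F ∈ 𝓕)
    (x : TsirelsonSpace 𝓕 θ) :
    (θ : ℝ) * ∑ j ∈ F, |(tsirelsonBasis 𝓕 θ).coord j x| ≤ ‖x‖ := by
  refine (denseRange_ofFinsupp 𝓕 θ).induction_on x (isClosed_le ?_ continuous_norm) fun y => ?_
  · fun_prop
  · rw [norm_ofFinsupp]
    refine le_of_eq_of_le ?_ (mul_sum_abs_le_tsirelsonNorm hF y)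
    congr 1
    exact Finset.sum_congr rfl fun j _ => by rw [← tsirelsonCoord_ofFinsupp 𝓕 θ j y]; rfl

theorem mul_sum_norm_le_norm_sum {n L : ℕ} {𝓕 : Set (Finset ℕ+)}
    (hL : ∀ x : Fin n → ℕ+ →₀ ℝ,
      (∀ i j, i ≠ j → ∀ r, x i r ≠ 0 → x j r = 0) → (∀ i, ∀ r ∈ (x i).support, L ≤ (r : ℕ)) →
      ENNReal.ofReal θ * ∑ i, tsirelsonENorm 𝓕 θ (x i) ≤ tsirelsonENorm 𝓕 θ (∑ i, x i))
    (x : Fin n → TsirelsonSpace 𝓕 θ)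
    (hx : ∀ i j, i ≠ j → ∀ r, (tsirelsonBasis 𝓕 θ).coord r (x i) ≠ 0 →
      (tsirelsonBasis 𝓕 θ).coord r (x j) = 0)
    (hxL : ∀ i, ∀ r : ℕ+, (r : ℕ) < L → (tsirelsonBasis 𝓕 θ).coord r (x i) = 0) :
    (θ : ℝ) * ∑ i, ‖x i‖ ≤ ‖∑ i, x i‖ := by
  set b := tsirelsonBasis 𝓕 θ with hb
  have hproj : ∀ (A : Finset ℕ+) (y : TsirelsonSpace 𝓕 θ), ∑ j ∈ A, b.coord j y • b j =
      ofFinsupp 𝓕 θ (∑ j ∈ A, Finsupp.single j (b.coord j y)) := fun A y =>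
    sum_smul_tsirelsonUnit 𝓕 θ A fun j => b.coord j y
  have hlim : ∀ y : TsirelsonSpace 𝓕 θ, Filter.Tendsto (fun A : Finset ℕ+ =>
      ‖∑ j ∈ A, b.coord j y • b j‖) Filter.atTop (nhds ‖y‖) := fun y => (b.expansion y).norm
  refine le_of_tendsto_of_tendsto' ((tendsto_finsetSum Finset.univ fun i _ => hlim (x i)).const_mul _)
    (hlim (∑ i, x i)) fun A => ?_
  set u : Fin n → ℕ+ →₀ ℝ := fun i => ∑ j ∈ A, Finsupp.single j (b.coord j (x i)) with hu
  have hur : ∀ i r, u i r = if r ∈ A then b.coord r (x i) else 0 := fun i r => by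
    simp [hu, Finsupp.finsetSum_apply, Finsupp.single_apply]
  have key := hL u (fun i j hij r hr => ?_) fun i r hr => ?_
  · simp only [← ofReal_tsirelsonNorm] at key
    rw [← ENNReal.ofReal_sum_of_nonneg fun i _ => tsirelsonNorm_nonneg 𝓕 θ _,
      ← ENNReal.ofReal_mul θ.2.1.le,
      ENNReal.ofReal_le_ofReal_iff (tsirelsonNorm_nonneg 𝓕 θ _)] at key
    have hsum : ∑ j ∈ A, b.coord j (∑ i, x i) • b j = ofFinsupp 𝓕 θ (∑ i, u i) := by
      simp only [map_sum, Finset.sum_smul, hu, ofFinsupp_single]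
      exact Finset.sum_comm
    rw [hsum, norm_ofFinsupp]
    simp only [hproj, norm_ofFinsupp]
    exact key
  · rw [hur] at hr ⊢
    split_ifs at hr ⊢ with h
    · exact hx i j hij r hr
    · rfl
  · rw [Finsupp.mem_support_iff, hur] at hr
    split_ifs at hr with h
    · by_contra! hlt
      exact hr (hxL i r hlt)
    · exact absurd rfl hr

/-- Normalized fillings of tails are equivalent to the unit vector basis of `ℓ₁`. -/
theorem IsFilling.isL1Equivalent {𝓕 : Set (Finset ℕ+)} {n l : ℕ} {k : ℕ+} (hl : l ≤ k)
    (hL : ∀ x : Fin n → ℕ+ →₀ ℝ,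
      (∀ i j, i ≠ j → ∀ r, x i r ≠ 0 → x j r = 0) → (∀ i, ∀ r ∈ (x i).support, l ≤ (r : ℕ)) →
      ENNReal.ofReal θ * ∑ i, tsirelsonENorm 𝓕 θ (x i) ≤ tsirelsonENorm 𝓕 θ (∑ i, x i))
    (h𝓕 : ∀ F : Finset ℕ+, (∀ k ∈ F, F.card ≤ (k : ℕ)) → F ∈ 𝓕) (hn : n ≤ k)
    {x : Fin k → TsirelsonSpace 𝓕 θ} (hx : IsFilling (tsirelsonBasis 𝓕 θ) k n x)
    (hx1 : ∀ i, ‖x i‖ = 1) : IsL1Equivalent ((θ : ℝ) / 3) x := by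
  classical
  set b := tsirelsonBasis 𝓕 θ with hb
  have hθ : (0 : ℝ) < θ := θ.2.1
  refine ⟨θ / 3, 1, by positivity, one_pos, by rw [mul_one], fun s a => ⟨?_, ?_⟩⟩
  swap
  · rw [one_mul]
    refine (norm_sum_le _ _).trans (Finset.sum_le_sum fun i _ => ?_)
    rw [norm_smul, hx1, mul_one, Real.norm_eq_abs]
  have key : ∀ a : Fin k → ℝ, θ / 3 * ∑ i, |a i| ≤ ‖∑ i, a i • x i‖ := by
    intro a
    set v := ∑ i, a i • x i with hv
    have hcoord : ∀ i j, b.coord j (x i) ≠ 0 → b.coord j v = a i * b.coord j (x i) := by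
      intro i j hj
      rw [hv, map_sum, Finset.sum_eq_single_of_mem i (Finset.mem_univ i) fun i' _ hne => ?_,
        map_smul, smul_eq_mul]
      rw [map_smul, smul_eq_mul]
      by_contra h
      exact hne (hx.eq_of_ne (right_ne_zero_of_mul h) hj)
    have hlow : θ * ∑ i : Fin n, |a (Fin.castLE hn i)| ≤ ‖v‖ := by
      set v' := ∑ i : Fin n, a (Fin.castLE hn i) • x (Fin.castLE hn i) with hv'
      have h₁ : ‖v'‖ ≤ 1 * ‖v‖ := by
        refine (isOneUnconditional_tsirelsonBasis 𝓕 θ).norm_le_of_coord_le zero_le_one fun j => ?_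
        rw [one_mul]
        by_cases hex : ∃ i : Fin n, b.coord j (x (Fin.castLE hn i)) ≠ 0
        · obtain ⟨i, hi⟩ := hex
          have : b.coord j v' = b.coord j v := by
            rw [hcoord _ j hi, hv', map_sum,
              Finset.sum_eq_single_of_mem i (Finset.mem_univ i) fun i' _ hne => ?_,
              map_smul, smul_eq_mul]
            rw [map_smul, smul_eq_mul]
            by_contra h
            exact hne (Fin.castLE_injective hn (hx.eq_of_ne (right_ne_zero_of_mul h) hi))
          exact this ▸ le_rfl
        · push Not at hex
          have : b.coord j v' = 0 := by
            rw [hv', map_sum]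
            exact Finset.sum_eq_zero fun i _ => by rw [map_smul, hex i, smul_zero]
          rw [this, abs_zero]
          exact abs_nonneg _
      have h₂ := mul_sum_norm_le_norm_sum hL
        (fun i : Fin n => a (Fin.castLE hn i) • x (Fin.castLE hn i)) (fun i j hij r hr => ?_)
        fun i r hr => ?_
      · simp only [norm_smul, hx1, mul_one, Real.norm_eq_abs] at h₂
        rw [one_mul] at h₁
        exact h₂.trans h₁
      · rw [map_smul, smul_eq_mul] at hr ⊢
        by_contra h
        exact hij (Fin.castLE_injective hn
          (hx.eq_of_ne (right_ne_zero_of_mul hr) (right_ne_zero_of_mul h)))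
      · rw [map_smul, hx.tail _ r (PNat.coe_lt_coe _ _ |>.1 (hr.trans_le hl)), smul_zero]
    set T := Finset.univ.filter fun i : Fin k => n ≤ (i : ℕ) with hT
    have hunit : ∀ i : Fin k, ∃ j, n ≤ (i : ℕ) → |b.coord j (x i)| = 1 := by
      intro i
      by_cases hi : n ≤ (i : ℕ)
      · obtain ⟨j, c, hc⟩ := hx.unit i hi
        refine ⟨j, fun _ => ?_⟩
        have h₁ := hx1 i
        rw [hc, norm_smul, isNormalizedBasis_tsirelsonBasis 𝓕 θ j, mul_one, Real.norm_eq_abs] at h₁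
        rw [hc, map_smul, coord_basis, if_pos rfl, smul_eq_mul, mul_one, h₁]
      · exact ⟨1, fun h => absurd h hi⟩
    choose j hj using hunit
    have hjT : ∀ i ∈ T, |b.coord (j i) (x i)| = 1 := fun i hi => hj i (Finset.mem_filter.1 hi).2
    have hjne : ∀ i ∈ T, b.coord (j i) (x i) ≠ 0 := fun i hi h0 => by
      have := hjT i hi
      rw [h0, abs_zero] at this
      exact zero_ne_one this
    have hjinj : Set.InjOn j T := by
      intro i hi i' hi' h
      exact hx.eq_of_ne (j := j i) (hjne i hi) (h ▸ hjne i' hi')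
    have hhigh : θ * ∑ i ∈ T, |a i| ≤ ‖v‖ := by
      have hF : T.image j ∈ 𝓕 := by
        refine h𝓕 _ fun q hq => ?_
        obtain ⟨i, hi, rfl⟩ := Finset.mem_image.1 hq
        have h₁ : (T.image j).card ≤ k :=
          (Finset.card_image_le.trans (Finset.card_le_univ _)).trans_eq (Fintype.card_fin _)
        refine h₁.trans ?_
        by_contra! hlt
        exact hjne i hi (hx.tail i _ (PNat.coe_lt_coe _ _ |>.1 hlt))
      refine le_of_eq_of_le ?_ (mul_sum_abs_coord_le_norm hF v)
      rw [Finset.sum_image hjinj]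
      congr 1
      refine Finset.sum_congr rfl fun i hi => ?_
      change _ = |b.coord (j i) v|
      rw [hcoord i (j i) (hjne i hi), abs_mul, hjT i hi, mul_one]
    have hsplit : ∑ i, |a i| ≤ ∑ i : Fin n, |a (Fin.castLE hn i)| + ∑ i ∈ T, |a i| := by
      have h₁ : ∑ i : Fin n, |a (Fin.castLE hn i)| =
          ∑ i ∈ Finset.univ.map (Fin.castLEEmb hn), |a i| := by
        rw [Finset.sum_map]
        rfl
      rw [h₁, ← Finset.sum_union]
      · refine Finset.sum_le_sum_of_subset_of_nonneg (fun i _ => ?_) fun i _ _ => abs_nonneg _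
        rw [Finset.mem_union, Finset.mem_map]
        by_cases hi : n ≤ (i : ℕ)
        · exact .inr (Finset.mem_filter.2 ⟨Finset.mem_univ _, hi⟩)
        · exact .inl ⟨⟨i, not_le.1 hi⟩, Finset.mem_univ _, rfl⟩
      · rw [Finset.disjoint_left]
        intro i hi hiT
        obtain ⟨i', -, rfl⟩ := Finset.mem_map.1 hi
        have := (Finset.mem_filter.1 hiT).2
        have h₂ := i'.2
        simp only [Fin.castLEEmb_apply, Fin.val_castLE] at this
        omega
    have h₃ := mul_le_mul_of_nonneg_left hsplit hθ.le
    rw [mul_add] at h₃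
    have h₄ := norm_nonneg v
    have h₅ : θ / 3 * ∑ i, |a i| = (θ * ∑ i, |a i|) / 3 := by ring
    rw [h₅]
    linarith
  have h := key fun i => if i ∈ s then a i else 0
  simp only [ite_smul, zero_smul, Finset.sum_ite_mem, Finset.univ_inter, apply_ite abs,
    abs_zero] at h
  exact h

/-- Finite dimensional subspaces of tails are moved into the span of normalized disjoint vectors
of the tail. -/
theorem exists_filling_of_tail {X : Type*} [NormedAddCommGroup X] [NormedSpace ℝ X]
    [CompleteSpace X] {b : UnconditionalSchauderBasis ℕ+ ℝ X} (h1 : IsOneUnconditional b) {m : ℕ}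
    (hm : 0 < m) {k : ℕ+} (hk : cellNumber m ≤ k) {W : Submodule ℝ X} [CompleteSpace W]
    (hW : ∀ x, x ∈ W ↔ ∀ j < k, b.coord j x = 0) (E : Submodule ℝ W)
    (hE : Module.finrank ℝ E = m) :
    ∃ (x : Fin k → W) (S : W ≃L[ℝ] W),
      IsFilling b k (cellNumber m) (fun i => (x i : X)) ∧ (∀ i, ‖x i‖ = 1) ∧
      ‖(S : W →L[ℝ] W)‖ * ‖(S.symm : W →L[ℝ] W)‖ ≤ 2 ∧
      ∀ y ∈ E, S y ∈ Submodule.span ℝ (Set.range x) := by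
  classical
  have hE' : Module.finrank ℝ (E.map W.subtype) = m := by
    rw [← hE]
    exact (Submodule.equivMapOfInjective _ W.injective_subtype E).symm.finrank_eq
  obtain ⟨K, z, hK, hz, hspan, hcoord⟩ := exists_disjoint_approx h1 hm _ hE'
  have hEtail : ∀ j < k, ∀ y ∈ E.map W.subtype, b.coord j y = 0 := by
    rintro j hj _ ⟨y, -, rfl⟩
    exact (hW _).1 y.2 j hj
  have hKW : ∀ y, K y ∈ W := fun y =>
    (hW _).2 fun j hj => (hcoord j (hEtail j hj)).1 y
  set KW : W →L[ℝ] W := (K.comp W.subtypeL).codRestrict W fun y => hKW y with hKWdef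
  have hKWn : ‖KW‖ ≤ 1 / 3 := ContinuousLinearMap.opNorm_le_bound _ (by norm_num) fun y => by
    change ‖K y‖ ≤ 1 / 3 * ‖(y : X)‖
    exact (K.le_opNorm _).trans (by gcongr)
  obtain ⟨S, hS, hSn⟩ := exists_automorphism KW hKWn
  set x₀ : Fin k → X := fun i => if h : (i : ℕ) < cellNumber m then z ⟨i, h⟩ else 0 with hx₀
  have hfill : IsFilling b k (cellNumber m) x₀ := by
    refine .of_support (fun j i i' hi hi' => ?_) (fun i j hj => ?_) fun i hi => ?_
    · simp only [hx₀] at hi hi'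
      split_ifs at hi hi' with h h'
      · have := hz.eq_of_ne hi hi'
        simpa [Fin.ext_iff] using this
      all_goals simp at hi hi'
    · simp only [hx₀]
      split_ifs
      · exact (hcoord j (hEtail j hj)).2 _
      · exact map_zero _
    · exact ⟨1, 0, by simp [hx₀, not_lt.2 hi]⟩
  obtain ⟨y, hy, hyne, hspan'⟩ := hfill.exists_ne_zero
  have hyW : ∀ i, y i ∈ W := fun i => (hW _).2 fun j hj => hy.tail i j hj
  have hpos : ∀ i, 0 < ‖y i‖ := fun i => norm_pos_iff.2 (hyne i)
  set x : Fin k → W := fun i => ‖y i‖⁻¹ • ⟨y i, hyW i⟩ with hx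
  have hxy : ∀ i, (x i : X) = ‖y i‖⁻¹ • y i := fun i => rfl
  have hsupp : ∀ j i, b.coord j (x i : X) ≠ 0 → b.coord j (y i) ≠ 0 := fun j i h h0 => h (by
    rw [hxy, map_smul, h0, smul_zero])
  refine ⟨x, S, .of_support (fun j i i' hi hi' => hy.eq_of_ne (hsupp j i hi) (hsupp j i' hi'))
    (fun i j hj => ?_) (fun i hi => ?_), fun i => ?_, hSn, fun v hv => ?_⟩
  · rw [hxy, map_smul, hy.tail i j hj, smul_zero]
  · obtain ⟨j, c, hc⟩ := hy.unit i hi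
    exact ⟨j, ‖y i‖⁻¹ * c, by rw [hxy, hc, smul_smul]⟩
  · change ‖(x i : X)‖ = 1
    rw [hxy, norm_smul, norm_inv, norm_norm, inv_mul_cancel₀ (hpos i).ne']
  · have hmem : (S v : X) ∈ Submodule.map W.subtype (Submodule.span ℝ (Set.range x)) := by
      rw [Submodule.map_span, ← Set.range_comp]
      have h₁ : (S v : X) = v + K v := by
        rw [hS]
        rfl
      have hyx : Submodule.span ℝ (Set.range y) ≤
          Submodule.span ℝ (Set.range (W.subtype ∘ x)) := by
        rw [Submodule.span_le]
        rintro _ ⟨i, rfl⟩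
        have : y i = ‖y i‖ • (W.subtype ∘ x) i := by
          change y i = ‖y i‖ • (x i : X)
          rw [hxy, smul_smul, mul_inv_cancel₀ (hpos i).ne', one_smul]
        rw [this]
        exact Submodule.smul_mem _ _ (Submodule.subset_span ⟨i, rfl⟩)
      have hzy : Submodule.span ℝ (Set.range z) ≤ Submodule.span ℝ (Set.range y) := by
        rw [Submodule.span_le]
        rintro _ ⟨i, rfl⟩
        have : z i = x₀ (Fin.castLE hk i) := by simp [hx₀]
        rw [this]
        exact hspan' _
      rw [h₁]
      exact hyx (hzy (hspan v ⟨v, hv, rfl⟩))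
    obtain ⟨u, hu, huv⟩ := hmem
    rwa [← W.injective_subtype huv]

theorem isL1Equivalent_subtype {X : Type*} [NormedAddCommGroup X] [NormedSpace ℝ X]
    {W : Submodule ℝ X} {ι : Type*} {c : ℝ} {x : ι → W}
    (h : IsL1Equivalent c fun i => (x i : X)) : IsL1Equivalent c x := by
  obtain ⟨A, B, hA, hB, hAB, h⟩ := h
  refine ⟨A, B, hA, hB, hAB, fun s a => ?_⟩
  have hn : ‖∑ i ∈ s, a i • x i‖ = ‖∑ i ∈ s, a i • (x i : X)‖ := by
    change ‖((∑ i ∈ s, a i • x i : W) : X)‖ = _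
    push_cast
    rfl
  rw [hn]
  exact h s a

end TsirelsonTails

theorem mainTheorem5 :
    -- Johnson's theorem
    (∀ (X : Type u) [NormedAddCommGroup X] [NormedSpace ℝ X] [CompleteSpace X]
      (b : UnconditionalSchauderBasis ℕ+ ℝ X),
      IsNormalizedBasis b → IsOneUnconditional b → ¬ IsEquivalentToL1Basis b.basis →
      (∃ c > 0, ∃ L : ℕ+ → ℕ+, TailsEmbedInL1 b.basis c L) →
      ∃ T : Set ℕ+ → X →L[ℝ] X,
        (∀ N : Set ℕ+, N.Infinite → IsSpatialProjection b (T N)) ∧ TreeCondition T) ∧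
    -- the spaces `T[𝓢_ξ, θ]`
    (∃ L : ℕ+ → ℕ+, IsDisjointificationBound.{u} L ∧
      ∀ α : Ordinal.{0} → ℕ+ → Ordinal.{0}, IsApproximating α →
      ∀ (ξ : Ordinal.{0}), 1 ≤ ξ → ξ < Ordinal.omega 1 → ∀ θ : Set.Ioo (0 : ℝ) 1,
      ∃ b : UnconditionalSchauderBasis ℕ+ ℝ (TsirelsonSpace (schreierFamily α ξ) θ),
        b.basis = tsirelsonUnit (schreierFamily α ξ) θ ∧
        IsNormalizedBasis b ∧ IsOneUnconditional b ∧ ¬ IsEquivalentToL1Basis b.basis ∧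
        -- `m`-dimensional subspaces of the tail `X_{L(m)}`
        (∀ (m : ℕ+) (E : Submodule ℝ (basisTail b.basis (L m))), Module.finrank ℝ E = m →
          ∃ (x : Fin (L m) → basisTail b.basis (L m))
            (S : basisTail b.basis (L m) ≃L[ℝ] basisTail b.basis (L m)),
            DisjointlySupported b (fun i => (x i : TsirelsonSpace (schreierFamily α ξ) θ)) ∧
            (∀ i, ‖x i‖ = 1) ∧ IsL1Equivalent ((θ : ℝ) / 3) x ∧
            ‖(S : basisTail b.basis (L m) →L[ℝ] basisTail b.basis (L m))‖ *
              ‖(S.symm : basisTail b.basis (L m) →L[ℝ] basisTail b.basis (L m))‖ ≤ 2 ∧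
            ∀ y ∈ E, S y ∈ Submodule.span ℝ (Set.range x)) ∧
        -- spatial projections with the tree condition, and the number of closed ideals
        (∃ T : Set ℕ+ →
            TsirelsonSpace (schreierFamily α ξ) θ →L[ℝ] TsirelsonSpace (schreierFamily α ξ) θ,
          (∀ N : Set ℕ+, N.Infinite → IsSpatialProjection b (T N)) ∧ TreeCondition T) ∧
        Cardinal.mk {J : Submodule ℝ (TsirelsonSpace (schreierFamily α ξ) θ →L[ℝ]
          TsirelsonSpace (schreierFamily α ξ) θ) // IsClosedIdeal J} =
            2 ^ Cardinal.continuum) := by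
  refine ⟨fun X _ _ _ b hn h1 hne h => exists_treeCondition hn h1 hne h, ?_⟩
  choose l hl using exists_lower_estimate
  set L : ℕ+ → ℕ+ := fun m =>
    ⟨cellNumber m + l (cellNumber m) + 1, Nat.succ_pos _⟩ with hL
  have hLm : ∀ m, (L m : ℕ) = cellNumber m + l (cellNumber m) + 1 := fun m => rfl
  refine ⟨L, isDisjointificationBound fun m => by rw [hLm]; omega,
    fun α hα ξ h1ξ hξ θ => ?_⟩
  set b := tsirelsonBasis (schreierFamily α ξ) θ with hb
  have hbn : IsNormalizedBasis b := isNormalizedBasis_tsirelsonBasis _ θ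
  have hb1 : IsOneUnconditional b := isOneUnconditional_tsirelsonBasis _ θ
  have hbne : ¬ IsEquivalentToL1Basis b.basis := not_isEquivalentToL1Basis_tsirelsonUnit hα hξ θ
  have htail : ∀ (m : ℕ+) (E : Submodule ℝ (basisTail b.basis (L m))), Module.finrank ℝ E = m →
      ∃ (x : Fin (L m) → basisTail b.basis (L m))
        (S : basisTail b.basis (L m) ≃L[ℝ] basisTail b.basis (L m)),
        DisjointlySupported b (fun i => (x i : TsirelsonSpace (schreierFamily α ξ) θ)) ∧
        (∀ i, ‖x i‖ = 1) ∧ IsL1Equivalent ((θ : ℝ) / 3) x ∧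
        ‖(S : basisTail b.basis (L m) →L[ℝ] basisTail b.basis (L m))‖ *
          ‖(S.symm : basisTail b.basis (L m) →L[ℝ] basisTail b.basis (L m))‖ ≤ 2 ∧
        ∀ y ∈ E, S y ∈ Submodule.span ℝ (Set.range x) := by
    intro m E hE
    have hcm : cellNumber m ≤ L m := by rw [hLm]; omega
    obtain ⟨x, S, hx, hx1, hSn, hSE⟩ := exists_filling_of_tail hb1 m.pos hcm
      (fun x => mem_basisTail_iff) E hE
    refine ⟨x, S, hx.disjoint, hx1, isL1Equivalent_subtype ?_, hSn, hSE⟩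
    exact IsFilling.isL1Equivalent (l := l (cellNumber m)) (by rw [hLm]; omega)
      (fun y hy hyl => hl _ α hα ξ h1ξ hξ θ θ.2.1 y hy hyl)
      (fun F hF => mem_schreierFamily_of_card_le hα h1ξ hξ hF) hcm hx hx1
  obtain ⟨T, hT, hTree⟩ := exists_treeCondition hbn hb1 hbne
    ⟨θ / 3, div_pos θ.2.1 (by norm_num), L, fun m E hE => by
      obtain ⟨x, S, -, -, hx, hSn, hSE⟩ := htail m E hE
      exact ⟨x, S, hx, hSn, hSE⟩⟩
  exact ⟨b, rfl, hbn, hb1, hbne, htail, ⟨T, hT, hTree⟩, hTree.mk_closedIdeals b⟩
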